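/- **Setting.** Let $d\ge 1$, $\omega\in\mathbb R^m$ with $\|\omega\|=1$, and let $g:\mathbb R^d\times\mathbb T^m\to\mathbb R^d$ ($\mathbb T^m=\mathbb R^m/\mathbb Z^m$) be $C^3$ and supported in the ball of radius $1/2$ about the origin in its first variable. Let $\nu$ be a probability measure on $[-1,1]$, not concentrated on $0$ and centered: $\int c\,d\nu(c)=0$; write $\overline{c^2}=\int c^2\,d\nu(c)$. A scattering event is described by $\kappa=(b,M,\phi,c)\in\mathbb R^d\times \mathrm{SO}(d,\mathbb R)\times\mathbb T^m\times\mathbb R$; it is admissible for $v\in\mathbb R^d$ if $b\cdot v=0$, $\|b\|\le\frac12$ and $c\in[-1,1]$. For $v\neq0$ let $e=v/\|v\|$, let $y$ be the unique solution of $$\ddot y(\tau)=cMg(M^{-1}y(\tau),\omega\tau+\phi),\qquad y(0)=b-\tfrac12 e,\qquad \dot y(0)=v,$$ and put $$R(v,\kappa)=c\int_0^\infty Mg(M^{-1}y(\tau),\omega\tau+\phi)\,d\tau,\qquad \Delta E(v,\kappa)=\tfrac12\left(\|v+R(v,\kappa)\|^2-\|v\|^2\right)$$ ($R(v,\kappa):=0$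 if the integral does not converge absolutely, which can only happen for slow particles). Let $\overline{f(v)}$ be the average of $f(v,\kappa)$ over $\kappa$ when, independently, $b$ is uniform on the $(d-1)$-dimensional ball of radius $1/2$ orthogonal to $v$, $M$ is Haar distributed, $\phi$ is uniform, and $c$ has law $\nu$. Let $C_d$ be the volume of the ball of radius $1/2$ in $\mathbb R^{d-1}$ and $|S^{d-1}|$ the area of the unit sphere of $\mathbb R^d$ ($|S^0|=2$). **Coefficients.** As $\|v\|\to\infty$, uniformly in $e$ and in the admissible $\kappa$, $$R(v,\kappa)=\sum_{k=1}^3\frac{\alpha^{(k)}(e,\kappa)}{\|v\|^k}+O(\|v\|^{-4}),$$ with $\alpha^{(1)}(e,\kappa)=c\int_{\mathbb R}Mg(M^{-1}(b+(\lambda-\frac12)e),\phi)\,d\lambda$ and $\alpha^{(2)}(e,\kappa)=c\int_{\mathbb R}\lambda\,M(\omega\cdot\nabla_\phi g)(M^{-1}(b+(\lambda-\frac12)e),\phi)\,d\lambda$. Put $\beta^{(0)}=e\cdot\alpha^{(1)}$, $\beta^{(1)}=e\cdot\alpha^{(2)}$, $\beta^{(2)}=\frac12\alpha^{(1)}\cdot\alpha^{(1)}+e\cdot\alpha^{(3)}$.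 **Theorem.** (i) For all unit vectors $e$, $\overline{\alpha^{(1)}(e)}=0=\overline{\alpha^{(2)}(e)}$. Moreover, as $\|v\|\to\infty$, $$\overline{\Delta E(v)}=\frac{B'}{\|v\|^2}+O(\|v\|^{-3}),\qquad \overline{\Delta E(v)^2}=D'^2+O(\|v\|^{-1}),$$ where $B'=\frac{d-1}{2}D'^2$ and $$D'^2=\frac{2}{|S^{d-1}|}\,\frac{\overline{c^2}}{C_d}\int_{\mathbb T^m}d\phi\int_{\mathbb R^{2d}}dy\,dy'\;\|y-y'\|^{-1-d}\,\big((y-y')\cdot g(y,\phi)\big)\big((y-y')\cdot g(y',\phi)\big)\ \ge 0 .$$ For all unit vectors $e$, $\overline{\beta^{(0)}(e)}=\overline{\beta^{(1)}(e)}=0$, $\overline{\beta^{(2)}(e)}=B'$ and $\overline{(\beta^{(0)}(e))^2}=D'^2$. With $D'=\sqrt{D'^2}$, one has $D'>0$ if and only if $\beta^{(0)}(e,\kappa)$ does not vanish identically (on unit vectors $e$ and $\kappa$ admissible for $e$), and this implies that $g$ is not a gradient field, i.e. not of the form $-\nabla_yW$ (with, if $d=1$, $W$ supported in the ball of radius $1/2$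 in $y$). All functions of $\kappa$ averaged here are integrable (for $\Delta E$: when $\|v\|$ is large). (ii) Let $v_0\in\mathbb R^d$ and let $v_{n+1}=v_n+R(v_n,\kappa_n)$ be the random walk in which, given $\kappa_0,\dots,\kappa_{n-1}$, the parameter $\kappa_n=(b_n,M_n,\phi_n,c_n)$ has the law above for the velocity $v_n$. Let $N\in\mathbb N$ be such that $v_0,\dots,v_N$ are almost surely nonzero, and for $n\le N$ put $e_n=v_n/\|v_n\|$, $\beta^{(\ell)}_n=\beta^{(\ell)}(e_n,\kappa_n)$. These variables are square integrable for $\ell\le2$, and for all $n\neq n'$ in $\{0,\dots,N\}$ and $\ell,\ell'\in\{0,1\}$, $$\langle\beta^{(2)}_n\rangle-B'=0=\langle\beta^{(\ell)}_n\rangle,$$ $$\langle\beta^{(\ell)}_n\beta^{(\ell')}_{n'}\rangle=0=\langle\beta^{(\ell)}_n(\beta^{(2)}_{n'}-B')\rangle=\langle(\beta^{(2)}_n-B')(\beta^{(2)}_{n'}-B')\rangle .$$ Moreover, $\langle(\beta^{(2)}_n)^2\rangle$ and $\langle\beta^{(\ell)}_n\beta^{(2)}_n\rangle$ are independent of $n\in\{0,\dots,N\}$,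 where, if $d=1$, it is assumed that the direction of motion is not reversed: $e_n=e_0$ almost surely for all $n\le N$. -/

import Mathlib

open MeasureTheory Filter Asymptotics
open scoped RealInnerProductSpace

universe u

noncomputable section

namespace InelasticScattering

/-- Euclidean space `ℝ^d`. -/
abbrev E (d : ℕ) : Type := EuclideanSpace ℝ (Fin d)

/-- The torus `𝕋^m = ℝ^m / ℤ^m`. -/
abbrev Torus (m : ℕ) : Type := Fin m → UnitAddCircle

/-- The quotient map `ℝ^m → 𝕋^m`. -/
def toTorus {m : ℕ} (x : E m) : Torus m := fun i => (x i : UnitAddCircle)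

/-! ### The rotation group and its normalised Haar measure -/

/-- The rotation group `SO(d, ℝ)`. -/
abbrev SO (d : ℕ) := Matrix.specialOrthogonalGroup (Fin d) ℝ

lemma mem_SO_iff {d : ℕ} (A : Matrix (Fin d) (Fin d) ℝ) :
    A ∈ SO d ↔ A * A.transpose = 1 ∧ A.det = 1 := by
  rw [Matrix.mem_specialOrthogonalGroup_iff, Matrix.mem_orthogonalGroup_iff]

lemma isCompact_SO (d : ℕ) :
    IsCompact {A : Matrix (Fin d) (Fin d) ℝ | A ∈ SO d} := by
  have hcl : IsClosed {A : Matrix (Fin d) (Fin d) ℝ | A ∈ SO d} := by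
    have h : {A : Matrix (Fin d) (Fin d) ℝ | A ∈ SO d}
        = {A | A * A.transpose = 1} ∩ {A | A.det = 1} := by
      ext A
      exact mem_SO_iff A
    rw [h]
    refine IsClosed.inter ?_ ?_
    · exact isClosed_eq (continuous_id.matrix_mul continuous_id.matrix_transpose) continuous_const
    · exact isClosed_eq continuous_id.matrix_det continuous_const
  have hbox : IsCompact (Set.pi Set.univ
      (fun _ : Fin d => Set.pi Set.univ (fun _ : Fin d => Set.Icc (-1 : ℝ) 1))) :=
    isCompact_univ_pi fun _ => isCompact_univ_pi fun _ => isCompact_Icc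
  refine IsCompact.of_isClosed_subset hbox hcl ?_
  intro A hA i _ j _
  have h1 : (A * A.transpose) i i = 1 := by
    rw [((mem_SO_iff A).1 hA).1]
    simp
  rw [Matrix.mul_apply] at h1
  have h2 : A i j * A i j ≤ ∑ k, A i k * A.transpose k i := by
    refine Finset.single_le_sum (f := fun k => A i k * A.transpose k i) ?_ (Finset.mem_univ j)
    intro k _
    simpa using mul_self_nonneg (A i k)
  rw [h1] at h2
  exact abs_le.1 (abs_le_one_iff_mul_self_le_one.2 h2)

instance (d : ℕ) : CompactSpace (SO d) := isCompact_iff_compactSpace.1 (isCompact_SO d)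

lemma coe_inv_SO {d : ℕ} (A : SO d) :
    ((A⁻¹ : SO d) : Matrix (Fin d) (Fin d) ℝ) = (A : Matrix (Fin d) (Fin d) ℝ).transpose := rfl

instance (d : ℕ) : IsTopologicalGroup (SO d) where
  continuous_inv := by
    refine Continuous.subtype_mk ?_ _
    exact continuous_subtype_val.matrix_transpose

instance (d : ℕ) : MeasurableSpace (SO d) := borel _

instance (d : ℕ) : BorelSpace (SO d) := ⟨rfl⟩

/-- The Haar probability measure on `SO(d, ℝ)`. -/
def haarSO (d : ℕ) : Measure (SO d) :=
  Measure.haarMeasure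
    (⟨⟨Set.univ, isCompact_univ⟩, by simp⟩ : TopologicalSpace.PositiveCompacts (SO d))

/-- The action of a rotation matrix on `ℝ^d`. -/
def rot {d : ℕ} (M : SO d) (x : E d) : E d :=
  Matrix.toEuclideanLin (M : Matrix (Fin d) (Fin d) ℝ) x

/-! ### The scatterer -/

/-- `g : ℝ^d × 𝕋^m → ℝ^d` is of class `C³` (that is, its lift to `ℝ^d × ℝ^m` is) and supported in
the ball of radius `1/2` in its first variable.  Since the ball and the torus are compact, `g` and
its derivatives up to order three are then bounded. -/
structure IsForceProfile {d m : ℕ} (g : E d → Torus m → E d) : Prop where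
  contDiff : ContDiff ℝ 3 (fun p : E d × E m => g p.1 (toTorus p.2))
  support : ∀ y φ, 1 / 2 < ‖y‖ → g y φ = 0

/-- `g = -∇_y W` for some `W`, differentiable in `y`.  In dimension one, where every continuous
function is a derivative, `W` is required to be supported in the ball of radius `1/2`, as is usual
for the potential of a localised scatterer (for `d ≥ 2` this can always be achieved by
subtracting from `W(·, φ)` its constant value outside the ball). -/
def IsGradientField {d m : ℕ} (g : E d → Torus m → E d) : Prop :=
  ∃ W : E d → Torus m → ℝ,
    (∀ φ y, HasGradientAt (fun z => W z φ) (-(g y φ)) y) ∧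
    (d = 1 → ∀ φ y, 1 / 2 < ‖y‖ → W y φ = 0)

/-- The derivative `∂_τ = ω · ∇_φ`. -/
def dtau {d m : ℕ} (ω : E m) (g : E d → Torus m → E d) (y : E d) (φ : Torus m) : E d :=
  deriv (fun t : ℝ => g y (φ + toTorus (t • ω))) 0

/-- The parameters `κ = (b, M, φ, c)` of a scattering event: impact parameter, orientation, phase
and coupling. -/
abbrev Kappa (d m : ℕ) := E d × SO d × Torus m × ℝ

/-- The direction `v / ‖v‖`. -/
def dir {d : ℕ} (v : E d) : E d := ‖v‖⁻¹ • v

/-- `κ = (b, M, φ, c)` is admissible for the velocity (or direction) `v`: `b ⟂ v`, `‖b‖ ≤ 1/2` and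
`c ∈ [-1, 1]`. -/
def Admissible {d m : ℕ} (v : E d) (κ : Kappa d m) : Prop :=
  ⟪κ.1, v⟫ = 0 ∧ ‖κ.1‖ ≤ 1 / 2 ∧ κ.2.2.2 ∈ Set.Icc (-1 : ℝ) 1

/-- The force `c M g(M⁻¹ y, ω τ + φ)` of a scatterer centred at the origin. -/
def force {d m : ℕ} (g : E d → Torus m → E d) (ω : E m) (κ : Kappa d m) (y : E d) (τ : ℝ) : E d :=
  κ.2.2.2 • rot κ.2.1 (g (rot κ.2.1⁻¹ y) (toTorus (τ • ω) + κ.2.2.1))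

/-- `y` solves `y'' = c M g(M⁻¹ y, ω τ + φ)`, `y(0) = b - v / (2‖v‖)`, `y'(0) = v`. -/
def IsTrajectory {d m : ℕ} (g : E d → Torus m → E d) (ω : E m) (v : E d) (κ : Kappa d m)
    (y : ℝ → E d) : Prop :=
  (∀ τ, DifferentiableAt ℝ y τ) ∧
  (∀ τ, HasDerivAt (deriv y) (force g ω κ (y τ) τ) τ) ∧
  y 0 = κ.1 - (1 / 2 : ℝ) • dir v ∧
  deriv y 0 = v

/-- The solution of the equation of motion (it exists and is unique, because the force is bounded
and Lipschitz in `y`). -/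
def trajectory {d m : ℕ} (g : E d → Torus m → E d) (ω : E m) (v : E d) (κ : Kappa d m) : ℝ → E d :=
  Classical.epsilon (IsTrajectory g ω v κ)

/-- The momentum transfer `R(v, κ) = c ∫_0^∞ M g(M⁻¹ y(τ), ω τ + φ) dτ`. -/
def R {d m : ℕ} (g : E d → Torus m → E d) (ω : E m) (v : E d) (κ : Kappa d m) : E d :=
  ∫ τ in Set.Ioi (0 : ℝ), force g ω κ (trajectory g ω v κ τ) τ

/-- The energy transfer `ΔE(v, κ)`. -/
def deltaE {d m : ℕ} (g : E d → Torus m → E d) (ω : E m) (v : E d) (κ : Kappa d m) : ℝ :=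
  (1 / 2) * (‖v + R g ω v κ‖ ^ 2 - ‖v‖ ^ 2)

/-- The coefficients `α^(k)(e, κ)` of the high velocity expansion
`R(s e, κ) ∼ ∑_{k ≥ 1} α^(k)(e, κ) / s^k`, `s → ∞`, one after the other; `α^(0) = 0`, since
`R(s e, κ) → 0`. -/
def alpha {d m : ℕ} (g : E d → Torus m → E d) (ω : E m) (k : ℕ) (e : E d) (κ : Kappa d m) : E d :=
  limUnder atTop (fun s : ℝ =>
    s ^ k • (R g ω (s • e) κ - ∑ j : Fin k, (s ^ (j : ℕ))⁻¹ • alpha g ω j e κ))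
termination_by k
decreasing_by exact j.2

/-- The coefficient `α^(1)(e, κ)`, explicitly. -/
def alphaOne {d m : ℕ} (g : E d → Torus m → E d) (e : E d) (κ : Kappa d m) : E d :=
  κ.2.2.2 • ∫ s : ℝ, rot κ.2.1 (g (rot κ.2.1⁻¹ (κ.1 + (s - 1 / 2) • e)) κ.2.2.1)

/-- The coefficient `α^(2)(e, κ)`, explicitly. -/
def alphaTwo {d m : ℕ} (g : E d → Torus m → E d) (ω : E m) (e : E d) (κ : Kappa d m) : E d :=
  κ.2.2.2 • ∫ s : ℝ, s • rot κ.2.1 (dtau ω g (rot κ.2.1⁻¹ (κ.1 + (s - 1 / 2) • e)) κ.2.2.1)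

/-- The coefficients `β^(ℓ)(e, κ)` of the expansion of `ΔE` in powers of `1 / ‖v‖`, namely
`β^(ℓ) = e · α^(ℓ+1) + 1/2 ∑_{i + j = ℓ} α^(i) · α^(j)`; so `β^(0) = e · α^(1)`,
`β^(1) = e · α^(2)`, `β^(2) = α^(1) · α^(1) / 2 + e · α^(3)`. -/
def beta {d m : ℕ} (g : E d → Torus m → E d) (ω : E m) (l : ℕ) (e : E d) (κ : Kappa d m) : ℝ :=
  ⟪e, alpha g ω (l + 1) e κ⟫ +
    (1 / 2) * ∑ p ∈ Finset.HasAntidiagonal.antidiagonal l, ⟪alpha g ω p.1 e κ, alpha g ω p.2 e κ⟫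

/-! ### Averages -/

/-- The uniform probability measure on the `(d-1)`-dimensional ball of radius `1/2` in the
hyperplane orthogonal to `v`. -/
def discLaw {d : ℕ} (v : E d) : Measure (E d) :=
  (ProbabilityTheory.cond (volume : Measure ((ℝ ∙ v)ᗮ : Submodule ℝ (E d)))
    (Metric.closedBall 0 (1 / 2))).map Subtype.val

/-- The law of `κ = (b, M, φ, c)` for a particle of velocity (or direction) `v`: independently,
`b` is uniform on the ball orthogonal to `v`, `M` and `φ` are uniform, and `c` has law `ν`. -/
def kappaLaw {d : ℕ} (m : ℕ) (ν : Measure ℝ) (v : E d) : Measure (Kappa d m) :=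
  (discLaw v).prod ((haarSO d).prod ((volume : Measure (Torus m)).prod ν))

/-- `C_d`, the volume of the ball of radius `1/2` in `ℝ^(d-1)`. -/
def ballVol (d : ℕ) : ℝ := (volume : Measure (E (d - 1))).real (Metric.closedBall 0 (1 / 2))

/-- The surface area of the unit sphere of `ℝ^d` (equal to `2` if `d = 1`). -/
def sphereArea (d : ℕ) : ℝ := (volume : Measure (E d)).toSphere.real Set.univ

/-- The constant `D'²`. -/
def Dsq {d m : ℕ} (g : E d → Torus m → E d) (ν : Measure ℝ) : ℝ :=
  2 / sphereArea d * ((∫ c, c ^ 2 ∂ν) / ballVol d) *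
    ∫ φ : Torus m, ∫ y : E d, ∫ y' : E d,
      ⟪y - y', g y φ⟫ * ⟪y - y', g y' φ⟫ / ‖y - y'‖ ^ (1 + d)

/-- The constant `B' = (d - 1) / 2 · D'²`. -/
def Bcoef {d m : ℕ} (g : E d → Torus m → E d) (ν : Measure ℝ) : ℝ :=
  ((d : ℝ) - 1) / 2 * Dsq g ν

/-! ### The random walk -/

/-- `(v_n, κ_n)` is the random walk `v_{n+1} = v_n + R(v_n, κ_n)` started at `v₀`: given the past
`κ_0, …, κ_{n-1}`, which determines `v_n`, the parameter `κ_n` has law `kappaLaw m ν v_n`. -/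
structure IsVelocityWalk {d m : ℕ} (g : E d → Torus m → E d) (ω : E m) (ν : Measure ℝ)
    {Ω : Type u} [MeasurableSpace Ω] (P : Measure Ω) (v₀ : E d)
    (v : ℕ → Ω → E d) (κ : ℕ → Ω → Kappa d m) : Prop where
  measurable_kappa : ∀ n, Measurable (κ n)
  init : ∀ x, v 0 x = v₀
  step : ∀ n x, v (n + 1) x = v n x + R g ω (v n x) (κ n x)
  law : ∀ (n : ℕ) (A : Set Ω),
    MeasurableSet[⨆ k ∈ Finset.range n, MeasurableSpace.comap (κ k) inferInstance] A →
    ∀ S : Set (Kappa d m), MeasurableSet S →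
      P (A ∩ κ n ⁻¹' S) = ∫⁻ x in A, kappaLaw m ν (v n x) S ∂P

end InelasticScattering

end

open InelasticScattering

namespace InelasticScattering

open Topology

/-! ### Rotations -/

/-! Expansion. In the frame of the scatterer the rotation `M` disappears from the force and only the
vectors `u = M⁻¹ e` and `M⁻¹ b` remain. With ε = 1/‖v‖ and time measured in units of ε, the particle
has unit speed and the force carries a factor ε². To leading order the particle moves on the line
`line u b`; the first correction is ε² c `deflection`, and the phase advances by ε s. Taylor
expansion of `g` in space and phase then gives `R` up to O(ε⁴) (`norm_integral_force_expansion_le`,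
`exists_R_expansion`). The line meets the ball for s in [0, 1] only, so integration up to s = 2
leaves room for the perturbed trajectory to get out. The limits defining `alpha` then pick out
explicit coefficients (`alpha_eq`): α^(1) and α^(2) are linear in c, α^(3) is a linear plus a
quadratic term. Linear terms have mean zero because `ν` is centred.

Means. The averages of (β^(0))² and β^(2) thus reduce to averages of quadratic expressions in `g`
along a line, that is, of two-point kernels k(x, z) with x on the line and z = t u. Averaging over
the impact parameter and integrating along the line is Lebesgue integration over x
(`integral_discLaw_line`); averaging over `M` and integrating over t is integration over z in polar
coordinates without the Jacobian, hence with the weight ‖z‖^{1-d} (`integral_haar_ray`). This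
produces the double integral of D'².

The relation B' = (d-1)/2 · D'² is a divergence identity: for fixed x, the derivative of z ↦
‖z‖^{1-d} ⟪z, g(x+z)⟫ in the direction g(x) integrates to zero, and the product rule splits it into
the kernels of |α^(1)|²/2, of e·α^(3) and of -(d-1)/2 times (β^(0))² (`integral_weight_divergence`,
`integral_weight_kernel_identity`). For d = 1 the rotation group is trivial, so the polar coordinate
argument needs an even kernel; β^(2) is then treated ray by ray (`integral_kernel_ray_eq_zero`).

Positivity. D'² is the mean of the square of c times a continuous function, under a law that charges
every neighbourhood of an admissible (b, M, φ). For a gradient field β^(0) is the work along a line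
whose ends can be joined outside the support, hence zero.

Walk. Given the past, κ_n has a law for which the mean of β^(ℓ) does not depend on the velocity, so
centred variables at different times are orthogonal (`IsVelocityWalk.integral_mul_eq`). Second
moments at equal times are independent of the direction by rotation invariance. Making conditional
expectations rigorous requires measurability of `R` in all variables, whence the continuous
dependence of the flow on its parameters, and measurability of the disc law in the velocity. -/

lemma rot_apply {d : ℕ} (M : SO d) (x : E d) (i : Fin d) :
    rot M x i = ∑ j, (M : Matrix (Fin d) (Fin d) ℝ) i j * x j := by
  simp [rot, Matrix.toLpLin_apply, Matrix.mulVec, dotProduct]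

lemma rot_one {d : ℕ} (x : E d) : rot (1 : SO d) x = x := by
  simp [rot]

lemma rot_mul {d : ℕ} (M N : SO d) (x : E d) : rot (M * N) x = rot M (rot N x) := by
  simp [rot, Matrix.toLpLin_apply]

lemma rot_inv_rot {d : ℕ} (M : SO d) (x : E d) : rot M⁻¹ (rot M x) = x := by
  rw [← rot_mul, inv_mul_cancel, rot_one]

lemma rot_rot_inv {d : ℕ} (M : SO d) (x : E d) : rot M (rot M⁻¹ x) = x := by
  rw [← rot_mul, mul_inv_cancel, rot_one]

lemma inner_rot_left {d : ℕ} (M : SO d) (x y : E d) : ⟪rot M x, y⟫ = ⟪x, rot M⁻¹ y⟫ := by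
  simp only [PiLp.inner_apply, rot_apply, coe_inv_SO, Matrix.transpose_apply, RCLike.inner_apply,
    conj_trivial, Finset.sum_mul, Finset.mul_sum]
  rw [Finset.sum_comm]
  refine Finset.sum_congr rfl fun i _ => Finset.sum_congr rfl fun j _ => ?_
  ring

lemma inner_rot_rot {d : ℕ} (M : SO d) (x y : E d) : ⟪rot M x, rot M y⟫ = ⟪x, y⟫ := by
  rw [inner_rot_left, rot_inv_rot]

lemma norm_rot {d : ℕ} (M : SO d) (x : E d) : ‖rot M x‖ = ‖x‖ := by
  rw [norm_eq_sqrt_real_inner, inner_rot_rot, ← norm_eq_sqrt_real_inner]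

/-- A rotation as a linear isometry equivalence. -/
noncomputable def rotL {d : ℕ} (M : SO d) : E d ≃ₗᵢ[ℝ] E d where
  toFun := rot M
  invFun := rot M⁻¹
  left_inv := rot_inv_rot M
  right_inv := rot_rot_inv M
  map_add' x y := by simp [rot]
  map_smul' c x := by simp [rot]
  norm_map' := norm_rot M

lemma rot_add {d : ℕ} (M : SO d) (x y : E d) : rot M (x + y) = rot M x + rot M y :=
  map_add (rotL M) x y

lemma rot_sub {d : ℕ} (M : SO d) (x y : E d) : rot M (x - y) = rot M x - rot M y :=
  map_sub (rotL M) x y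

lemma rot_smul {d : ℕ} (M : SO d) (c : ℝ) (x : E d) : rot M (c • x) = c • rot M x :=
  map_smul (rotL M) c x

lemma measurePreserving_rot {d : ℕ} (M : SO d) :
    MeasurePreserving (rot M) (volume : Measure (E d)) volume :=
  (rotL M).measurePreserving

lemma continuous_rot_uncurry {d : ℕ} : Continuous fun p : SO d × E d => rot p.1 p.2 := by
  refine (PiLp.homeomorph 2 (fun _ : Fin d => ℝ)).comp_continuous_iff.1 ?_
  refine continuous_pi fun i => ?_
  change Continuous fun p : SO d × E d => rot p.1 p.2 i
  simp only [rot_apply]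
  refine continuous_finsetSum _ fun j _ => Continuous.mul ?_ ?_
  · exact ((continuous_subtype_val.comp continuous_fst).matrix_elem i j)
  · exact (PiLp.continuous_apply 2 _ j).comp continuous_snd

attribute [local irreducible] rot in
lemma continuous_rot_comp {d : ℕ} {X : Type*} [TopologicalSpace X] {M : X → SO d} {f : X → E d}
    (hM : Continuous M) (hf : Continuous f) :
    Continuous fun x => rot (M x) (f x) :=
  continuous_rot_uncurry.comp (hM.prodMk hf)

instance (d : ℕ) : SecondCountableTopology (SO d) :=
  haveI : SecondCountableTopology (Matrix (Fin d) (Fin d) ℝ) :=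
    inferInstanceAs (SecondCountableTopology (Fin d → Fin d → ℝ))
  Topology.IsInducing.subtypeVal.secondCountableTopology

instance (d : ℕ) : (haarSO d).IsHaarMeasure := by unfold haarSO; infer_instance

instance (d : ℕ) : IsProbabilityMeasure (haarSO d) :=
  ⟨Measure.haarMeasure_self⟩

lemma exists_rot_eq_of_det {d : ℕ} (f : E d ≃ₗᵢ[ℝ] E d)
    (hf : LinearMap.det (f.toLinearEquiv : E d →ₗ[ℝ] E d) = 1) :
    ∃ Q : SO d, ∀ x, rot Q x = f x := by
  set A : Matrix (Fin d) (Fin d) ℝ :=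
    Matrix.toEuclideanLin.symm (f.toLinearEquiv : E d →ₗ[ℝ] E d) with hA
  have hA' : Matrix.toEuclideanLin A = (f.toLinearEquiv : E d →ₗ[ℝ] E d) := by simp [hA]
  have hdet : A.det = 1 := by
    rw [← hf, ← hA']
    change A.det = LinearMap.det (Matrix.toLpLin 2 2 A)
    rw [Matrix.toLpLin_eq_toLin, LinearMap.det_toLin]
  have hmul : A.transpose * A = 1 := by
    apply Matrix.toEuclideanLin.injective
    refine LinearMap.ext fun x => ?_
    refine ext_inner_right ℝ fun y => ?_
    have h1 : Matrix.toEuclideanLin (A.transpose * A) x =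
        Matrix.toEuclideanLin A.transpose (Matrix.toEuclideanLin A x) := by
      simp [Matrix.toLpLin_apply]
    have h2 : A.transpose = A.conjTranspose := by
      rw [Matrix.conjTranspose_eq_transpose_of_trivial]
    rw [h1, h2, Matrix.toEuclideanLin_conjTranspose_eq_adjoint, LinearMap.adjoint_inner_left, hA']
    simp
  exact ⟨⟨A, (mem_SO_iff A).2 ⟨mul_eq_one_comm.1 hmul, hdet⟩⟩, fun x => by
    change Matrix.toEuclideanLin A x = _
    rw [hA']; rfl⟩

lemma det_reflection_hyperplane {d : ℕ} {w : E d} (hw : w ≠ 0) :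
    LinearMap.det ((ℝ ∙ w)ᗮ.reflection.toLinearEquiv : E d →ₗ[ℝ] E d) = -1 := by
  have h := (ℝ ∙ w)ᗮ.det_reflection
  rw [Submodule.orthogonal_orthogonal, finrank_span_singleton hw, pow_one] at h
  exact h

lemma exists_ne_zero_inner_eq_zero {d : ℕ} (hd : 2 ≤ d) (y : E d) :
    ∃ w : E d, w ≠ 0 ∧ ⟪w, y⟫ = 0 := by
  have h := (ℝ ∙ y).finrank_add_finrank_orthogonal
  have h1 : Module.finrank ℝ (ℝ ∙ y) ≤ 1 := by
    have := finrank_span_finset_le_card (R := ℝ) ({y} : Finset (E d))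
    rwa [Finset.coe_singleton, Finset.card_singleton] at this
  rw [finrank_euclideanSpace_fin] at h
  have : 0 < Module.finrank ℝ (ℝ ∙ y)ᗮ := by omega
  obtain ⟨w, hw⟩ := Module.finrank_pos_iff_exists_ne_zero.1 this
  refine ⟨w, by simpa using hw, ?_⟩
  have := w.2
  rw [Submodule.mem_orthogonal_singleton_iff_inner_left] at this
  exact this

/-- `SO(d)` acts transitively on spheres if `d ≥ 2`. -/
lemma exists_rot_eq {d : ℕ} (hd : 2 ≤ d) {x y : E d} (h : ‖x‖ = ‖y‖) : ∃ Q : SO d, rot Q x = y := by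
  by_cases hxy : x = y
  · exact ⟨1, by rw [rot_one, hxy]⟩
  obtain ⟨w, hw, hwy⟩ := exists_ne_zero_inner_eq_zero hd y
  -- The reflection exchanging x and y has determinant -1; a second reflection, in the hyperplane
  -- orthogonal to some w ⟂ y, fixes y and restores determinant 1. Such a w exists because d ≥ 2.
  obtain ⟨Q, hQ⟩ := exists_rot_eq_of_det
    ((ℝ ∙ (x - y))ᗮ.reflection.trans (ℝ ∙ w)ᗮ.reflection) (by
      have := LinearMap.det_comp ((ℝ ∙ w)ᗮ.reflection.toLinearEquiv : E d →ₗ[ℝ] E d)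
        ((ℝ ∙ (x - y))ᗮ.reflection.toLinearEquiv : E d →ₗ[ℝ] E d)
      rw [det_reflection_hyperplane hw, det_reflection_hyperplane (sub_ne_zero.2 hxy)] at this
      exact this.trans (by norm_num))
  refine ⟨Q, ?_⟩
  rw [hQ, LinearIsometryEquiv.trans_apply, Submodule.reflection_sub h,
    Submodule.reflection_eq_self_iff, Submodule.mem_orthogonal_singleton_iff_inner_right]
  exact hwy

/-! ### The torus -/

/-- Smoothness of `g` is assumed for its lift to `E d × E m`. Openness makes the product with the
identity a quotient map again, so continuity descends to `E d × Torus m`, where compactness gives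
bounds. -/
lemma isOpenQuotientMap_toTorus {m : ℕ} : IsOpenQuotientMap (toTorus : E m → Torus m) := by
  have h : IsOpenQuotientMap (Pi.map fun (_ : Fin m) (x : ℝ) => (x : UnitAddCircle)) :=
    IsOpenQuotientMap.piMap fun _ => QuotientAddGroup.isOpenQuotientMap_mk
  exact h.comp (PiLp.homeomorph 2 (fun _ : Fin m => ℝ)).isOpenQuotientMap

lemma toTorus_add {m : ℕ} (x y : E m) : toTorus (x + y) = toTorus x + toTorus y := by
  ext i; simp [toTorus]

lemma toTorus_zero {m : ℕ} : toTorus (0 : E m) = 0 := by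
  ext i; simp [toTorus]

lemma continuous_toTorus {m : ℕ} : Continuous (toTorus : E m → Torus m) :=
  isOpenQuotientMap_toTorus.continuous

lemma exists_toTorus_eq {m : ℕ} (φ : Torus m) : ∃ x, toTorus x = φ :=
  isOpenQuotientMap_toTorus.surjective φ

instance : IsProbabilityMeasure (volume : Measure UnitAddCircle) :=
  ⟨UnitAddCircle.measure_univ⟩

instance (m : ℕ) : IsProbabilityMeasure (volume : Measure (Torus m)) := by
  rw [volume_pi]; infer_instance

/-! ### Calculus of force profiles -/

/-- Functions on `ℝ^d × 𝕋^m` of class `C^k`, supported in the ball of radius `1/2` in the first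
variable. -/
structure Prof {d m : ℕ} {X : Type*} [NormedAddCommGroup X] [NormedSpace ℝ X] (k : ℕ)
    (f : E d → Torus m → X) : Prop where
  contDiff : ContDiff ℝ k (fun p : E d × E m => f p.1 (toTorus p.2))
  support : ∀ y φ, 1 / 2 < ‖y‖ → f y φ = 0

/-- The derivative `ω · ∇_φ` of a vector valued function. -/
noncomputable def Dtau {d m : ℕ} {X : Type*} [NormedAddCommGroup X] [NormedSpace ℝ X] (ω : E m)
    (f : E d → Torus m → X) (y : E d) (φ : Torus m) : X :=
  deriv (fun t : ℝ => f y (φ + toTorus (t • ω))) 0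

/-- The derivative with respect to the first variable. -/
noncomputable def Dspace {d m : ℕ} {X : Type*} [NormedAddCommGroup X] [NormedSpace ℝ X]
    (f : E d → Torus m → X) (y : E d) (φ : Torus m) : E d →L[ℝ] X :=
  fderiv ℝ (fun z => f z φ) y

namespace Prof

variable {d m : ℕ} {X : Type*} [NormedAddCommGroup X] [NormedSpace ℝ X] {k : ℕ}
  {f : E d → Torus m → X}

lemma continuous (hf : Prof k f) : Continuous fun p : E d × Torus m => f p.1 p.2 := by
  have h : IsOpenQuotientMap (Prod.map id toTorus : E d × E m → E d × Torus m) :=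
    IsOpenQuotientMap.id.prodMap isOpenQuotientMap_toTorus
  exact h.continuous_comp_iff.1 hf.contDiff.continuous

lemma exists_bound (hf : Prof k f) : ∃ K, 0 ≤ K ∧ ∀ y φ, ‖f y φ‖ ≤ K := by
  have hc : IsCompact (Metric.closedBall (0 : E d) (1 / 2) ×ˢ (Set.univ : Set (Torus m))) :=
    (isCompact_closedBall 0 _).prod isCompact_univ
  obtain ⟨K, hK⟩ := hc.exists_bound_of_continuousOn hf.continuous.continuousOn
  refine ⟨max K 0, le_max_right _ _, fun y φ => ?_⟩
  by_cases hy : ‖y‖ ≤ 1 / 2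
  · exact (hK (y, φ) ⟨by simpa using hy, Set.mem_univ _⟩).trans (le_max_left _ _)
  · rw [hf.support y φ (not_le.1 hy), norm_zero]
    exact le_max_right _ _

lemma hasDerivAt_aux (hf : Prof (k + 1) f) (ω : E m) (y : E d) (x : E m) (t : ℝ) :
    HasDerivAt (fun t : ℝ => f y (toTorus x + toTorus (t • ω)))
      (fderiv ℝ (fun p : E d × E m => f p.1 (toTorus p.2)) (y, x + t • ω) (0, ω)) t := by
  have h1 := (hf.contDiff.differentiable (by simp) (y, x + t • ω)).hasFDerivAt
  have h2 : HasDerivAt (fun t : ℝ => ((y, x + t • ω) : E d × E m)) (0, ω) t := by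
    refine (hasDerivAt_const t y).prodMk ?_
    simpa using ((hasDerivAt_id t).smul_const ω).const_add x
  have h3 := h1.comp_hasDerivAt t h2
  refine h3.congr_of_eventuallyEq (Eventually.of_forall fun t => ?_)
  simp [toTorus_add]

lemma dtau_lift (hf : Prof (k + 1) f) (ω : E m) (y : E d) (x : E m) :
    Dtau ω f y (toTorus x) =
      fderiv ℝ (fun p : E d × E m => f p.1 (toTorus p.2)) (y, x) (0, ω) := by
  have h := (hf.hasDerivAt_aux ω y x 0).deriv
  rwa [zero_smul, add_zero] at h

lemma hasDerivAt_dtau (hf : Prof (k + 1) f) (ω : E m) (y : E d) (φ : Torus m) (t : ℝ) :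
    HasDerivAt (fun t : ℝ => f y (φ + toTorus (t • ω))) (Dtau ω f y (φ + toTorus (t • ω))) t := by
  obtain ⟨x, rfl⟩ := exists_toTorus_eq φ
  rw [← toTorus_add, hf.dtau_lift]
  exact hf.hasDerivAt_aux ω y x t

/-- This and `dspace` lose one order of differentiability and keep the support, so that compactness
bounds all derivatives up to order three uniformly, and with them all Taylor remainders. -/
lemma dtau (hf : Prof (k + 1) f) (ω : E m) : Prof k (Dtau ω f) where
  contDiff := by
    have h : (fun p : E d × E m => Dtau ω f p.1 (toTorus p.2)) = fun p =>
        fderiv ℝ (fun p : E d × E m => f p.1 (toTorus p.2)) p (0, ω) := by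
      funext p; exact hf.dtau_lift ω p.1 p.2
    rw [h]
    exact (hf.contDiff.fderiv_right (by norm_cast)).clm_apply contDiff_const
  support y φ hy := by
    have h : (fun t : ℝ => f y (φ + toTorus (t • ω))) = fun _ => 0 := by
      funext t; exact hf.support _ _ hy
    rw [Dtau, h, deriv_const]

lemma hasFDerivAt_aux (hf : Prof (k + 1) f) (y : E d) (x : E m) :
    HasFDerivAt (fun z => f z (toTorus x))
      ((fderiv ℝ (fun p : E d × E m => f p.1 (toTorus p.2)) (y, x)).comp
        (ContinuousLinearMap.inl ℝ (E d) (E m))) y := by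
  have h1 := (hf.contDiff.differentiable (by simp) (y, x)).hasFDerivAt
  exact h1.comp (f := fun z : E d => (z, x)) y (hasFDerivAt_prodMk_left y x)

lemma hasFDerivAt (hf : Prof (k + 1) f) (y : E d) (φ : Torus m) :
    HasFDerivAt (fun z => f z φ) (Dspace f y φ) y := by
  obtain ⟨x, rfl⟩ := exists_toTorus_eq φ
  exact (hf.hasFDerivAt_aux y x).differentiableAt.hasFDerivAt

lemma dspace (hf : Prof (k + 1) f) : Prof k (Dspace f) where
  contDiff := by
    have h : (fun p : E d × E m => Dspace f p.1 (toTorus p.2)) = fun p =>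
        (fderiv ℝ (fun p : E d × E m => f p.1 (toTorus p.2)) p).comp
          (ContinuousLinearMap.inl ℝ (E d) (E m)) := by
      funext p; exact (hf.hasFDerivAt_aux p.1 p.2).fderiv
    rw [h]
    exact (hf.contDiff.fderiv_right (by norm_cast)).clm_comp contDiff_const
  support y φ hy := by
    have h : (fun z => f z φ) =ᶠ[nhds y] fun _ => 0 := by
      filter_upwards [continuous_norm.continuousAt.eventually (lt_mem_nhds hy)] with z hz
      exact hf.support _ _ hz
    rw [Dspace, h.fderiv_eq, fderiv_fun_const]
    rfl

lemma exists_lipschitz_space (hf : Prof (k + 1) f) :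
    ∃ K, 0 ≤ K ∧ ∀ y z φ, ‖f y φ - f z φ‖ ≤ K * ‖y - z‖ := by
  obtain ⟨K, hK0, hK⟩ := hf.dspace.exists_bound
  exact ⟨K, hK0, fun y z φ => convex_univ.norm_image_sub_le_of_norm_hasFDerivWithin_le
    (fun x _ => (hf.hasFDerivAt x φ).hasFDerivWithinAt) (fun x _ => hK x φ)
    (Set.mem_univ z) (Set.mem_univ y)⟩

lemma exists_lipschitz_time (hf : Prof (k + 1) f) (ω : E m) :
    ∃ K, 0 ≤ K ∧ ∀ y φ (t : ℝ), ‖f y (φ + toTorus (t • ω)) - f y φ‖ ≤ K * |t| := by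
  obtain ⟨K, hK0, hK⟩ := (hf.dtau ω).exists_bound
  refine ⟨K, hK0, fun y φ t => ?_⟩
  have := convex_univ.norm_image_sub_le_of_norm_hasDerivWithin_le
    (f := fun t : ℝ => f y (φ + toTorus (t • ω)))
    (fun t _ => (hf.hasDerivAt_dtau ω y φ t).hasDerivWithinAt) (fun t _ => hK y _)
    (Set.mem_univ 0) (Set.mem_univ t)
  simpa [toTorus_zero] using this

/-- Taylor's formula in the first variable. -/
lemma exists_taylor_space (hf : Prof (k + 2) f) :
    ∃ K, 0 ≤ K ∧ ∀ y z φ, ‖f z φ - f y φ - Dspace f y φ (z - y)‖ ≤ K * ‖z - y‖ ^ 2 := by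
  obtain ⟨K, hK0, hK⟩ := (dspace (k := k + 1) hf).exists_lipschitz_space
  refine ⟨K, hK0, fun y z φ => ?_⟩
  have h := (convex_segment y z).norm_image_sub_le_of_norm_hasFDerivWithin_le'
    (f := fun x => f x φ) (f' := fun x => Dspace f x φ) (φ := Dspace f y φ) (C := K * ‖z - y‖)
    (fun x _ => (hasFDerivAt (k := k + 1) hf x φ).hasFDerivWithinAt)
    (fun x hx => (hK x y φ).trans (mul_le_mul_of_nonneg_left ?_ hK0))
    (left_mem_segment ℝ y z) (right_mem_segment ℝ y z)
  · exact h.trans_eq (by ring)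
  · obtain ⟨t, ht, rfl⟩ := (segment_eq_image' ℝ y z ▸ hx)
    rw [add_sub_cancel_left, norm_smul, Real.norm_of_nonneg ht.1]
    exact mul_le_of_le_one_left (norm_nonneg _) ht.2

end Prof

/-- If `f(0) = 0` and `‖f'‖ ≤ K` on `[0, T]` then `‖f‖ ≤ K T` there. -/
lemma norm_le_of_hasDerivAt_bound {X : Type*} [NormedAddCommGroup X] [NormedSpace ℝ X]
    {f f' : ℝ → X} {K T : ℝ} (hK : 0 ≤ K) (h0 : f 0 = 0)
    (hf : ∀ t ∈ Set.Icc 0 T, HasDerivAt f (f' t) t)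
    (hb : ∀ t ∈ Set.Icc 0 T, ‖f' t‖ ≤ K) : ∀ t ∈ Set.Icc 0 T, ‖f t‖ ≤ K * T := by
  intro t ht
  have := norm_image_sub_le_of_norm_deriv_le_segment' (f := f) (f' := f') (C := K)
    (fun x hx => (hf x hx).hasDerivWithinAt) (fun x hx => hb x (Set.Ico_subset_Icc_self hx)) t ht
  rw [h0, sub_zero, sub_zero] at this
  exact this.trans (mul_le_mul_of_nonneg_left ht.2 hK)

/-- Taylor's formula of order two along the phase flow. -/
lemma Prof.exists_taylor_time {d m : ℕ} {X : Type*} [NormedAddCommGroup X] [NormedSpace ℝ X]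
    {f : E d → Torus m → X} (hf : Prof 3 f) (ω : E m) :
    ∃ K, 0 ≤ K ∧ ∀ y φ (t : ℝ), 0 ≤ t →
      ‖f y (φ + toTorus (t • ω)) - f y φ - t • Dtau ω f y φ
        - (t ^ 2 / 2) • Dtau ω (Dtau ω f) y φ‖ ≤ K * t ^ 3 := by
  have hf1 : Prof 2 (Dtau ω f) := Prof.dtau (k := 2) hf ω
  have hf2 : Prof 1 (Dtau ω (Dtau ω f)) := Prof.dtau (k := 1) hf1 ω
  obtain ⟨K, hK0, hK⟩ := Prof.exists_lipschitz_time (k := 0) hf2 ω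
  refine ⟨K, hK0, fun y φ T hT => ?_⟩
  have hT' : T ∈ Set.Icc 0 T := ⟨hT, le_rfl⟩
  have h1 : ∀ t ∈ Set.Icc 0 T, ‖Dtau ω f y (φ + toTorus (t • ω)) - Dtau ω f y φ
      - t • Dtau ω (Dtau ω f) y φ‖ ≤ K * T * T := by
    refine norm_le_of_hasDerivAt_bound (f' := fun t => Dtau ω (Dtau ω f) y (φ + toTorus (t • ω)) -
      (1 : ℝ) • Dtau ω (Dtau ω f) y φ) (by positivity) (by simp [toTorus_zero]) (fun t _ => ?_)
      (fun t ht => ?_)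
    · exact ((Prof.hasDerivAt_dtau (k := 1) hf1 ω y φ t).sub_const _).sub
        ((hasDerivAt_id t).smul_const _)
    · rw [one_smul]
      refine (hK y φ t).trans ?_
      rw [abs_of_nonneg ht.1]
      exact mul_le_mul_of_nonneg_left ht.2 hK0
  have h2 := norm_le_of_hasDerivAt_bound (T := T)
    (f := fun t => f y (φ + toTorus (t • ω)) - f y φ - t • Dtau ω f y φ
        - (t ^ 2 / 2) • Dtau ω (Dtau ω f) y φ)
    (f' := fun t => Dtau ω f y (φ + toTorus (t • ω)) - Dtau ω f y φ
      - t • Dtau ω (Dtau ω f) y φ) (K := K * T * T) (by positivity) (by simp [toTorus_zero])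
      (fun t _ => ?_) h1 T hT'
  · exact h2.trans_eq (by ring)
  · have e1 := (Prof.hasDerivAt_dtau (k := 2) hf ω y φ t).sub_const (f y φ)
    have e2 := (hasDerivAt_id t).smul_const (Dtau ω f y φ)
    have e3 : HasDerivAt (fun t : ℝ => (t ^ 2 / 2) • Dtau ω (Dtau ω f) y φ)
        (t • Dtau ω (Dtau ω f) y φ) t := by
      refine HasDerivAt.smul_const ?_ _
      have := ((hasDerivAt_id t).pow 2).div_const 2
      simpa using this
    have := (e1.sub e2).sub e3
    rw [one_smul] at this
    exact this

lemma IsForceProfile.prof {d m : ℕ} {g : E d → Torus m → E d} (hg : IsForceProfile g) :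
    Prof 3 g := ⟨hg.contDiff, hg.support⟩

attribute [local irreducible] rot

open BoundedContinuousFunction

/-! ### Global solutions of ordinary differential equations with parameters -/

/-- Integration gains a factor 1/k in the norm weighted by exp(k|t|); this makes the Picard map a
contraction on the whole time axis. -/
lemma abs_integral_exp_mul_abs_le {k : ℝ} (hk : 0 < k) (t : ℝ) :
    |∫ r in (0 : ℝ)..t, Real.exp (k * |r|)| ≤ Real.exp (k * |t|) / k := by
  have key : ∀ t : ℝ, 0 ≤ t → |∫ r in (0 : ℝ)..t, Real.exp (k * |r|)| ≤ Real.exp (k * |t|) / k := by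
    intro t ht
    have h1 : ∫ r in (0 : ℝ)..t, Real.exp (k * |r|) = ∫ r in (0 : ℝ)..t, Real.exp (k * r) := by
      refine intervalIntegral.integral_congr fun r hr => ?_
      rw [Set.uIcc_of_le ht] at hr
      simp only [abs_of_nonneg hr.1]
    have h2 : ∫ r in (0 : ℝ)..t, Real.exp (k * r) = (Real.exp (k * t) - 1) / k := by
      rw [intervalIntegral.integral_comp_mul_left _ hk.ne', integral_exp]
      simp [div_eq_inv_mul]
    rw [h1, h2, abs_of_nonneg ht, abs_of_nonneg]
    · gcongr; linarith
    · have : 1 ≤ Real.exp (k * t) := Real.one_le_exp (by positivity)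
      exact div_nonneg (by linarith) hk.le
  rcases le_total 0 t with ht | ht
  · exact key t ht
  · have h := key (-t) (by linarith)
    have h1 : ∫ r in (0 : ℝ)..(-t), Real.exp (k * |r|) = -∫ r in (0 : ℝ)..t, Real.exp (k * |r|) := by
      have := intervalIntegral.integral_comp_neg (a := 0) (b := -t) fun r => Real.exp (k * |r|)
      simp only [abs_neg, neg_neg, neg_zero] at this
      rw [this, intervalIntegral.integral_symm]
    rwa [h1, abs_neg, abs_neg] at h

/-- Global solutions of `u' = f(x, u, t)`, `u(0) = u₀(x)`, depending continuously on the parameter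
`x`, for `f` globally Lipschitz in `u`. -/
theorem exists_continuous_global_solution {X H : Type*} [TopologicalSpace X]
    [NormedAddCommGroup H] [NormedSpace ℝ H] [CompleteSpace H] {f : X → H → ℝ → H}
    (hf : Continuous fun p : X × H × ℝ => f p.1 p.2.1 p.2.2) {u₀ : X → H} (hu₀ : Continuous u₀)
    {K L : X → ℝ} (hKc : Continuous K) (hLc : Continuous L) (hL0 : ∀ x, 0 ≤ L x)
    (hK : ∀ x t, ‖f x (u₀ x) t‖ ≤ K x)
    (hL : ∀ x u u' t, ‖f x u t - f x u' t‖ ≤ L x * ‖u - u'‖) :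
    ∃ U : X → ℝ → H, Continuous (fun p : X × ℝ => U p.1 p.2) ∧ (∀ x, U x 0 = u₀ x) ∧
      ∀ x t, HasDerivAt (U x) (f x (U x t) t) t := by
  have hK0 : ∀ x, 0 ≤ K x := fun x => (norm_nonneg _).trans (hK x 0)
  -- The rate k is at least K and 2L, so the weighted Picard map stays bounded and contracts by 1/2;
  -- the 1 keeps k positive. As k depends continuously on x, the fixed point is sought among bounded
  -- continuous functions on `X × ℝ`, for all parameters at once, and joint continuity comes with
  -- it.
  set k : X → ℝ := fun x => 1 + K x + 2 * L x with hk
  have hkpos : ∀ x, 0 < k x := fun x => by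
    simp only [hk]; linarith [hK0 x, hL0 x]
  have hkc : Continuous k := by fun_prop
  set w : X → ℝ → ℝ := fun x t => Real.exp (k x * |t|) with hw
  have hwpos : ∀ x t, 0 < w x t := fun x t => Real.exp_pos _
  have hw1 : ∀ x t, 1 ≤ w x t := fun x t => Real.one_le_exp (by have := hkpos x; positivity)
  have hwc : Continuous fun p : X × ℝ => w p.1 p.2 := by simp only [hw]; fun_prop
  have hint : ∀ (x : X) (t C : ℝ) (h : ℝ → H), 0 ≤ C → (∀ r, ‖h r‖ ≤ C * w x r) →
      ‖(w x t)⁻¹ • ∫ r in (0 : ℝ)..t, h r‖ ≤ C / k x := by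
    intro x t C h hC hh
    rw [norm_smul, norm_inv, Real.norm_of_nonneg (hwpos x t).le, inv_mul_le_iff₀ (hwpos x t)]
    have h1 : ‖∫ r in (0 : ℝ)..t, h r‖ ≤ |∫ r in (0 : ℝ)..t, C * w x r| := by
      refine intervalIntegral.norm_integral_le_abs_of_norm_le (ae_of_all _ fun r => hh r) ?_
      refine Continuous.intervalIntegrable ?_ _ _
      exact continuous_const.mul (hwc.comp (by fun_prop : Continuous fun r : ℝ => (x, r)))
    refine h1.trans ?_
    rw [intervalIntegral.integral_const_mul, abs_mul, abs_of_nonneg hC]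
    calc C * |∫ r in (0 : ℝ)..t, w x r| ≤ C * (w x t / k x) :=
          mul_le_mul_of_nonneg_left (abs_integral_exp_mul_abs_le (hkpos x) t) hC
      _ = w x t * (C / k x) := by ring
  -- The unknown Z is the displacement from u₀ divided by the weight: it is bounded although the
  -- solution may grow exponentially.
  set u : (X × ℝ →ᵇ H) → X → ℝ → H := fun Z x t => u₀ x + w x t • Z (x, t) with hu
  have huc : ∀ Z, Continuous fun p : X × ℝ => f p.1 (u Z p.1 p.2) p.2 := by
    intro Z
    refine hf.comp (continuous_fst.prodMk (Continuous.prodMk ?_ continuous_snd))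
    exact (hu₀.comp continuous_fst).add (hwc.smul Z.continuous)
  have hcont : ∀ Z : X × ℝ →ᵇ H,
      Continuous fun p : X × ℝ => ∫ r in (0 : ℝ)..p.2, f p.1 (u Z p.1 r) r := by
    intro Z
    refine intervalIntegral.continuous_parametric_intervalIntegral_of_continuous
      (f := fun p : X × ℝ => fun r => f p.1 (u Z p.1 r) r) ?_ continuous_snd
    exact (huc Z).comp (by fun_prop : Continuous fun q : (X × ℝ) × ℝ => (q.1.1, q.2))
  have hbd : ∀ (Z : X × ℝ →ᵇ H) x r, ‖f x (u Z x r) r‖ ≤ (K x + L x * ‖Z‖) * w x r := by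
    intro Z x r
    have h1 : ‖f x (u Z x r) r - f x (u₀ x) r‖ ≤ L x * (w x r * ‖Z‖) := by
      refine (hL x _ _ r).trans (mul_le_mul_of_nonneg_left ?_ (hL0 x))
      simp only [hu, add_sub_cancel_left, norm_smul, Real.norm_of_nonneg (hwpos x r).le]
      exact mul_le_mul_of_nonneg_left (Z.norm_coe_le_norm _) (hwpos x r).le
    have h2 := norm_le_norm_add_norm_sub' (f x (u Z x r) r) (f x (u₀ x) r)
    have h3 : K x ≤ K x * w x r := le_mul_of_one_le_right (hK0 x) (hw1 x r)
    have h4 := hK x r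
    nlinarith
  set Φ : (X × ℝ →ᵇ H) → (X × ℝ →ᵇ H) := fun Z =>
    BoundedContinuousFunction.ofNormedAddCommGroup
      (fun p : X × ℝ => (w p.1 p.2)⁻¹ • ∫ r in (0 : ℝ)..p.2, f p.1 (u Z p.1 r) r)
      ((hwc.inv₀ fun p => (hwpos _ _).ne').smul (hcont Z)) (1 + ‖Z‖) (by
        intro p
        refine (hint p.1 p.2 (K p.1 + L p.1 * ‖Z‖) _ ?_ (hbd Z p.1)).trans ?_
        · have := hK0 p.1; have := hL0 p.1; positivity
        · rw [div_le_iff₀ (hkpos _)]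
          have h1 := hK0 p.1; have h2 := hL0 p.1; have h3 := norm_nonneg Z
          simp only [hk]
          nlinarith [mul_nonneg h1 h3, mul_nonneg h2 h3]) with hΦ
  have hΦ_apply : ∀ Z x t, Φ Z (x, t) = (w x t)⁻¹ • ∫ r in (0 : ℝ)..t, f x (u Z x r) r :=
    fun _ _ _ => rfl
  have hcontr : ContractingWith (1 / 2) Φ := by
    refine ⟨by norm_num [← NNReal.coe_lt_coe], LipschitzWith.of_dist_le_mul fun Z Z' => ?_⟩
    rw [dist_eq_norm, dist_eq_norm]
    refine (BoundedContinuousFunction.norm_le (by positivity)).2 fun ⟨x, t⟩ => ?_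
    have hci : ∀ Z, IntervalIntegrable (fun r => f x (u Z x r) r) volume 0 t := fun Z =>
      ((huc Z).comp (by fun_prop : Continuous fun r : ℝ => (x, r))).intervalIntegrable _ _
    rw [BoundedContinuousFunction.sub_apply, hΦ_apply, hΦ_apply, ← smul_sub,
      ← intervalIntegral.integral_sub (hci Z) (hci Z')]
    refine (hint x t (L x * ‖Z - Z'‖) _ (mul_nonneg (hL0 x) (norm_nonneg _)) fun r => ?_).trans ?_
    · refine (hL x _ _ r).trans ?_
      rw [mul_assoc]
      refine mul_le_mul_of_nonneg_left ?_ (hL0 x)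
      simp only [hu, add_sub_add_left_eq_sub, ← smul_sub]
      rw [norm_smul, Real.norm_of_nonneg (hwpos x r).le, mul_comm]
      exact mul_le_mul_of_nonneg_right ((Z - Z').norm_coe_le_norm (x, r)) (hwpos x r).le
    · rw [div_le_iff₀ (hkpos x)]
      have h1 := hK0 x; have h2 := hL0 x; have h3 := norm_nonneg (Z - Z')
      simp only [hk]
      push_cast
      nlinarith [mul_nonneg h1 h3]
  obtain ⟨Z, hZ⟩ : ∃ Z, Φ Z = Z := ⟨_, hcontr.fixedPoint_isFixedPt⟩
  have hU : ∀ x t, u Z x t = u₀ x + ∫ r in (0 : ℝ)..t, f x (u Z x r) r := by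
    intro x t
    have h := hΦ_apply Z x t
    rw [hZ] at h
    simp only [hu]
    rw [h, smul_inv_smul₀ (hwpos x t).ne']
  refine ⟨u Z, (hu₀.comp continuous_fst).add (hwc.smul Z.continuous), fun x => ?_, fun x t => ?_⟩
  · rw [hU, intervalIntegral.integral_same, add_zero]
  · have hc : Continuous fun r => f x (u Z x r) r :=
      (huc Z).comp (by fun_prop : Continuous fun r : ℝ => (x, r))
    have h := (intervalIntegral.integral_hasDerivAt_right (hc.intervalIntegrable 0 t)
      (hc.stronglyMeasurableAtFilter _ _) hc.continuousAt).const_add (u₀ x)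
    exact h.congr_of_eventuallyEq (Eventually.of_forall fun s => hU x s)

/-! ### The equation of motion in the frame of the scatterer -/

/-- `y' = p`, `p' = c g(y, φ + ω t)`. -/
structure IsBodySol {d m : ℕ} (g : E d → Torus m → E d) (ω : E m) (φ : Torus m) (c : ℝ)
    (y p : ℝ → E d) : Prop where
  pos : ∀ t, HasDerivAt y (p t) t
  vel : ∀ t, HasDerivAt p (c • g (y t) (φ + toTorus (t • ω))) t

lemma Prof.continuous_smul_comp {d m k : ℕ} {g : E d → Torus m → E d} (hg : Prof k g) (ω : E m)
    {X : Type*} [TopologicalSpace X] {c t : X → ℝ} {y : X → E d} {φ : X → Torus m}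
    (hc : Continuous c) (hy : Continuous y) (hφ : Continuous φ) (ht : Continuous t) :
    Continuous fun x => c x • g (y x) (φ x + toTorus (t x • ω)) :=
  hc.smul (hg.continuous.comp
    (hy.prodMk (hφ.add (continuous_toTorus.comp (ht.smul continuous_const)))))

/-- The right hand side of the equation of motion, as a first order system. -/
def bodyField {d m : ℕ} (g : E d → Torus m → E d) (ω : E m) (φ : Torus m) (c : ℝ) (t : ℝ)
    (u : E d × E d) : E d × E d :=
  (u.2, c • g u.1 (φ + toTorus (t • ω)))

lemma IsBodySol.hasDerivAt {d m : ℕ} {g : E d → Torus m → E d} {ω : E m} {φ : Torus m} {c : ℝ}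
    {y p : ℝ → E d} (h : IsBodySol g ω φ c y p) (t : ℝ) :
    HasDerivAt (fun t => (y t, p t)) (bodyField g ω φ c t (y t, p t)) t :=
  (h.pos t).prodMk (h.vel t)

lemma exists_bodyField_lipschitz {d m : ℕ} {g : E d → Torus m → E d} (hg : Prof 3 g) (ω : E m) :
    ∃ L, 0 ≤ L ∧ ∀ (φ : Torus m) (c t : ℝ) (u u' : E d × E d),
      ‖bodyField g ω φ c t u - bodyField g ω φ c t u'‖ ≤ (1 + |c| * L) * ‖u - u'‖ := by
  obtain ⟨L, hL0, hL⟩ := Prof.exists_lipschitz_space (k := 2) hg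
  refine ⟨L, hL0, fun φ c t u u' => ?_⟩
  have h1 : ‖u.1 - u'.1‖ ≤ ‖u - u'‖ := norm_fst_le (u - u')
  have h2 : ‖u.2 - u'.2‖ ≤ ‖u - u'‖ := norm_snd_le (u - u')
  have h0 := norm_nonneg (u - u')
  rw [bodyField, bodyField, Prod.mk_sub_mk, Prod.norm_mk, ← smul_sub, norm_smul, Real.norm_eq_abs]
  refine max_le ?_ ?_
  · nlinarith [mul_nonneg (mul_nonneg (abs_nonneg c) hL0) h0]
  · have h3 := mul_le_mul_of_nonneg_left
      ((hL u.1 u'.1 (φ + toTorus (t • ω))).trans (mul_le_mul_of_nonneg_left h1 hL0)) (abs_nonneg c)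
    nlinarith

lemma exists_bodyField_lipschitzWith {d m : ℕ} {g : E d → Torus m → E d} (hg : Prof 3 g)
    (ω : E m) (φ : Torus m) (c : ℝ) : ∃ L, ∀ t, LipschitzWith L (bodyField g ω φ c t) := by
  obtain ⟨L, hL0, hL⟩ := exists_bodyField_lipschitz hg ω
  refine ⟨⟨1 + |c| * L, by positivity⟩, fun t => LipschitzWith.of_dist_le_mul fun u u' => ?_⟩
  rw [dist_eq_norm, dist_eq_norm]
  exact hL φ c t u u'

lemma IsBodySol.unique {d m : ℕ} {g : E d → Torus m → E d} (hg : Prof 3 g) {ω : E m}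
    {φ : Torus m} {c : ℝ} {y p y' p' : ℝ → E d} (h : IsBodySol g ω φ c y p)
    (h' : IsBodySol g ω φ c y' p') (h0 : y 0 = y' 0) (h1 : p 0 = p' 0) : y = y' := by
  obtain ⟨L, hL⟩ := exists_bodyField_lipschitzWith hg ω φ c
  have := ODE_solution_unique_univ (t₀ := 0) (fun t => (hL t).lipschitzOnWith (s := Set.univ))
    (fun t => ⟨h.hasDerivAt t, Set.mem_univ _⟩) (fun t => ⟨h'.hasDerivAt t, Set.mem_univ _⟩)
    (by rw [h0, h1])
  funext t
  exact congrArg Prod.fst (congrFun this t)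

/-- The flow of the equation of motion, continuous in the parameters `(y₀, v, φ, c)`. -/
theorem exists_bodyFlow {d m : ℕ} {g : E d → Torus m → E d} (hg : Prof 3 g) (ω : E m) :
    ∃ Y P : E d × E d × Torus m × ℝ → ℝ → E d,
      Continuous (fun q : (E d × E d × Torus m × ℝ) × ℝ => Y q.1 q.2) ∧
      ∀ x, IsBodySol g ω x.2.2.1 x.2.2.2 (Y x) (P x) ∧ Y x 0 = x.1 ∧ P x 0 = x.2.1 := by
  obtain ⟨L, hL0, hL⟩ := exists_bodyField_lipschitz hg ω
  obtain ⟨K, hK0, hK⟩ := hg.exists_bound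
  obtain ⟨U, hUc, hU0, hU⟩ := exists_continuous_global_solution
    (X := E d × E d × Torus m × ℝ) (H := E d × E d)
    (f := fun x u t => bodyField g ω x.2.2.1 x.2.2.2 t u) (u₀ := fun x => (x.1, x.2.1))
    (K := fun x => ‖x.2.1‖ + |x.2.2.2| * K) (L := fun x => 1 + |x.2.2.2| * L)
    (by
      exact (by fun_prop : Continuous fun q : (E d × E d × Torus m × ℝ) × (E d × E d) × ℝ =>
        q.2.1.2).prodMk (hg.continuous_smul_comp ω (by fun_prop) (by fun_prop) (by fun_prop)
          (by fun_prop)))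
    (by fun_prop) (by fun_prop) (by fun_prop) (fun x => by positivity)
    (fun x t => by
      rw [bodyField, Prod.norm_mk, norm_smul, Real.norm_eq_abs]
      have := mul_le_mul_of_nonneg_left (hK x.1 (x.2.2.1 + toTorus (t • ω))) (abs_nonneg x.2.2.2)
      refine max_le ?_ (this.trans ?_)
      · have := mul_nonneg (abs_nonneg x.2.2.2) hK0
        simp only; linarith
      · simp)
    (fun x u u' t => hL _ _ _ _ _)
  refine ⟨fun x t => (U x t).1, fun x t => (U x t).2, hUc.fst, fun x => ⟨⟨fun t => ?_, fun t => ?_⟩,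
    congrArg Prod.fst (hU0 x), congrArg Prod.snd (hU0 x)⟩⟩
  · exact (hU x t).fst
  · exact (hU x t).snd

/-! ### The trajectory and the momentum transfer -/

lemma force_eq {d m : ℕ} (g : E d → Torus m → E d) (ω : E m) (κ : Kappa d m) (y : E d) (t : ℝ) :
    force g ω κ y t =
      rot κ.2.1 (κ.2.2.2 • g (rot κ.2.1⁻¹ y) (κ.2.2.1 + toTorus (t • ω))) := by
  rw [force, rot_smul, add_comm]

lemma hasDerivAt_rot {d : ℕ} (M : SO d) {f : ℝ → E d} {f' : E d} {t : ℝ}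
    (h : HasDerivAt f f' t) : HasDerivAt (fun t => rot M (f t)) (rot M f') t :=
  (rotL M).toContinuousLinearEquiv.toContinuousLinearMap.hasFDerivAt.comp_hasDerivAt t h

/-- `trajectory` is an arbitrary choice among solutions, so existence (the rotated body solution)
and uniqueness are both needed to identify it. -/
lemma trajectory_eq {d m : ℕ} {g : E d → Torus m → E d} (hg : Prof 3 g) {ω : E m} {v : E d}
    {κ : Kappa d m} {y p : ℝ → E d} (h : IsBodySol g ω κ.2.2.1 κ.2.2.2 y p)
    (h0 : y 0 = rot κ.2.1⁻¹ (κ.1 - (1 / 2 : ℝ) • dir v)) (h1 : p 0 = rot κ.2.1⁻¹ v) :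
    trajectory g ω v κ = fun t => rot κ.2.1 (y t) := by
  have hex : ∃ z, IsTrajectory g ω v κ z := by
    have hd : deriv (fun t => rot κ.2.1 (y t)) = fun t => rot κ.2.1 (p t) := by
      funext t; exact (hasDerivAt_rot _ (h.pos t)).deriv
    refine ⟨fun t => rot κ.2.1 (y t), fun t => (hasDerivAt_rot _ (h.pos t)).differentiableAt,
      fun t => ?_, ?_, ?_⟩
    · rw [hd, force_eq, rot_inv_rot]
      exact hasDerivAt_rot _ (h.vel t)
    · simp only [h0, rot_rot_inv]
    · simp only [hd, h1, rot_rot_inv]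
  have hz : IsTrajectory g ω v κ (trajectory g ω v κ) := Classical.epsilon_spec hex
  obtain ⟨z1, z2, z3, z4⟩ := hz
  set z := trajectory g ω v κ with hzdef
  have hb : IsBodySol g ω κ.2.2.1 κ.2.2.2 (fun t => rot κ.2.1⁻¹ (z t))
      (fun t => rot κ.2.1⁻¹ (deriv z t)) := by
    refine ⟨fun t => hasDerivAt_rot _ (z1 t).hasDerivAt, fun t => ?_⟩
    have := hasDerivAt_rot κ.2.1⁻¹ (z2 t)
    rwa [force_eq, rot_inv_rot] at this
  have := h.unique hg hb (by rw [h0, z3]) (by rw [h1, z4])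
  funext t
  rw [this]
  simp only [rot_rot_inv]

lemma R_eq {d m : ℕ} {g : E d → Torus m → E d} (hg : Prof 3 g) {ω : E m} {v : E d}
    {κ : Kappa d m} {y p : ℝ → E d} (h : IsBodySol g ω κ.2.2.1 κ.2.2.2 y p)
    (h0 : y 0 = rot κ.2.1⁻¹ (κ.1 - (1 / 2 : ℝ) • dir v)) (h1 : p 0 = rot κ.2.1⁻¹ v) :
    R g ω v κ = rot κ.2.1
      (∫ t in Set.Ioi (0 : ℝ), κ.2.2.2 • g (y t) (κ.2.2.1 + toTorus (t • ω))) := by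
  rw [R, trajectory_eq hg h h0 h1]
  simp only [force_eq, rot_inv_rot]
  -- A linear equivalence commutes with the integral even if the integrand is not integrable, both
  -- sides then being 0. Hence slow particles need no exception.
  exact (rotL κ.2.1).toContinuousLinearEquiv.integral_comp_comm _

lemma measurable_rot_comp {d : ℕ} {X : Type*} [MeasurableSpace X] {M : X → SO d} {f : X → E d}
    (hM : Measurable M) (hf : Measurable f) :
    Measurable fun x => rot (M x) (f x) :=
  continuous_rot_uncurry.measurable.comp (hM.prodMk hf)

lemma measurable_dir {d : ℕ} : Measurable (dir : E d → E d) := by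
  unfold dir; fun_prop

/-- The force along the flow is jointly continuous in parameters and time, and parametric integrals
of measurable functions are measurable whether or not they converge. Only measurability survives,
since `dir` jumps at 0. -/
theorem measurable_R {d m : ℕ} {g : E d → Torus m → E d} (hg : Prof 3 g) (ω : E m) :
    Measurable fun q : E d × Kappa d m => R g ω q.1 q.2 := by
  obtain ⟨Y, P, hYc, hY⟩ := exists_bodyFlow hg ω
  set I : E d × E d × Torus m × ℝ → E d := fun x =>
    ∫ t in Set.Ioi (0 : ℝ), x.2.2.2 • g (Y x t) (x.2.2.1 + toTorus (t • ω)) with hI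
  have hIm : Measurable I := by
    refine StronglyMeasurable.measurable ?_
    refine StronglyMeasurable.integral_prod_right (f := fun x t =>
      x.2.2.2 • g (Y x t) (x.2.2.1 + toTorus (t • ω))) ?_
    refine Continuous.stronglyMeasurable ?_
    exact hg.continuous_smul_comp ω (by fun_prop) hYc (by fun_prop) (by fun_prop)
  have hm : (fun q : E d × Kappa d m => R g ω q.1 q.2) = fun q => rot q.2.2.1
      (I (rot q.2.2.1⁻¹ (q.2.1 - (1 / 2 : ℝ) • dir q.1), rot q.2.2.1⁻¹ q.1, q.2.2.2)) := by
    funext q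
    obtain ⟨h, h0, h1⟩ := hY
      (rot q.2.2.1⁻¹ (q.2.1 - (1 / 2 : ℝ) • dir q.1), rot q.2.2.1⁻¹ q.1, q.2.2.2)
    exact R_eq hg h h0 h1
  rw [hm]
  clear_value I
  have hM : Measurable fun q : E d × Kappa d m => q.2.2.1 := by fun_prop
  have hdir : Measurable fun q : E d × Kappa d m => dir q.1 := measurable_dir.comp measurable_fst
  have hb : Measurable fun q : E d × Kappa d m => q.2.1 - (1 / 2 : ℝ) • dir q.1 :=
    measurable_snd.fst.sub (hdir.const_smul (1 / 2 : ℝ))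
  have hy := measurable_rot_comp hM.inv hb
  have hv := measurable_rot_comp hM.inv measurable_fst
  have hx := hy.prodMk (hv.prodMk measurable_snd.snd.snd)
  exact measurable_rot_comp hM (hIm.comp hx)

/-! ### The coefficients of the expansion in the frame of the scatterer -/

section coefficients

variable {d m : ℕ}

/-- The free trajectory with direction `u` and impact parameter `b`. -/
noncomputable def line (u b : E d) (s : ℝ) : E d := b + (s - 1 / 2) • u

/-- `α^(1) / c`. -/
noncomputable def aOne (g : E d → Torus m → E d) (u b : E d) (φ : Torus m) : E d :=
  ∫ s in (0 : ℝ)..2, g (line u b s) φ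

/-- `α^(2) / c`. -/
noncomputable def aTwo (g : E d → Torus m → E d) (ω : E m) (u b : E d) (φ : Torus m) : E d :=
  ∫ s in (0 : ℝ)..2, s • Dtau ω g (line u b s) φ

/-- The part of `α^(3)` that is linear in `c`. -/
noncomputable def aThreeLin (g : E d → Torus m → E d) (ω : E m) (u b : E d) (φ : Torus m) : E d :=
  ∫ s in (0 : ℝ)..2, (s ^ 2 / 2) • Dtau ω (Dtau ω g) (line u b s) φ

/-- The first correction to the free trajectory. -/
noncomputable def deflection (g : E d → Torus m → E d) (u b : E d) (φ : Torus m) (s : ℝ) : E d :=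
  s • (∫ r in (0 : ℝ)..s, g (line u b r) φ) - ∫ r in (0 : ℝ)..s, r • g (line u b r) φ

/-- The part of `α^(3)` that is quadratic in `c`. -/
noncomputable def aThreeQuad (g : E d → Torus m → E d) (u b : E d) (φ : Torus m) : E d :=
  ∫ s in (0 : ℝ)..2, Dspace g (line u b s) φ (deflection g u b φ s)

lemma Prof.continuous_comp_line {X : Type*} [NormedAddCommGroup X] [NormedSpace ℝ X] {k : ℕ}
    {f : E d → Torus m → X} (hf : Prof k f) {Z : Type*} [TopologicalSpace Z] {u b : Z → E d}
    {φ : Z → Torus m} {s : Z → ℝ} (hu : Continuous u) (hb : Continuous b) (hφ : Continuous φ)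
    (hs : Continuous s) : Continuous fun z => f (line (u z) (b z) (s z)) (φ z) := by
  refine hf.continuous.comp (Continuous.prodMk ?_ hφ)
  change Continuous fun z => b z + (s z - 1 / 2) • u z
  fun_prop

variable {g : E d → Torus m → E d}

lemma continuous_aOne (hg : Prof 3 g) :
    Continuous fun x : E d × E d × Torus m => aOne g x.1 x.2.1 x.2.2 := by
  refine intervalIntegral.continuous_parametric_intervalIntegral_of_continuous'
    (f := fun (x : E d × E d × Torus m) s => g (line x.1 x.2.1 s) x.2.2) ?_ _ _
  exact hg.continuous_comp_line (by fun_prop) (by fun_prop) (by fun_prop) (by fun_prop)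

lemma continuous_aTwo (hg : Prof 3 g) (ω : E m) :
    Continuous fun x : E d × E d × Torus m => aTwo g ω x.1 x.2.1 x.2.2 := by
  refine intervalIntegral.continuous_parametric_intervalIntegral_of_continuous'
    (f := fun (x : E d × E d × Torus m) s => s • Dtau ω g (line x.1 x.2.1 s) x.2.2) ?_ _ _
  exact continuous_snd.smul ((Prof.dtau (k := 2) hg ω).continuous_comp_line
    (by fun_prop) (by fun_prop) (by fun_prop) (by fun_prop))

lemma continuous_aThreeLin (hg : Prof 3 g) (ω : E m) :
    Continuous fun x : E d × E d × Torus m => aThreeLin g ω x.1 x.2.1 x.2.2 := by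
  refine intervalIntegral.continuous_parametric_intervalIntegral_of_continuous'
    (f := fun (x : E d × E d × Torus m) s =>
      (s ^ 2 / 2) • Dtau ω (Dtau ω g) (line x.1 x.2.1 s) x.2.2) ?_ _ _
  exact ((continuous_snd.pow 2).div_const 2).smul
    ((Prof.dtau (k := 1) (Prof.dtau (k := 2) hg ω) ω).continuous_comp_line
      (by fun_prop) (by fun_prop) (by fun_prop) (by fun_prop))

lemma continuous_deflection (hg : Prof 3 g) :
    Continuous fun x : (E d × E d × Torus m) × ℝ => deflection g x.1.1 x.1.2.1 x.1.2.2 x.2 := by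
  have h : Continuous fun q : ((E d × E d × Torus m) × ℝ) × ℝ =>
      g (line q.1.1.1 q.1.1.2.1 q.2) q.1.1.2.2 :=
    hg.continuous_comp_line (by fun_prop) (by fun_prop) (by fun_prop) (by fun_prop)
  refine (continuous_snd.smul ?_).sub ?_
  · exact intervalIntegral.continuous_parametric_intervalIntegral_of_continuous
      (f := fun (x : (E d × E d × Torus m) × ℝ) r => g (line x.1.1 x.1.2.1 r) x.1.2.2) h
      continuous_snd
  · exact intervalIntegral.continuous_parametric_intervalIntegral_of_continuous
      (f := fun (x : (E d × E d × Torus m) × ℝ) r => r • g (line x.1.1 x.1.2.1 r) x.1.2.2)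
      (continuous_snd.smul h) continuous_snd

lemma continuous_aThreeQuad (hg : Prof 3 g) :
    Continuous fun x : E d × E d × Torus m => aThreeQuad g x.1 x.2.1 x.2.2 := by
  refine intervalIntegral.continuous_parametric_intervalIntegral_of_continuous'
    (f := fun (x : E d × E d × Torus m) s =>
      Dspace g (line x.1 x.2.1 s) x.2.2 (deflection g x.1 x.2.1 x.2.2 s)) ?_ _ _
  exact ((Prof.dspace (k := 2) hg).continuous_comp_line
      (by fun_prop) (by fun_prop) (by fun_prop) (by fun_prop)).clm_apply (continuous_deflection hg)

/-- The boundary terms s·g cancel. Thus `deflection` vanishes with its derivative at 0 and has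
second derivative g along the line: it is the linear response to the force felt on the free
trajectory. -/
lemma hasDerivAt_deflection (hg : Prof 3 g) (u b : E d) (φ : Torus m) (s : ℝ) :
    HasDerivAt (deflection g u b φ) (∫ r in (0 : ℝ)..s, g (line u b r) φ) s := by
  have hc : Continuous fun r => g (line u b r) φ :=
    hg.continuous_comp_line (by fun_prop) (by fun_prop) (by fun_prop) (by fun_prop)
  have hc' : Continuous fun r : ℝ => r • g (line u b r) φ := continuous_id.smul hc
  have h1 := intervalIntegral.integral_hasDerivAt_right (hc.intervalIntegrable 0 s)
    (hc.stronglyMeasurableAtFilter _ _) hc.continuousAt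
  have h2 := intervalIntegral.integral_hasDerivAt_right (hc'.intervalIntegrable 0 s)
    (hc'.stronglyMeasurableAtFilter _ _) hc'.continuousAt
  have h3 : HasDerivAt (deflection g u b φ) _ s := ((hasDerivAt_id s).smul h1).sub h2
  convert h3 using 1
  simp

/-- Bounds on a force profile and its derivatives. -/
structure ProfBounds (g : E d → Torus m → E d) (ω : E m) (K : ℝ) : Prop where
  nonneg : 0 ≤ K
  bound : ∀ y φ, ‖g y φ‖ ≤ K
  bound_dspace : ∀ y φ, ‖Dspace g y φ‖ ≤ K
  lip_space : ∀ y z φ, ‖g y φ - g z φ‖ ≤ K * ‖y - z‖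
  lip_time : ∀ y φ (t : ℝ), ‖g y (φ + toTorus (t • ω)) - g y φ‖ ≤ K * |t|
  lip_time_dspace : ∀ y φ (t : ℝ),
    ‖Dspace g y (φ + toTorus (t • ω)) - Dspace g y φ‖ ≤ K * |t|
  taylor_space : ∀ y z φ, ‖g z φ - g y φ - Dspace g y φ (z - y)‖ ≤ K * ‖z - y‖ ^ 2
  taylor_time : ∀ y φ (t : ℝ), 0 ≤ t →
      ‖g y (φ + toTorus (t • ω)) - g y φ - t • Dtau ω g y φ
        - (t ^ 2 / 2) • Dtau ω (Dtau ω g) y φ‖ ≤ K * t ^ 3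

lemma Prof.exists_bounds (hg : Prof 3 g) (ω : E m) : ∃ K, ProfBounds g ω K := by
  have hD : Prof 2 (Dspace g) := Prof.dspace (k := 2) hg
  obtain ⟨K1, h10, h1⟩ := hg.exists_bound
  obtain ⟨K2, h20, h2⟩ := hD.exists_bound
  obtain ⟨K3, h30, h3⟩ := Prof.exists_lipschitz_space (k := 2) hg
  obtain ⟨K4, h40, h4⟩ := Prof.exists_lipschitz_time (k := 2) hg ω
  obtain ⟨K5, h50, h5⟩ := Prof.exists_lipschitz_time (k := 1) hD ω
  obtain ⟨K6, h60, h6⟩ := Prof.exists_taylor_space (k := 1) hg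
  obtain ⟨K7, h70, h7⟩ := hg.exists_taylor_time ω
  refine ⟨K1 + K2 + K3 + K4 + K5 + K6 + K7, by positivity, fun y φ => (h1 y φ).trans (by linarith),
    fun y φ => (h2 y φ).trans (by linarith), fun y z φ => (h3 y z φ).trans ?_,
    fun y φ t => (h4 y φ t).trans ?_, fun y φ t => (h5 y φ t).trans ?_,
    fun y z φ => (h6 y z φ).trans ?_, fun y φ t ht => (h7 y φ t ht).trans ?_⟩
  all_goals
    refine mul_le_mul_of_nonneg_right ?_ (by positivity)
    linarith

end coefficients

/-! ### Expansion of the trajectory -/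

section expansion

variable {d m : ℕ} {g : E d → Torus m → E d} {ω : E m} {K : ℝ} {φ : Torus m} {c ε : ℝ}
  {u b : E d} {y p : ℝ → E d}

/-- Two integrations over an interval of length 2. Since the force is bounded outright, this
replaces Gronwall's inequality throughout. -/
lemma norm_le_of_second_deriv_bound {X : Type*} [NormedAddCommGroup X] [NormedSpace ℝ X]
    {f f' f'' : ℝ → X} {K : ℝ} (hK : 0 ≤ K) (h0 : f 0 = 0) (h0' : f' 0 = 0)
    (hf : ∀ t, HasDerivAt f (f' t) t) (hf' : ∀ t, HasDerivAt f' (f'' t) t)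
    (hb : ∀ t ∈ Set.Icc (0 : ℝ) 2, ‖f'' t‖ ≤ K) :
    ∀ t ∈ Set.Icc (0 : ℝ) 2, ‖f t‖ ≤ 4 * K ∧ ‖f' t‖ ≤ 2 * K := by
  have h1 := norm_le_of_hasDerivAt_bound hK h0' (fun t _ => hf' t) hb
  have h2 := norm_le_of_hasDerivAt_bound (by positivity) h0 (fun t _ => hf t) h1
  exact fun t ht => ⟨(h2 t ht).trans_eq (by ring), (h1 t ht).trans_eq (by ring)⟩

lemma hasDerivAt_line (u b : E d) (s : ℝ) : HasDerivAt (line u b) u s := by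
  have h : HasDerivAt (line u b) _ s :=
    (((hasDerivAt_id s).sub_const (1 / 2)).smul_const u).const_add b
  convert h using 1
  simp

/-- For ε = 1/‖v‖ the rescaled motion has unit initial speed, and the force enters with the small
factor ε². -/
lemma IsBodySol.hasDerivAt_scaled (h : IsBodySol g ω φ c y p) (ε s : ℝ) :
    HasDerivAt (fun s => y (ε * s)) (ε • p (ε * s)) s ∧
    HasDerivAt (fun s => ε • p (ε * s))
      (ε ^ 2 • c • g (y (ε * s)) (φ + toTorus ((ε * s) • ω))) s := by
  have hs : HasDerivAt (fun s : ℝ => ε * s) ε s := by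
    simpa using (hasDerivAt_id s).const_mul ε
  refine ⟨(h.pos (ε * s)).scomp s hs, ?_⟩
  have := ((h.vel (ε * s)).scomp s hs).const_smul ε
  rw [smul_smul ε ε, ← sq] at this
  exact this

lemma norm_coupling_smul_le (hc : |c| ≤ 1) {X : Type*} [NormedAddCommGroup X] [NormedSpace ℝ X]
    (x : X) : ‖c • x‖ ≤ ‖x‖ := by
  rw [norm_smul, Real.norm_eq_abs]
  exact mul_le_of_le_one_left (norm_nonneg _) hc

lemma norm_scaled_sub_line_le (hK : ProfBounds g ω K) (hc : |c| ≤ 1) (hε : 0 < ε)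
    (h : IsBodySol g ω φ c y p) (h0 : y 0 = b - (1 / 2 : ℝ) • u) (h1 : p 0 = ε⁻¹ • u) :
    ∀ s ∈ Set.Icc (0 : ℝ) 2,
      ‖y (ε * s) - line u b s‖ ≤ 4 * (ε ^ 2 * K) ∧ ‖ε • p (ε * s) - u‖ ≤ 2 * (ε ^ 2 * K) := by
  refine norm_le_of_second_deriv_bound (mul_nonneg (sq_nonneg _) hK.nonneg) ?_ ?_
    (fun s => (h.hasDerivAt_scaled ε s).1.sub (hasDerivAt_line u b s))
    (fun s => (h.hasDerivAt_scaled ε s).2.sub_const u) (fun s _ => ?_)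
  · simp only [mul_zero, h0, line, zero_sub]
    module
  · simp [h1, smul_smul, hε.ne']
  · rw [norm_smul, norm_pow, Real.norm_of_nonneg hε.le]
    exact mul_le_mul_of_nonneg_left ((norm_coupling_smul_le hc _).trans (hK.bound _ _))
      (sq_nonneg _)

/-- The position is off by 4ε²K and the phase by ωεs with s ≤ 2, so the error is of first order in
ε. -/
lemma norm_force_sub_le (hK : ProfBounds g ω K) (hc : |c| ≤ 1) (hε : 0 < ε) (hε1 : ε ≤ 1)
    (h : IsBodySol g ω φ c y p) (h0 : y 0 = b - (1 / 2 : ℝ) • u) (h1 : p 0 = ε⁻¹ • u)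
    {s : ℝ} (hs : s ∈ Set.Icc (0 : ℝ) 2) :
    ‖c • g (y (ε * s)) (φ + toTorus ((ε * s) • ω)) - c • g (line u b s) φ‖ ≤
      ε * (4 * K ^ 2 + 2 * K) := by
  rw [← smul_sub]
  refine (norm_coupling_smul_le hc _).trans ?_
  have e1 := hK.lip_space (y (ε * s)) (line u b s) (φ + toTorus ((ε * s) • ω))
  have e2 := hK.lip_time (line u b s) φ (ε * s)
  have e3 := mul_le_mul_of_nonneg_left (norm_scaled_sub_line_le hK hc hε h h0 h1 s hs).1 hK.nonneg
  have e4 := norm_sub_le_norm_sub_add_norm_sub (g (y (ε * s)) (φ + toTorus ((ε * s) • ω)))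
    (g (line u b s) (φ + toTorus ((ε * s) • ω))) (g (line u b s) φ)
  have e5 : |ε * s| ≤ ε * 2 := by
    rw [abs_of_nonneg (mul_nonneg hε.le hs.1)]
    exact mul_le_mul_of_nonneg_left hs.2 hε.le
  have e6 := mul_le_mul_of_nonneg_left e5 hK.nonneg
  have e7 : ε ^ 2 * K ^ 2 ≤ ε * K ^ 2 :=
    mul_le_mul_of_nonneg_right (by nlinarith) (sq_nonneg K)
  nlinarith

/-- Subtracting the linear response leaves a second derivative equal to ε² times the force error of
`norm_force_sub_le`, hence of order ε³. -/
lemma norm_scaled_sub_line_sub_deflection_le (hg : Prof 3 g) (hK : ProfBounds g ω K)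
    (hc : |c| ≤ 1) (hε : 0 < ε) (hε1 : ε ≤ 1) (h : IsBodySol g ω φ c y p)
    (h0 : y 0 = b - (1 / 2 : ℝ) • u) (h1 : p 0 = ε⁻¹ • u) {s : ℝ} (hs : s ∈ Set.Icc (0 : ℝ) 2) :
    ‖y (ε * s) - line u b s - (ε ^ 2 * c) • deflection g u b φ s‖ ≤
      4 * (ε ^ 3 * (4 * K ^ 2 + 2 * K)) := by
  have hc1 : Continuous fun r => g (line u b r) φ :=
    hg.continuous_comp_line (by fun_prop) (by fun_prop) (by fun_prop) (by fun_prop)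
  have hI : ∀ s, HasDerivAt (fun s => ∫ r in (0 : ℝ)..s, g (line u b r) φ) (g (line u b s) φ) s :=
    fun s => intervalIntegral.integral_hasDerivAt_right (hc1.intervalIntegrable 0 s)
      (hc1.stronglyMeasurableAtFilter _ _) hc1.continuousAt
  have hK0 := hK.nonneg
  refine (norm_le_of_second_deriv_bound (K := ε ^ 3 * (4 * K ^ 2 + 2 * K)) (by positivity) ?_ ?_
    (fun s => ((h.hasDerivAt_scaled ε s).1.sub (hasDerivAt_line u b s)).sub
      ((hasDerivAt_deflection hg u b φ s).const_smul (ε ^ 2 * c)))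
    (fun s => ((h.hasDerivAt_scaled ε s).2.sub_const u).sub ((hI s).const_smul (ε ^ 2 * c)))
    (fun s hs => ?_) s hs).1
  · simp only [Pi.sub_apply, Pi.smul_apply, mul_zero, h0, line, zero_sub, deflection,
      intervalIntegral.integral_same]
    module
  · simp [h1, smul_smul, hε.ne']
  · rw [mul_smul (ε ^ 2) c, ← smul_sub, norm_smul, norm_pow, Real.norm_of_nonneg hε.le]
    calc _ ≤ ε ^ 2 * (ε * (4 * K ^ 2 + 2 * K)) :=
          mul_le_mul_of_nonneg_left (norm_force_sub_le hK hc hε hε1 h h0 h1 hs) (sq_nonneg _)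
      _ = _ := by ring

/-- A fast particle has left the support of the force at time `2 / ‖v‖`, and does not come back. -/
lemma force_eq_zero_of_lt (hg : Prof 3 g) (hK : ProfBounds g ω K) (hc : |c| ≤ 1) (hε : 0 < ε)
    (hεK : 8 * (ε ^ 2 * K) ≤ 1) (hu : ‖u‖ = 1) (hbu : ⟪b, u⟫ = 0) (h : IsBodySol g ω φ c y p)
    (h0 : y 0 = b - (1 / 2 : ℝ) • u) (h1 : p 0 = ε⁻¹ • u) {t : ℝ} (ht : ε * 2 ≤ t) :
    g (y t) (φ + toTorus (t • ω)) = 0 := by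
  obtain ⟨e1, e2⟩ := norm_scaled_sub_line_le hK hc hε h h0 h1 2 ⟨by norm_num, le_rfl⟩
  set T := ε * 2 with hT
  have hin : ∀ x : E d, -‖x‖ ≤ ⟪x, u⟫ := fun x => by
    have := abs_le.1 (abs_real_inner_le_norm x u)
    rw [hu, mul_one] at this
    exact this.1
  have huu : ⟪u, u⟫ = (1 : ℝ) := by rw [real_inner_self_eq_norm_sq, hu]; norm_num
  -- At s = 2 the free line has height 3/2 in the direction u, and the trajectory differs from it by
  -- 4ε²K ≤ 1/2. The rescaled velocity is off by at most 1/4, so it still points outwards.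
  have f1 : 1 ≤ ⟪y T, u⟫ := by
    have := hin (y T - line u b 2)
    have h2 : ⟪line u b 2, u⟫ = 3 / 2 := by
      rw [line, inner_add_left, hbu, real_inner_smul_left, huu]; norm_num
    rw [inner_sub_left, h2] at this
    linarith
  have f2 : 0 ≤ ⟪p T, u⟫ := by
    have := hin (ε • p T - u)
    rw [inner_sub_left, real_inner_smul_left, huu] at this
    have : 0 ≤ ε * ⟪p T, u⟫ := by linarith
    exact nonneg_of_mul_nonneg_right this hε
  have hout : ∀ r, T ≤ r → ∀ ψ, g (y T + (r - T) • p T) ψ = 0 := by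
    intro r hr ψ
    refine hg.support _ _ ?_
    have h3 : 1 ≤ ⟪y T + (r - T) • p T, u⟫ := by
      rw [inner_add_left, real_inner_smul_left]
      have := mul_nonneg (sub_nonneg.2 hr) f2
      linarith
    have h4 := real_inner_le_norm (y T + (r - T) • p T) u
    rw [hu, mul_one] at h4
    linarith
  -- From time T on, uniform motion stays outside the support and so solves the full equation;
  -- uniqueness forward in time identifies it with the trajectory.
  have hz : ∀ r, T ≤ r → HasDerivAt (fun r => (y T + (r - T) • p T, p T))
      (bodyField g ω φ c r (y T + (r - T) • p T, p T)) r := by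
    intro r hr
    rw [bodyField, hout r hr, smul_zero]
    refine HasDerivAt.prodMk ?_ (hasDerivAt_const _ _)
    simpa using (((hasDerivAt_id r).sub_const T).smul_const (p T)).const_add (y T)
  obtain ⟨L, hL⟩ := exists_bodyField_lipschitzWith hg ω φ c
  have key := ODE_solution_unique_of_mem_Icc_right (a := T) (b := t) (s := fun _ => Set.univ)
    (f := fun r => (y r, p r)) (g := fun r => (y T + (r - T) • p T, p T))
    (fun r _ => (hL r).lipschitzOnWith)
    (fun r _ => (h.hasDerivAt r).continuousAt.continuousWithinAt)
    (fun r _ => (h.hasDerivAt r).hasDerivWithinAt) (fun _ _ => Set.mem_univ _)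
    (fun r hr => (hz r hr.1).continuousAt.continuousWithinAt)
    (fun r hr => (hz r hr.1).hasDerivWithinAt) (fun _ _ => Set.mem_univ _) (by simp)
    ⟨ht, le_rfl⟩
  have key' : y t = y T + (t - T) • p T := congrArg Prod.fst key
  rw [key', hout t ht]

lemma integral_force_eq (hg : Prof 3 g) (hK : ProfBounds g ω K) (hc : |c| ≤ 1) (hε : 0 < ε)
    (hεK : 8 * (ε ^ 2 * K) ≤ 1) (hu : ‖u‖ = 1) (hbu : ⟪b, u⟫ = 0) (h : IsBodySol g ω φ c y p)
    (h0 : y 0 = b - (1 / 2 : ℝ) • u) (h1 : p 0 = ε⁻¹ • u) :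
    ∫ t in Set.Ioi (0 : ℝ), c • g (y t) (φ + toTorus (t • ω)) =
      ε • ∫ s in (0 : ℝ)..2, c • g (y (ε * s)) (φ + toTorus ((ε * s) • ω)) := by
  rw [intervalIntegral.integral_comp_mul_left
    (fun t => c • g (y t) (φ + toTorus (t • ω))) hε.ne', smul_inv_smul₀ hε.ne', mul_zero,
    intervalIntegral.integral_of_le (by positivity)]
  refine setIntegral_eq_of_subset_of_forall_sdiff_eq_zero measurableSet_Ioi
    Set.Ioc_subset_Ioi_self fun t ht => ?_
  have : ε * 2 ≤ t := by
    by_contra hlt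
    exact ht.2 ⟨ht.1, (not_le.1 hlt).le⟩
  rw [force_eq_zero_of_lt hg hK hc hε hεK hu hbu h h0 h1 this, smul_zero]

/-- The constant of the expansion of the momentum transfer. -/
noncomputable def expConst (K : ℝ) : ℝ := 16 * K ^ 3 + 8 * K ^ 2 + 4 * K * (4 * K ^ 2 + 2 * K) + 8 * K

/-- Four errors of order ε³, one for each summand of `expConst`: the Taylor remainder in space
(`t1`), the phase shift in the space derivative (`t2`), the replacement of the displacement by
`deflection` (`t3`), and the Taylor remainder in the phase (`t4`). -/
lemma norm_force_expansion_le (hg : Prof 3 g) (hK : ProfBounds g ω K) (hc : |c| ≤ 1) (hε : 0 < ε)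
    (hε1 : ε ≤ 1) (h : IsBodySol g ω φ c y p) (h0 : y 0 = b - (1 / 2 : ℝ) • u)
    (h1 : p 0 = ε⁻¹ • u) {s : ℝ} (hs : s ∈ Set.Icc (0 : ℝ) 2) :
    ‖c • g (y (ε * s)) (φ + toTorus ((ε * s) • ω)) -
      (c • g (line u b s) φ + (ε * c) • s • Dtau ω g (line u b s) φ +
      (ε ^ 2 * c) • (s ^ 2 / 2) • Dtau ω (Dtau ω g) (line u b s) φ +
      (ε ^ 2 * c ^ 2) • Dspace g (line u b s) φ (deflection g u b φ s))‖ ≤ expConst K * ε ^ 3 := by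
  set ψ := φ + toTorus ((ε * s) • ω) with hψ
  set x := line u b s
  set z := y (ε * s)
  have hK0 := hK.nonneg
  have hεs : 0 ≤ ε * s := mul_nonneg hε.le hs.1
  have hεs2 : ε * s ≤ ε * 2 := mul_le_mul_of_nonneg_left hs.2 hε.le
  have e1 : ‖z - x‖ ≤ 4 * (ε ^ 2 * K) := (norm_scaled_sub_line_le hK hc hε h h0 h1 s hs).1
  have e2 : ‖z - x - (ε ^ 2 * c) • deflection g u b φ s‖ ≤ 4 * (ε ^ 3 * (4 * K ^ 2 + 2 * K)) :=
    norm_scaled_sub_line_sub_deflection_le hg hK hc hε hε1 h h0 h1 hs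
  have t1 : ‖g z ψ - g x ψ - Dspace g x ψ (z - x)‖ ≤ 16 * K ^ 3 * ε ^ 3 := by
    refine (hK.taylor_space x z ψ).trans ?_
    have : ‖z - x‖ ^ 2 ≤ (4 * (ε ^ 2 * K)) ^ 2 := pow_le_pow_left₀ (norm_nonneg _) e1 2
    have h4 : ε ^ 4 ≤ ε ^ 3 := pow_le_pow_of_le_one hε.le hε1 (by norm_num)
    calc K * ‖z - x‖ ^ 2 ≤ K * (4 * (ε ^ 2 * K)) ^ 2 := mul_le_mul_of_nonneg_left this hK0
      _ = 16 * K ^ 3 * ε ^ 4 := by ring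
      _ ≤ _ := mul_le_mul_of_nonneg_left h4 (by positivity)
  have t2 : ‖(Dspace g x ψ - Dspace g x φ) (z - x)‖ ≤ 8 * K ^ 2 * ε ^ 3 := by
    refine (ContinuousLinearMap.le_opNorm _ _).trans ?_
    have := hK.lip_time_dspace x φ (ε * s)
    rw [abs_of_nonneg hεs] at this
    calc _ ≤ (K * (ε * 2)) * (4 * (ε ^ 2 * K)) :=
          mul_le_mul (this.trans (mul_le_mul_of_nonneg_left hεs2 hK0)) e1 (norm_nonneg _)
            (by positivity)
      _ = _ := by ring
  have t3 : ‖Dspace g x φ (z - x - (ε ^ 2 * c) • deflection g u b φ s)‖ ≤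
      4 * K * (4 * K ^ 2 + 2 * K) * ε ^ 3 := by
    refine (ContinuousLinearMap.le_opNorm _ _).trans ?_
    calc _ ≤ K * (4 * (ε ^ 3 * (4 * K ^ 2 + 2 * K))) :=
          mul_le_mul (hK.bound_dspace x φ) e2 (norm_nonneg _) hK0
      _ = _ := by ring
  have t4 : ‖g x ψ - g x φ - (ε * s) • Dtau ω g x φ
        - ((ε * s) ^ 2 / 2) • Dtau ω (Dtau ω g) x φ‖ ≤ 8 * K * ε ^ 3 := by
    refine (hK.taylor_time x φ (ε * s) hεs).trans ?_
    calc K * (ε * s) ^ 3 ≤ K * (ε * 2) ^ 3 :=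
          mul_le_mul_of_nonneg_left (pow_le_pow_left₀ hεs hεs2 3) hK0
      _ = _ := by ring
  have heq : c • g z ψ - (c • g x φ + (ε * c) • s • Dtau ω g x φ +
      (ε ^ 2 * c) • (s ^ 2 / 2) • Dtau ω (Dtau ω g) x φ +
      (ε ^ 2 * c ^ 2) • Dspace g x φ (deflection g u b φ s)) =
      c • ((g z ψ - g x ψ - Dspace g x ψ (z - x)) + (Dspace g x ψ - Dspace g x φ) (z - x) +
        Dspace g x φ (z - x - (ε ^ 2 * c) • deflection g u b φ s) +
        (g x ψ - g x φ - (ε * s) • Dtau ω g x φ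
        - ((ε * s) ^ 2 / 2) • Dtau ω (Dtau ω g) x φ)) := by
    rw [map_sub _ (z - x), map_smul, _root_.sub_apply]
    module
  rw [heq]
  refine (norm_coupling_smul_le hc _).trans ((norm_add₄_le).trans ?_)
  rw [expConst]
  linarith

/-- High velocity expansion of the momentum transfer, in the frame of the scatterer. -/
theorem norm_integral_force_expansion_le (hg : Prof 3 g) (hK : ProfBounds g ω K) (hc : |c| ≤ 1)
    (hε : 0 < ε) (hε1 : ε ≤ 1) (hεK : 8 * (ε ^ 2 * K) ≤ 1) (hu : ‖u‖ = 1) (hbu : ⟪b, u⟫ = 0)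
    (h : IsBodySol g ω φ c y p) (h0 : y 0 = b - (1 / 2 : ℝ) • u) (h1 : p 0 = ε⁻¹ • u) :
    ‖(∫ t in Set.Ioi (0 : ℝ), c • g (y t) (φ + toTorus (t • ω))) -
      (ε • c • aOne g u b φ + ε ^ 2 • c • aTwo g ω u b φ +
        ε ^ 3 • (c • aThreeLin g ω u b φ + c ^ 2 • aThreeQuad g u b φ))‖ ≤
      2 * expConst K * ε ^ 4 := by
  have hy : Continuous y := continuous_iff_continuousAt.2 fun t => (h.pos t).continuousAt
  have c0 : Continuous fun s => c • g (y (ε * s)) (φ + toTorus ((ε * s) • ω)) :=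
    hg.continuous_smul_comp ω continuous_const (by fun_prop) continuous_const (by fun_prop)
  have c1 : Continuous fun s => g (line u b s) φ :=
    hg.continuous_comp_line continuous_const continuous_const continuous_const continuous_id
  have c2 : Continuous fun s : ℝ => s • Dtau ω g (line u b s) φ :=
    continuous_id.smul ((Prof.dtau (k := 2) hg ω).continuous_comp_line
      continuous_const continuous_const continuous_const continuous_id)
  have c3 : Continuous fun s : ℝ => (s ^ 2 / 2) • Dtau ω (Dtau ω g) (line u b s) φ :=
    ((continuous_id.pow 2).div_const 2).smul
      ((Prof.dtau (k := 1) (Prof.dtau (k := 2) hg ω) ω).continuous_comp_line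
        continuous_const continuous_const continuous_const continuous_id)
  have c4 : Continuous fun s => Dspace g (line u b s) φ (deflection g u b φ s) :=
    ((Prof.dspace (k := 2) hg).continuous_comp_line
      continuous_const continuous_const continuous_const continuous_id).clm_apply
      (continuous_iff_continuousAt.2 fun s => (hasDerivAt_deflection hg u b φ s).continuousAt)
  have i0 := c0.intervalIntegrable (μ := volume) 0 2
  have i1 : IntervalIntegrable (fun s => c • g (line u b s) φ) volume 0 2 :=
    (c1.const_smul c).intervalIntegrable 0 2
  have i2 : IntervalIntegrable (fun s : ℝ => (ε * c) • s • Dtau ω g (line u b s) φ) volume 0 2 :=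
    (c2.const_smul (ε * c)).intervalIntegrable 0 2
  have i3 : IntervalIntegrable (fun s : ℝ =>
      (ε ^ 2 * c) • (s ^ 2 / 2) • Dtau ω (Dtau ω g) (line u b s) φ) volume 0 2 :=
    (c3.const_smul (ε ^ 2 * c)).intervalIntegrable 0 2
  have i4 : IntervalIntegrable (fun s : ℝ =>
      (ε ^ 2 * c ^ 2) • Dspace g (line u b s) φ (deflection g u b φ s)) volume 0 2 :=
    (c4.const_smul (ε ^ 2 * c ^ 2)).intervalIntegrable 0 2
  have hsum : ε • c • aOne g u b φ + ε ^ 2 • c • aTwo g ω u b φ +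
        ε ^ 3 • (c • aThreeLin g ω u b φ + c ^ 2 • aThreeQuad g u b φ) =
      ε • ∫ s in (0 : ℝ)..2, (c • g (line u b s) φ + (ε * c) • s • Dtau ω g (line u b s) φ +
      (ε ^ 2 * c) • (s ^ 2 / 2) • Dtau ω (Dtau ω g) (line u b s) φ +
      (ε ^ 2 * c ^ 2) • Dspace g (line u b s) φ (deflection g u b φ s)) := by
    rw [intervalIntegral.integral_add ((i1.add i2).add i3) i4,
      intervalIntegral.integral_add (i1.add i2) i3, intervalIntegral.integral_add i1 i2,
      intervalIntegral.integral_smul, intervalIntegral.integral_smul,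
      intervalIntegral.integral_smul, intervalIntegral.integral_smul, ← aOne, ← aTwo,
      ← aThreeLin, ← aThreeQuad]
    module
  rw [integral_force_eq hg hK hc hε hεK hu hbu h h0 h1, hsum, ← smul_sub,
    ← intervalIntegral.integral_sub i0 (((i1.add i2).add i3).add i4), norm_smul,
    Real.norm_of_nonneg hε.le]
  have hb := intervalIntegral.norm_integral_le_of_norm_le_const (a := (0 : ℝ)) (b := 2)
    (C := expConst K * ε ^ 3) (f := fun s => c • g (y (ε * s)) (φ + toTorus ((ε * s) • ω)) -
      (c • g (line u b s) φ + (ε * c) • s • Dtau ω g (line u b s) φ +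
      (ε ^ 2 * c) • (s ^ 2 / 2) • Dtau ω (Dtau ω g) (line u b s) φ +
      (ε ^ 2 * c ^ 2) • Dspace g (line u b s) φ (deflection g u b φ s))) (fun s hs => by
        rw [Set.uIoc_of_le (by norm_num)] at hs
        exact norm_force_expansion_le hg hK hc hε hε1 h h0 h1 ⟨hs.1.le, hs.2⟩)
  rw [sub_zero, abs_of_nonneg (by norm_num : (0 : ℝ) ≤ 2)] at hb
  calc _ ≤ ε * (expConst K * ε ^ 3 * 2) := mul_le_mul_of_nonneg_left hb hε.le
    _ = _ := by ring

end expansion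

/-! ### Expansion of the momentum transfer in the laboratory frame -/

section lab

variable {d m : ℕ} {g : E d → Torus m → E d} {ω : E m}

/-- Explicit expressions for the coefficients `α^(k)`, `k ≤ 3`. -/
noncomputable def alphaE (g : E d → Torus m → E d) (ω : E m) (k : ℕ) (e : E d) (κ : Kappa d m) :
    E d :=
  match k with
  | 1 => rot κ.2.1 (κ.2.2.2 • aOne g (rot κ.2.1⁻¹ e) (rot κ.2.1⁻¹ κ.1) κ.2.2.1)
  | 2 => rot κ.2.1 (κ.2.2.2 • aTwo g ω (rot κ.2.1⁻¹ e) (rot κ.2.1⁻¹ κ.1) κ.2.2.1)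
  | 3 => rot κ.2.1 (κ.2.2.2 • aThreeLin g ω (rot κ.2.1⁻¹ e) (rot κ.2.1⁻¹ κ.1) κ.2.2.1 +
      κ.2.2.2 ^ 2 • aThreeQuad g (rot κ.2.1⁻¹ e) (rot κ.2.1⁻¹ κ.1) κ.2.2.1)
  | _ => 0

/-- The coefficients `β^(ℓ)`, `ℓ ≤ 2`, in the frame of the scatterer. -/
noncomputable def betaBody (g : E d → Torus m → E d) (ω : E m) (l : ℕ) (u b : E d) (φ : Torus m)
    (c : ℝ) : ℝ :=
  match l with
  | 0 => c * ⟪u, aOne g u b φ⟫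
  | 1 => c * ⟪u, aTwo g ω u b φ⟫
  | _ => c * ⟪u, aThreeLin g ω u b φ⟫ +
      c ^ 2 * ((1 / 2) * ‖aOne g u b φ‖ ^ 2 + ⟪u, aThreeQuad g u b φ⟫)

/-- Explicit expressions for the coefficients `β^(ℓ)`, `ℓ ≤ 2`. -/
noncomputable def betaE (g : E d → Torus m → E d) (ω : E m) (l : ℕ) (e : E d) (κ : Kappa d m) : ℝ :=
  betaBody g ω l (rot κ.2.1⁻¹ e) (rot κ.2.1⁻¹ κ.1) κ.2.2.1 κ.2.2.2

lemma dir_smul {v : E d} (hv : v ≠ 0) : ‖v‖ • dir v = v := by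
  rw [dir, smul_inv_smul₀ (norm_ne_zero_iff.2 hv)]

lemma norm_dir {v : E d} (hv : v ≠ 0) : ‖dir v‖ = 1 := by
  rw [dir, norm_smul, norm_inv, norm_norm, inv_mul_cancel₀ (norm_ne_zero_iff.2 hv)]

lemma dir_smul_of_pos {s : ℝ} (hs : 0 < s) {e : E d} (he : ‖e‖ = 1) : dir (s • e) = e := by
  rw [dir, norm_smul, he, mul_one, Real.norm_of_nonneg hs.le, inv_smul_smul₀ hs.ne']

lemma admissible_smul_iff {s : ℝ} (hs : s ≠ 0) (v : E d) (κ : Kappa d m) :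
    Admissible (s • v) κ ↔ Admissible v κ := by
  simp [Admissible, real_inner_smul_right, hs]

lemma admissible_dir_iff {v : E d} (hv : v ≠ 0) (κ : Kappa d m) :
    Admissible (dir v) κ ↔ Admissible v κ :=
  admissible_smul_iff (inv_ne_zero (norm_ne_zero_iff.2 hv)) v κ

/-- High velocity expansion of the momentum transfer. -/
theorem exists_R_expansion (hg : Prof 3 g) (ω : E m) :
    ∃ C V : ℝ, 0 ≤ C ∧ 1 ≤ V ∧ ∀ (v : E d) (κ : Kappa d m), V ≤ ‖v‖ → Admissible v κ →
      ‖R g ω v κ - ((‖v‖ ^ 1)⁻¹ • alphaE g ω 1 (dir v) κ + (‖v‖ ^ 2)⁻¹ • alphaE g ω 2 (dir v) κ +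
        (‖v‖ ^ 3)⁻¹ • alphaE g ω 3 (dir v) κ)‖ ≤ C / ‖v‖ ^ 4 := by
  obtain ⟨K, hK⟩ := hg.exists_bounds ω
  obtain ⟨Y, P, -, hY⟩ := exists_bodyFlow hg ω
  have hK0 := hK.nonneg
  -- For ‖v‖ ≥ 1 + 8K both ε ≤ 1 and 8ε²K ≤ 8εK ≤ 1 hold, which the expansion requires.
  refine ⟨2 * expConst K, 1 + 8 * K, ?_, by linarith, fun v κ hv hadm => ?_⟩
  · unfold expConst; positivity
  have hv1 : 1 ≤ ‖v‖ := by linarith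
  have hv0 : v ≠ 0 := norm_pos_iff.1 (by linarith)
  obtain ⟨h, h0, h1⟩ := hY
    (rot κ.2.1⁻¹ (κ.1 - (1 / 2 : ℝ) • dir v), rot κ.2.1⁻¹ v, κ.2.2)
  rw [R_eq hg h h0 h1]
  have hε1 : ‖v‖⁻¹ ≤ 1 := inv_le_one_of_one_le₀ hv1
  have hε0 : 0 < ‖v‖⁻¹ := by positivity
  have key := norm_integral_force_expansion_le (ε := ‖v‖⁻¹) (u := rot κ.2.1⁻¹ (dir v))
    (b := rot κ.2.1⁻¹ κ.1) hg hK (abs_le.2 hadm.2.2) hε0 hε1 ?_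
    (by rw [norm_rot, norm_dir hv0])
    (by rw [inner_rot_rot, dir, real_inner_smul_right, hadm.1, mul_zero]) h
    (by rw [h0, rot_sub, rot_smul]) (by rw [h1, inv_inv, ← rot_smul, dir_smul hv0])
  · rw [← norm_rot κ.2.1, rot_sub, rot_add, rot_add, rot_smul, rot_smul _ (‖v‖⁻¹ ^ 2),
      rot_smul _ (‖v‖⁻¹ ^ 3)] at key
    refine le_trans (le_of_eq ?_) (key.trans_eq ?_)
    · simp only [alphaE, pow_one, inv_pow]
    · rw [inv_pow, div_eq_mul_inv]
  · have h2 : ‖v‖⁻¹ ^ 2 ≤ ‖v‖⁻¹ := by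
      rw [sq]; exact mul_le_of_le_one_left hε0.le hε1
    have h3 : ‖v‖⁻¹ * (8 * K) ≤ 1 := by
      rw [inv_mul_le_iff₀ (by positivity)]; linarith
    nlinarith

/-! ### Identification of the coefficients -/

/-- A finite expansion determines its coefficients by successive limits, which is the recursion
defining `alpha`. Truncation moves one term at a time into the error, hence the induction on the
number i of omitted terms. -/
lemma tendsto_of_expansion {X : Type*} [NormedAddCommGroup X] [NormedSpace ℝ X] {f : ℝ → X}
    {a : ℕ → X} {n : ℕ} {C V : ℝ}
    (h : ∀ s, V ≤ s → ‖f s - ∑ j ∈ Finset.range (n + 1), (s ^ j)⁻¹ • a j‖ ≤ C / s ^ (n + 1)) :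
    ∀ k ≤ n, Tendsto (fun s => s ^ k • (f s - ∑ j ∈ Finset.range k, (s ^ j)⁻¹ • a j)) atTop
      (𝓝 (a k)) := by
  have hb : ∀ i ≤ n, ∃ C, ∀ s, max 1 V ≤ s →
      ‖f s - ∑ j ∈ Finset.range (n - i + 1), (s ^ j)⁻¹ • a j‖ ≤ C / s ^ (n - i + 1) := by
    intro i
    induction i with
    | zero => exact fun _ => ⟨C, fun s hs => h s ((le_max_right _ _).trans hs)⟩
    | succ i ih =>
      intro hi
      obtain ⟨C, hC⟩ := ih (by omega)
      obtain ⟨k, hk⟩ : ∃ k, n - i = k + 1 := ⟨n - i - 1, by omega⟩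
      have hk' : n - (i + 1) + 1 = k + 1 := by omega
      rw [hk] at hC
      rw [hk']
      refine ⟨C + ‖a (k + 1)‖, fun s hs => ?_⟩
      have hs1 : 1 ≤ s := (le_max_left _ _).trans hs
      have h1 := hC s hs
      have hC0 : 0 ≤ C := by
        have h3 : 0 < s ^ (k + 1 + 1) := by positivity
        have := (norm_nonneg _).trans h1
        rwa [le_div_iff₀ h3, zero_mul] at this
      rw [Finset.sum_range_succ, ← sub_sub] at h1
      have h2 := norm_le_norm_sub_add (f s - ∑ j ∈ Finset.range (k + 1), (s ^ j)⁻¹ • a j)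
        ((s ^ (k + 1))⁻¹ • a (k + 1))
      rw [norm_smul, Real.norm_of_nonneg (by positivity)] at h2
      have h4 : C / s ^ (k + 1 + 1) ≤ C / s ^ (k + 1) :=
        div_le_div_of_nonneg_left hC0 (by positivity) (pow_le_pow_right₀ hs1 (by omega))
      calc _ ≤ C / s ^ (k + 1) + (s ^ (k + 1))⁻¹ * ‖a (k + 1)‖ := by linarith
        _ = _ := by ring
  intro k hk
  obtain ⟨C, hC⟩ := hb (n - k) (by omega)
  rw [show n - (n - k) = k by omega] at hC
  rw [tendsto_iff_norm_sub_tendsto_zero]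
  have hlim : Tendsto (fun s : ℝ => C / s) atTop (𝓝 0) := tendsto_const_nhds.div_atTop tendsto_id
  refine squeeze_zero' (Eventually.of_forall fun _ => norm_nonneg _) ?_ hlim
  filter_upwards [eventually_ge_atTop (max 1 V)] with s hs
  have hs1 : 0 < s := zero_lt_one.trans_le ((le_max_left _ _).trans hs)
  have h1 := hC s hs
  rw [Finset.sum_range_succ, ← sub_sub] at h1
  have h2 : s ^ k • (f s - ∑ j ∈ Finset.range k, (s ^ j)⁻¹ • a j) - a k =
      s ^ k • (f s - ∑ j ∈ Finset.range k, (s ^ j)⁻¹ • a j - (s ^ k)⁻¹ • a k) := by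
    rw [smul_sub _ (f s - _), smul_inv_smul₀ (by positivity)]
  rw [h2, norm_smul, Real.norm_of_nonneg (by positivity)]
  calc _ ≤ s ^ k * (C / s ^ (k + 1)) := mul_le_mul_of_nonneg_left h1 (by positivity)
    _ = C / s := by field_simp; ring

lemma alpha_eq (hg : Prof 3 g) {e : E d} (he : ‖e‖ = 1) {κ : Kappa d m} (hκ : Admissible e κ) :
    ∀ k ≤ 3, alpha g ω k e κ = alphaE g ω k e κ := by
  obtain ⟨C, V, hC0, hV, hC⟩ := exists_R_expansion hg ω
  -- The sum starts at j = 0; the default case of `alphaE` supplies the coefficient α^(0) = 0.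
  have hT := tendsto_of_expansion (f := fun s => R g ω (s • e) κ) (a := fun k => alphaE g ω k e κ)
    (n := 3) (C := C) (V := V) (fun s hs => by
      have hs0 : 0 < s := by linarith
      have hn : ‖s • e‖ = s := by rw [norm_smul, he, mul_one, Real.norm_of_nonneg hs0.le]
      have := hC (s • e) κ (by rwa [hn]) ((admissible_smul_iff hs0.ne' e κ).2 hκ)
      rw [hn, dir_smul_of_pos hs0 he] at this
      refine le_trans (le_of_eq ?_) this
      simp only [Finset.sum_range_succ, Finset.range_zero, Finset.sum_empty]
      simp [alphaE])
  intro k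
  induction k using Nat.strong_induction_on with
  | _ k ih =>
    intro hk
    rw [alpha]
    refine Tendsto.limUnder_eq ?_
    refine (hT k hk).congr fun s => ?_
    rw [Finset.sum_range fun j => (s ^ j)⁻¹ • alphaE g ω j e κ]
    congr 2
    refine Finset.sum_congr rfl fun j _ => ?_
    rw [ih j j.2 (by have := j.2; omega)]

lemma beta_eq (hg : Prof 3 g) {e : E d} (he : ‖e‖ = 1) {κ : Kappa d m} (hκ : Admissible e κ) :
    ∀ l ≤ 2, beta g ω l e κ = betaE g ω l e κ := by
  have h := alpha_eq (ω := ω) hg he hκ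
  have hin : ∀ x, ⟪e, rot κ.2.1 x⟫ = ⟪rot κ.2.1⁻¹ e, x⟫ := fun x => by
    rw [real_inner_comm, inner_rot_left, real_inner_comm]
  intro l hl
  interval_cases l
  · simp [beta, h 0 (by norm_num), h 1 (by norm_num), alphaE, betaE, betaBody, hin,
      real_inner_smul_right]
  · simp [beta, h 0 (by norm_num), h 1 (by norm_num), h 2 (by norm_num), alphaE, betaE, betaBody,
      hin, real_inner_smul_right, Finset.Nat.antidiagonal_succ]
  · simp only [beta, Finset.Nat.antidiagonal_succ, Finset.Nat.antidiagonal_zero]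
    simp [h 0 (by norm_num), h 1 (by norm_num), h 2 (by norm_num), h 3 (by norm_num), alphaE,
      betaE, betaBody, hin, inner_add_right, real_inner_smul_right, norm_rot, norm_smul, mul_pow]
    ring

/-! ### The line integrals -/

lemma lt_norm_line {u b : E d} (hu : ‖u‖ = 1) (hbu : ⟪b, u⟫ = 0) {s : ℝ}
    (hs : s ∉ Set.Icc (0 : ℝ) 1) : 1 / 2 < ‖line u b s‖ := by
  have h1 := abs_real_inner_le_norm (line u b s) u
  rw [line, inner_add_left, hbu, real_inner_smul_left, real_inner_self_eq_norm_sq, hu] at h1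
  rw [line]
  refine lt_of_lt_of_le ?_ (h1.trans_eq (by ring))
  rw [one_pow, mul_one, zero_add, lt_abs]
  by_contra! hlt
  exact hs ⟨by linarith, by linarith⟩

/-- The line is in the ball only for s in [0, 1]. Hence the integrals over [0, 2] used for the
perturbation theory equal those over ℝ in `alphaOne` and `alphaTwo`. -/
lemma integral_line_eq {X : Type*} [NormedAddCommGroup X] [NormedSpace ℝ X] {u b : E d}
    (hu : ‖u‖ = 1) (hbu : ⟪b, u⟫ = 0) {f : E d → X} (hf : ∀ y, 1 / 2 < ‖y‖ → f y = 0) (w : ℝ → ℝ) :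
    ∫ s, w s • f (line u b s) = ∫ s in (0 : ℝ)..2, w s • f (line u b s) := by
  rw [intervalIntegral.integral_of_le (by norm_num), ← integral_Icc_eq_integral_Ioc]
  refine (setIntegral_eq_integral_of_forall_compl_eq_zero fun s hs => ?_).symm
  rw [hf _ (lt_norm_line hu hbu fun h => hs ⟨h.1, h.2.trans (by norm_num)⟩), smul_zero]

lemma rot_line (M : SO d) (e b : E d) (s : ℝ) :
    rot M (b + (s - 1 / 2) • e) = line (rot M e) (rot M b) s := by
  rw [rot_add, rot_smul, line]

lemma alphaE_one_eq (hg : Prof 3 g) {e : E d} (he : ‖e‖ = 1) {κ : Kappa d m}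
    (hκ : Admissible e κ) : alphaE g ω 1 e κ = alphaOne g e κ := by
  have hu : ‖rot κ.2.1⁻¹ e‖ = 1 := by rw [norm_rot, he]
  have hbu : ⟪rot κ.2.1⁻¹ κ.1, rot κ.2.1⁻¹ e⟫ = 0 := by rw [inner_rot_rot, hκ.1]
  have h := integral_line_eq hu hbu (f := fun y => g y κ.2.2.1) (fun y hy => hg.support y _ hy)
    (fun _ => 1)
  simp only [one_smul] at h
  simp only [alphaE, alphaOne, rot_line, aOne, ← h, rot_smul]
  congr 1
  exact ((rotL κ.2.1).toContinuousLinearEquiv.integral_comp_comm _).symm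

lemma alphaE_two_eq (hg : Prof 3 g) {e : E d} (he : ‖e‖ = 1) {κ : Kappa d m}
    (hκ : Admissible e κ) : alphaE g ω 2 e κ = alphaTwo g ω e κ := by
  have hu : ‖rot κ.2.1⁻¹ e‖ = 1 := by rw [norm_rot, he]
  have hbu : ⟪rot κ.2.1⁻¹ κ.1, rot κ.2.1⁻¹ e⟫ = 0 := by rw [inner_rot_rot, hκ.1]
  have h := integral_line_eq hu hbu (f := fun y => Dtau ω g y κ.2.2.1)
    (fun y hy => (Prof.dtau (k := 2) hg ω).support y _ hy) (fun s => s)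
  simp only [alphaE, alphaTwo, rot_line, aTwo, ← h, rot_smul]
  congr 1
  simp only [← rot_smul]
  exact ((rotL κ.2.1).toContinuousLinearEquiv.integral_comp_comm
    (fun s : ℝ => s • Dtau ω g (line (rot κ.2.1⁻¹ e) (rot κ.2.1⁻¹ κ.1) s) κ.2.2.1)).symm

/-! ### Bounds, continuity, and the energy transfer -/

lemma exists_bound_of_continuous {X : Type*} [NormedAddCommGroup X] {f : E d × E d × Torus m → X}
    (hf : Continuous f) :
    ∃ A, 0 ≤ A ∧ ∀ u b φ, ‖u‖ ≤ 1 → ‖b‖ ≤ 1 → ‖f (u, b, φ)‖ ≤ A := by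
  have hc : IsCompact (Metric.closedBall (0 : E d) 1 ×ˢ Metric.closedBall (0 : E d) 1 ×ˢ
      (Set.univ : Set (Torus m))) :=
    (isCompact_closedBall 0 _).prod ((isCompact_closedBall 0 _).prod isCompact_univ)
  obtain ⟨A, hA⟩ := hc.exists_bound_of_continuousOn hf.continuousOn
  exact ⟨max A 0, le_max_right _ _, fun u b φ hu hb =>
    (hA (u, b, φ) ⟨by simpa using hu, by simpa using hb, Set.mem_univ _⟩).trans (le_max_left _ _)⟩

lemma exists_alphaE_bound (hg : Prof 3 g) (ω : E m) :
    ∃ A, 0 ≤ A ∧ ∀ k e (κ : Kappa d m), ‖e‖ = 1 → Admissible e κ → ‖alphaE g ω k e κ‖ ≤ A := by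
  obtain ⟨A1, h10, h1⟩ := exists_bound_of_continuous (continuous_aOne hg)
  obtain ⟨A2, h20, h2⟩ := exists_bound_of_continuous (continuous_aTwo hg ω)
  obtain ⟨A3, h30, h3⟩ := exists_bound_of_continuous (continuous_aThreeLin hg ω)
  obtain ⟨A4, h40, h4⟩ := exists_bound_of_continuous (continuous_aThreeQuad hg)
  refine ⟨A1 + A2 + A3 + A4, by positivity, fun k e κ he hκ => ?_⟩
  have hu : ‖rot κ.2.1⁻¹ e‖ ≤ 1 := by rw [norm_rot, he]
  have hb : ‖rot κ.2.1⁻¹ κ.1‖ ≤ 1 := by rw [norm_rot]; linarith [hκ.2.1]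
  have hc : |κ.2.2.2| ≤ 1 := abs_le.2 hκ.2.2
  have hc2 : |κ.2.2.2 ^ 2| ≤ 1 := by rw [abs_pow]; exact pow_le_one₀ (abs_nonneg _) hc
  have e1 := (norm_coupling_smul_le hc _).trans (h1 _ _ κ.2.2.1 hu hb)
  have e2 := (norm_coupling_smul_le hc _).trans (h2 _ _ κ.2.2.1 hu hb)
  have e3 := (norm_coupling_smul_le hc _).trans (h3 _ _ κ.2.2.1 hu hb)
  have e4 := (norm_coupling_smul_le hc2 _).trans (h4 _ _ κ.2.2.1 hu hb)
  match k with
  | 1 => simp only [alphaE, norm_rot]; linarith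
  | 2 => simp only [alphaE, norm_rot]; linarith
  | 3 => simp only [alphaE, norm_rot]; exact (norm_add_le _ _).trans (by linarith)
  | 0 => simp only [alphaE, norm_zero]; positivity
  | (n + 4) => simp only [alphaE, norm_zero]; positivity

lemma betaE_eq (g : E d → Torus m → E d) (ω : E m) (e : E d) (κ : Kappa d m) :
    betaE g ω 0 e κ = ⟪e, alphaE g ω 1 e κ⟫ ∧ betaE g ω 1 e κ = ⟪e, alphaE g ω 2 e κ⟫ ∧
    betaE g ω 2 e κ = (1 / 2) * ‖alphaE g ω 1 e κ‖ ^ 2 + ⟪e, alphaE g ω 3 e κ⟫ := by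
  have hin : ∀ x, ⟪e, rot κ.2.1 x⟫ = ⟪rot κ.2.1⁻¹ e, x⟫ := fun x => by
    rw [real_inner_comm, inner_rot_left, real_inner_comm]
  refine ⟨?_, ?_, ?_⟩
  · simp [betaE, betaBody, alphaE, hin, real_inner_smul_right]
  · simp [betaE, betaBody, alphaE, hin, real_inner_smul_right]
  · simp [betaE, betaBody, alphaE, hin, inner_add_right, real_inner_smul_right, norm_rot,
      norm_smul, mul_pow]
    ring

lemma exists_betaE_bound (hg : Prof 3 g) (ω : E m) :
    ∃ A, 0 ≤ A ∧ ∀ l ≤ 2, ∀ e (κ : Kappa d m), ‖e‖ = 1 → Admissible e κ → |betaE g ω l e κ| ≤ A := by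
  obtain ⟨A, hA0, hA⟩ := exists_alphaE_bound hg ω
  refine ⟨A + A ^ 2, by positivity, fun l hl e κ he hκ => ?_⟩
  obtain ⟨b0, b1, b2⟩ := betaE_eq g ω e κ
  have hin : ∀ k, |⟪e, alphaE g ω k e κ⟫| ≤ A := fun k => by
    have := abs_real_inner_le_norm e (alphaE g ω k e κ)
    rw [he, one_mul] at this
    exact this.trans (hA k e κ he hκ)
  interval_cases l
  · rw [b0]; linarith [hin 1, sq_nonneg A]
  · rw [b1]; linarith [hin 2, sq_nonneg A]
  · rw [b2]
    refine (abs_add_le _ _).trans ?_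
    rw [abs_of_nonneg (by positivity)]
    have := pow_le_pow_left₀ (norm_nonneg _) (hA 1 e κ he hκ) 2
    linarith [hin 3, sq_nonneg A]

/-- High velocity expansion of the energy transfer. -/
theorem exists_deltaE_expansion (hg : Prof 3 g) (ω : E m) :
    ∃ C V : ℝ, 0 ≤ C ∧ 1 ≤ V ∧ ∀ (v : E d) (κ : Kappa d m), V ≤ ‖v‖ → Admissible v κ →
      |deltaE g ω v κ - (betaE g ω 0 (dir v) κ + ‖v‖⁻¹ * betaE g ω 1 (dir v) κ +
        (‖v‖ ^ 2)⁻¹ * betaE g ω 2 (dir v) κ)| ≤ C * (‖v‖ ^ 3)⁻¹ := by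
  obtain ⟨C, V, hC0, hV, hC⟩ := exists_R_expansion hg ω
  obtain ⟨A, hA0, hA⟩ := exists_alphaE_bound hg ω
  refine ⟨C + A * (2 * A + C) + (2 * A + C) ^ 2 / 2, V, by positivity, hV, fun v κ hv hκ => ?_⟩
  have hv1 : 1 ≤ ‖v‖ := hV.trans hv
  have hv0 : v ≠ 0 := norm_pos_iff.1 (by linarith)
  have he := norm_dir hv0
  have hκ' := (admissible_dir_iff hv0 κ).2 hκ
  obtain ⟨b0, b1, b2⟩ := betaE_eq g ω (dir v) κ
  rw [b0, b1, b2]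
  have key := hC v κ hv hκ
  have n1 := hA 1 _ κ he hκ'
  have n2 := hA 2 _ κ he hκ'
  have n3 := hA 3 _ κ he hκ'
  generalize alphaE g ω 1 (dir v) κ = α1 at *
  generalize alphaE g ω 2 (dir v) κ = α2 at *
  generalize alphaE g ω 3 (dir v) κ = α3 at *
  obtain ⟨ε, hε⟩ : ∃ ε, ε = ‖v‖⁻¹ := ⟨_, rfl⟩
  have hε0 : 0 < ε := by rw [hε]; positivity
  have hε1 : ε ≤ 1 := by rw [hε]; exact inv_le_one_of_one_le₀ hv1
  have hvε : v = ε⁻¹ • dir v := by rw [hε, inv_inv, dir_smul hv0]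
  set e := dir v
  rw [div_eq_mul_inv, ← inv_pow, ← inv_pow, ← inv_pow, ← inv_pow, ← hε, pow_one] at key
  rw [← inv_pow, ← inv_pow, ← hε]
  -- ρ is the remainder of `R` and σ everything beyond first order. As ‖v‖ = 1/ε, the pairing of v
  -- with ρ loses one order: this is why an O(ε³) error for the energy needs `R` up to O(ε⁴).
  set ρ := R g ω v κ - (ε • α1 + ε ^ 2 • α2 + ε ^ 3 • α3) with hρ
  set σ := ε ^ 2 • α2 + ε ^ 3 • α3 + ρ with hσ
  have hR : R g ω v κ = ε • α1 + σ := by rw [hσ, hρ]; module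
  have hσn : ‖σ‖ ≤ (2 * A + C) * ε ^ 2 := by
    refine norm_add₃_le.trans ?_
    rw [norm_smul, norm_smul, norm_pow, norm_pow, Real.norm_of_nonneg hε0.le]
    have p3 : ε ^ 3 ≤ ε ^ 2 := pow_le_pow_of_le_one hε0.le hε1 (by norm_num)
    have p4 : ε ^ 4 ≤ ε ^ 2 := pow_le_pow_of_le_one hε0.le hε1 (by norm_num)
    have q2 : ε ^ 2 * ‖α2‖ ≤ ε ^ 2 * A := by gcongr
    have q3 : ε ^ 3 * ‖α3‖ ≤ ε ^ 2 * A := by gcongr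
    have q4 : C * ε ^ 4 ≤ C * ε ^ 2 := by gcongr
    linarith
  have hE : deltaE g ω v κ - (⟪e, α1⟫ + ε * ⟪e, α2⟫ + ε ^ 2 * (1 / 2 * ‖α1‖ ^ 2 + ⟪e, α3⟫)) =
      ε⁻¹ * ⟪e, ρ⟫ + ε * ⟪α1, σ⟫ + 1 / 2 * ‖σ‖ ^ 2 := by
    have h1 : deltaE g ω v κ = ⟪v, R g ω v κ⟫ + 1 / 2 * ‖R g ω v κ‖ ^ 2 := by
      rw [deltaE, norm_add_sq_real]; ring
    have h2 : ⟪v, R g ω v κ⟫ = ⟪e, α1⟫ + ε * ⟪e, α2⟫ + ε ^ 2 * ⟪e, α3⟫ + ε⁻¹ * ⟪e, ρ⟫ := by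
      rw [hR, hσ, hvε]
      simp only [inner_add_right, real_inner_smul_left, real_inner_smul_right]
      field_simp
      ring
    rw [h1, h2, hR, norm_add_sq_real, norm_smul, real_inner_smul_left, Real.norm_of_nonneg hε0.le]
    ring
  rw [hE]
  have i1 : |ε⁻¹ * ⟪e, ρ⟫| ≤ C * ε ^ 3 := by
    have := abs_real_inner_le_norm e ρ
    rw [he, one_mul] at this
    rw [abs_mul, abs_of_pos (inv_pos.2 hε0), inv_mul_le_iff₀ hε0]
    exact (this.trans key).trans_eq (by ring)
  have i2 : |ε * ⟪α1, σ⟫| ≤ A * (2 * A + C) * ε ^ 3 := by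
    rw [abs_mul, abs_of_pos hε0]
    have := (abs_real_inner_le_norm α1 σ).trans (mul_le_mul n1 hσn (norm_nonneg _) hA0)
    calc _ ≤ ε * (A * ((2 * A + C) * ε ^ 2)) := mul_le_mul_of_nonneg_left this hε0.le
      _ = _ := by ring
  have i3 : |1 / 2 * ‖σ‖ ^ 2| ≤ (2 * A + C) ^ 2 / 2 * ε ^ 3 := by
    rw [abs_of_nonneg (by positivity)]
    have := pow_le_pow_left₀ (norm_nonneg _) hσn 2
    have p4 : ε ^ 4 ≤ ε ^ 3 := pow_le_pow_of_le_one hε0.le hε1 (by norm_num)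
    calc _ ≤ 1 / 2 * ((2 * A + C) * ε ^ 2) ^ 2 := by linarith
      _ = (2 * A + C) ^ 2 / 2 * ε ^ 4 := by ring
      _ ≤ _ := mul_le_mul_of_nonneg_left p4 (by positivity)
  calc _ ≤ |ε⁻¹ * ⟪e, ρ⟫| + |ε * ⟪α1, σ⟫| + |1 / 2 * ‖σ‖ ^ 2| := abs_add_three _ _ _
    _ ≤ _ := by linarith

end lab

/-! ### Averages over the impact parameter -/

section disc

variable {d : ℕ}

/-- Volume on the hyperplane times length along e is Lebesgue measure; this is the Fubini theorem
behind the average over the impact parameter. -/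
lemma measurePreserving_cylinder {e : E d} (he : ‖e‖ = 1) :
    MeasurePreserving (fun p : ℝ × (ℝ ∙ e)ᗮ => (p.2 : E d) + p.1 • e)
      ((volume : Measure ℝ).prod (volume : Measure (ℝ ∙ e)ᗮ)) volume := by
  have h1 := ((LinearIsometryEquiv.toSpanUnitSingleton e he).measurePreserving).prod
    (MeasurePreserving.id (volume : Measure (ℝ ∙ e)ᗮ))
  have h2 := WithLp.volume_preserving_toLp (ℝ ∙ e) (ℝ ∙ e)ᗮ
  have h3 := (ℝ ∙ e).orthogonalDecomposition.symm.measurePreserving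
  have h := h3.comp (h2.comp h1)
  suffices hfun : (fun p : ℝ × (ℝ ∙ e)ᗮ => (p.2 : E d) + p.1 • e) = _ by rw [hfun]; exact h
  funext p
  change _ = ((ℝ ∙ e).orthogonalDecomposition.symm.toLinearEquiv
    (WithLp.toLp 2 (LinearIsometryEquiv.toSpanUnitSingleton e he p.1, p.2)) : E d)
  rw [Submodule.toLinearEquiv_orthogonalDecomposition_symm]
  simp [add_comm]

lemma finrank_orthogonal_span {e : E d} (he : e ≠ 0) : Module.finrank ℝ (ℝ ∙ e)ᗮ = d - 1 := by
  have h := (ℝ ∙ e).finrank_add_finrank_orthogonal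
  rw [finrank_euclideanSpace_fin, finrank_span_singleton he] at h
  omega

lemma volume_disc {e : E d} (he : e ≠ 0) :
    (volume : Measure (ℝ ∙ e)ᗮ) (Metric.closedBall 0 (1 / 2)) =
      (volume : Measure (E (d - 1))) (Metric.closedBall 0 (1 / 2)) := by
  set f : (ℝ ∙ e)ᗮ ≃ₗᵢ[ℝ] E (d - 1) :=
    ((stdOrthonormalBasis ℝ (ℝ ∙ e)ᗮ).reindex (finCongr (finrank_orthogonal_span he))).repr
  have h := f.measurePreserving.measure_preimage
    (Metric.isClosed_closedBall (x := 0) (ε := 1 / 2)).measurableSet.nullMeasurableSet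
  rw [← h]
  congr 1
  ext x
  simp

lemma volume_disc_ne_zero {e : E d} :
    (volume : Measure (ℝ ∙ e)ᗮ) (Metric.closedBall 0 (1 / 2)) ≠ 0 :=
  (Metric.measure_closedBall_pos _ _ (by norm_num)).ne'

lemma volume_disc_ne_top {e : E d} :
    (volume : Measure (ℝ ∙ e)ᗮ) (Metric.closedBall 0 (1 / 2)) ≠ ⊤ :=
  (isCompact_closedBall _ _).measure_lt_top.ne

instance (e : E d) : IsProbabilityMeasure (discLaw e) := by
  have := ProbabilityTheory.cond_isProbabilityMeasure_of_finite (volume_disc_ne_zero (e := e))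
    volume_disc_ne_top
  exact Measure.isProbabilityMeasure_map measurable_subtype_coe.aemeasurable

lemma ae_discLaw (e : E d) : ∀ᵐ b ∂(discLaw e), ⟪b, e⟫ = 0 ∧ ‖b‖ ≤ 1 / 2 := by
  have hm : MeasurableSet {b : E d | ⟪b, e⟫ = 0 ∧ ‖b‖ ≤ 1 / 2} :=
    (measurableSet_eq_fun (f := fun b : E d => ⟪b, e⟫) (g := fun _ => (0 : ℝ))
      (by fun_prop) (by fun_prop)).inter
      (measurableSet_le (f := fun b : E d => ‖b‖) (by fun_prop) (by fun_prop))
  rw [discLaw, ae_map_iff measurable_subtype_coe.aemeasurable hm]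
  filter_upwards [ProbabilityTheory.ae_cond_mem₀
    (Metric.isClosed_closedBall (x := 0) (ε := 1 / 2)).measurableSet.nullMeasurableSet] with b hb
  refine ⟨?_, by simpa using hb⟩
  exact (Submodule.mem_orthogonal_singleton_iff_inner_left).1 b.2

/-- Integrating over the impact parameter and along the lines of direction `e` amounts to
integrating over the space. -/
lemma integral_discLaw_line {e : E d} (he : ‖e‖ = 1) {f : E d → ℝ} (hfm : Measurable f)
    (hf : Integrable f) (hf0 : ∀ x, 1 / 2 < ‖x‖ → f x = 0) :
    ∫ b, (∫ s : ℝ, f (line e b s)) ∂(discLaw e) = (ballVol d)⁻¹ * ∫ x, f x := by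
  have he0 : e ≠ 0 := by rw [← norm_pos_iff, he]; norm_num
  have h1 : ∀ b, ∫ s : ℝ, f (line e b s) = ∫ s : ℝ, f (b + s • e) := fun b =>
    integral_sub_right_eq_self (fun s => f (b + s • e)) (1 / 2)
  simp only [h1]
  have hsm : StronglyMeasurable fun b => ∫ s : ℝ, f (b + s • e) :=
    StronglyMeasurable.integral_prod_right (f := fun b (s : ℝ) => f (b + s • e))
      (hfm.comp (by fun_prop : Measurable fun p : E d × ℝ => p.1 + p.2 • e)).stronglyMeasurable
  rw [discLaw, integral_map measurable_subtype_coe.aemeasurable hsm.aestronglyMeasurable,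
    ProbabilityTheory.cond, integral_smul_measure, ENNReal.toReal_inv]
  have h2 : ((volume : Measure (ℝ ∙ e)ᗮ) (Metric.closedBall 0 (1 / 2))).toReal = ballVol d := by
    rw [volume_disc he0]; rfl
  rw [h2, smul_eq_mul]
  congr 1
  -- Lines with ‖b‖ > 1/2 miss the ball, so the disc may be enlarged to the whole hyperplane.
  rw [setIntegral_eq_integral_of_forall_compl_eq_zero]
  · have hmp := measurePreserving_cylinder he
    rw [← hmp.map_eq, integral_map hmp.measurable.aemeasurable hfm.aestronglyMeasurable]
    exact (integral_prod_symm _ (hmp.integrable_comp_of_integrable hf)).symm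
  · intro b hb
    have hb' : 1 / 2 < ‖b‖ := by simpa using hb
    have hbe : ⟪(b : E d), e⟫ = 0 := (Submodule.mem_orthogonal_singleton_iff_inner_left).1 b.2
    have : ∀ s : ℝ, f (b + s • e) = 0 := fun s => by
      refine hf0 _ ?_
      have h3 : ‖(b : E d) + s • e‖ ^ 2 = ‖(b : E d)‖ ^ 2 + s ^ 2 := by
        rw [norm_add_sq_real, real_inner_smul_right, hbe, norm_smul, he, mul_one, Real.norm_eq_abs,
          sq_abs]
        ring
      have h4 : ‖(b : E d)‖ ≤ ‖(b : E d) + s • e‖ :=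
        le_of_sq_le_sq (by rw [h3]; nlinarith [sq_nonneg s]) (norm_nonneg _)
      exact lt_of_lt_of_le hb' h4
    simp [this]

end disc

/-! ### Polar coordinates and Haar measure -/

section polar

variable {d : ℕ}

/-- The weight `‖z‖^{1-d}`. -/
noncomputable def weight (z : E d) : ℝ := (‖z‖ ^ (d - 1))⁻¹

lemma weight_nonneg (z : E d) : 0 ≤ weight z := by unfold weight; positivity

lemma measurable_weight : Measurable (weight : E d → ℝ) := by unfold weight; fun_prop

lemma nontrivial_E (hd : 1 ≤ d) : Nontrivial (E d) := by
  have : Nonempty (Fin d) := ⟨⟨0, hd⟩⟩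
  infer_instance

/-- The Jacobian t^{d-1} of polar coordinates cancels the weight and leaves the indicator of (0, r].
-/
lemma integrable_weight_indicator (hd : 1 ≤ d) (r : ℝ) :
    Integrable ((Metric.closedBall (0 : E d) r).indicator weight) := by
  have := nontrivial_E hd
  have h : (Metric.closedBall (0 : E d) r).indicator weight =
      fun z => (Set.Iic r).indicator (fun t : ℝ => (t ^ (d - 1))⁻¹) ‖z‖ := by
    funext z
    by_cases hz : ‖z‖ ≤ r
    · rw [Set.indicator_of_mem (by simpa using hz), Set.indicator_of_mem (by simpa using hz), weight]
    · rw [Set.indicator_of_notMem (by simpa using hz),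
        Set.indicator_of_notMem (by simpa using hz)]
  rw [h, integrable_fun_norm_addHaar, finrank_euclideanSpace_fin]
  have h2 : IntegrableOn ((Set.Iic r).indicator fun _ => (1 : ℝ)) (Set.Ioi 0) := by
    rw [IntegrableOn, integrable_indicator_iff measurableSet_Iic, IntegrableOn,
      Measure.restrict_restrict measurableSet_Iic, Set.inter_comm, Set.Ioi_inter_Iic]
    exact integrable_const _
  refine h2.congr_fun (fun t ht => ?_) measurableSet_Ioi
  have ht' : (t : ℝ) ^ (d - 1) ≠ 0 := pow_ne_zero _ (ne_of_gt ht)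
  by_cases htr : t ≤ r
  · simp [Set.indicator, htr, ht']
  · simp [Set.indicator, htr]

lemma sphereArea_pos (hd : 1 ≤ d) : 0 < sphereArea d := by
  have := nontrivial_E hd
  rw [sphereArea, Measure.toSphere_real_apply_univ, finrank_euclideanSpace_fin]
  have : 0 < (volume : Measure (E d)).real (Metric.ball 0 1) :=
    ENNReal.toReal_pos (Metric.measure_ball_pos _ _ one_pos).ne' measure_ball_lt_top.ne
  positivity

lemma integral_haar_rot_inv (Q : SO d) (f : E d → ℝ) (z : E d) :
    ∫ M, f (rot M⁻¹ (rot Q z)) ∂(haarSO d) = ∫ M, f (rot M⁻¹ z) ∂(haarSO d) := by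
  rw [← integral_mul_left_eq_self (fun M : SO d => f (rot M⁻¹ (rot Q z))) Q]
  refine integral_congr_ae (ae_of_all _ fun M => ?_)
  simp only [mul_inv_rev, rot_mul, rot_inv_rot]

/-- In dimension one, vectors of the same norm agree up to a sign. -/
lemma eq_or_eq_neg_of_norm_eq (hd : d = 1) {x y : E d} (h : ‖x‖ = ‖y‖) : x = y ∨ x = -y := by
  subst hd
  have hn : ∀ z : E 1, ‖z‖ = |z 0| := fun z => by
    rw [EuclideanSpace.norm_eq]; simp [Real.sqrt_sq_eq_abs]
  rw [hn, hn, abs_eq_abs] at h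
  rcases h with h | h
  · left; ext i; fin_cases i; exact h
  · right; ext i; fin_cases i; exact h

/-- For d ≥ 2 this is transitivity on spheres. In dimension one the rotation group is trivial and
does not link x to -x, so evenness of `K` must do so. -/
lemma integral_haar_eq_of_norm_eq (hd : 1 ≤ d) {K : E d → ℝ}
    (hK : 2 ≤ d ∨ ∀ z, K (-z) = K z) {x y : E d} (h : ‖x‖ = ‖y‖) :
    ∫ M, K (rot M⁻¹ x) ∂(haarSO d) = ∫ M, K (rot M⁻¹ y) ∂(haarSO d) := by
  by_cases hd2 : 2 ≤ d
  · obtain ⟨Q, rfl⟩ := exists_rot_eq hd2 h.symm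
    exact integral_haar_rot_inv Q K y
  · rcases eq_or_eq_neg_of_norm_eq (by omega) h with rfl | rfl
    · rfl
    · refine integral_congr_ae (ae_of_all _ fun M => ?_)
      have : rot M⁻¹ (-y) = -rot M⁻¹ y := map_neg (rotL M⁻¹) y
      simp only [this]
      exact (hK.resolve_left hd2) _

/-- Integration in polar coordinates, the sphere being parametrised by `M ↦ M⁻¹ e`. -/
theorem integral_haar_ray (hd : 1 ≤ d) {e : E d} (he : ‖e‖ = 1) {K : E d → ℝ} (hKm : Measurable K)
    {C : ℝ} (hC : ∀ z, |K z| ≤ C) (h0 : ∀ z, 1 < ‖z‖ → K z = 0)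
    (hK : 2 ≤ d ∨ ∀ z, K (-z) = K z) :
    ∫ M, (∫ t in (0 : ℝ)..2, K (t • rot M⁻¹ e)) ∂(haarSO d) =
      (sphereArea d)⁻¹ * ∫ z, weight z * K z := by
  have := nontrivial_E hd
  have hrot : Measurable fun p : E d × SO d => rot p.2⁻¹ p.1 :=
    measurable_rot_comp measurable_snd.inv measurable_fst
  have hint : Integrable (fun p : E d × SO d => weight p.1 * K (rot p.2⁻¹ p.1))
      ((volume : Measure (E d)).prod (haarSO d)) := by
    have hb : Integrable (fun p : E d × SO d =>
        C * (Metric.closedBall (0 : E d) 1).indicator weight p.1 * 1)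
        ((volume : Measure (E d)).prod (haarSO d)) :=
      ((integrable_weight_indicator hd 1).const_mul C).mul_prod (integrable_const (1 : ℝ))
    refine hb.mono' ((measurable_weight.comp measurable_fst).mul
      (hKm.comp hrot)).aestronglyMeasurable (ae_of_all _ fun p => ?_)
    rw [mul_one]
    by_cases hz : ‖p.1‖ ≤ 1
    · rw [Set.indicator_of_mem (by simpa using hz), norm_mul,
        Real.norm_of_nonneg (weight_nonneg _), mul_comm]
      exact mul_le_mul_of_nonneg_right (hC _) (weight_nonneg _)
    · rw [h0 _ (by rw [norm_rot]; exact not_le.1 hz), Set.indicator_of_notMem (by simpa using hz)]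
      simp
  -- Weight and Lebesgue measure are rotation invariant, so `K` may be replaced by its average over
  -- rotations; by `h2` that average is radial, and the one-dimensional polar formula applies.
  have h1 : ∫ z, weight z * K z = ∫ z, weight z * ∫ M, K (rot M⁻¹ z) ∂(haarSO d) := by
    calc ∫ z, weight z * K z
        = ∫ M, (∫ z, weight z * K (rot M⁻¹ z)) ∂(haarSO d) := by
          have : ∀ M : SO d, ∫ z, weight z * K (rot M⁻¹ z) = ∫ z, weight z * K z := fun M => by
            rw [← (measurePreserving_rot M⁻¹).integral_comp
              (rotL M⁻¹).toHomeomorph.measurableEmbedding (fun z => weight z * K z)]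
            simp only [weight, norm_rot]
          simp [this]
      _ = ∫ z, (∫ M, weight z * K (rot M⁻¹ z) ∂(haarSO d)) := (integral_integral_swap hint).symm
      _ = _ := by simp only [integral_const_mul]
  have h2 : ∀ z : E d, ∫ M, K (rot M⁻¹ z) ∂(haarSO d) = ∫ M, K (‖z‖ • rot M⁻¹ e) ∂(haarSO d) := by
    intro z
    have : ‖z‖ = ‖‖z‖ • e‖ := by rw [norm_smul, norm_norm, he, mul_one]
    rw [integral_haar_eq_of_norm_eq hd hK this]
    simp only [rot_smul]
  have h3 := integral_fun_norm_addHaar (volume : Measure (E d))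
    (fun t : ℝ => (t ^ (d - 1))⁻¹ * ∫ M, K (t • rot M⁻¹ e) ∂(haarSO d))
  have h4 : ∫ z, weight z * K z = sphereArea d *
      ∫ t in Set.Ioi (0 : ℝ), ∫ M, K (t • rot M⁻¹ e) ∂(haarSO d) := by
    rw [h1]
    simp only [h2]
    rw [sphereArea, Measure.toSphere_real_apply_univ, finrank_euclideanSpace_fin]
    simp only [weight]
    rw [h3, finrank_euclideanSpace_fin, nsmul_eq_mul, smul_eq_mul, ← mul_assoc]
    congr 1
    refine setIntegral_congr_fun measurableSet_Ioi fun t ht => ?_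
    have ht' : (t : ℝ) ^ (d - 1) ≠ 0 := pow_ne_zero _ (ne_of_gt ht)
    simp only [smul_eq_mul]
    rw [mul_inv_cancel_left₀ ht']
  have h5 : ∫ t in Set.Ioi (0 : ℝ), ∫ M, K (t • rot M⁻¹ e) ∂(haarSO d) =
      ∫ t in (0 : ℝ)..2, ∫ M, K (t • rot M⁻¹ e) ∂(haarSO d) := by
    rw [intervalIntegral.integral_of_le (by norm_num)]
    refine setIntegral_eq_of_subset_of_forall_sdiff_eq_zero measurableSet_Ioi
      Set.Ioc_subset_Ioi_self fun t ht => ?_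
    have ht2 : 2 < t := by
      by_contra hlt
      exact ht.2 ⟨ht.1, not_lt.1 hlt⟩
    have : ∀ M : SO d, K (t • rot M⁻¹ e) = 0 := fun M => h0 _ (by
      rw [norm_smul, norm_rot, he, Real.norm_eq_abs, abs_of_pos (by linarith)]; linarith)
    simp [this]
  have h6 : ∫ t in (0 : ℝ)..2, ∫ M, K (t • rot M⁻¹ e) ∂(haarSO d) =
      ∫ M, (∫ t in (0 : ℝ)..2, K (t • rot M⁻¹ e)) ∂(haarSO d) := by
    simp only [intervalIntegral.integral_of_le (by norm_num : (0 : ℝ) ≤ 2)]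
    refine integral_integral_swap ?_
    refine Integrable.of_bound (C := C) ?_ (ae_of_all _ fun p => hC _)
    refine (hKm.comp ?_).aestronglyMeasurable
    exact measurable_fst.smul (measurable_rot_comp measurable_snd.inv measurable_const)
  rw [h4, h5, h6, inv_mul_cancel_left₀ (sphereArea_pos hd).ne']

end polar

/-! ### A divergence identity -/

section divergence

variable {d : ℕ}

/-- The regularised weight `(‖z‖² + δ)^{(1-d)/2}`. -/
noncomputable def regWeight (δ : ℝ) (z : E d) : ℝ := (‖z‖ ^ 2 + δ) ^ (-((d - 1 : ℕ) : ℝ) / 2)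

lemma regWeight_zero (z : E d) : regWeight 0 z = weight z := by
  have hz' : 0 ≤ ‖z‖ := norm_nonneg z
  rw [regWeight, weight, add_zero, ← Real.rpow_natCast, ← Real.rpow_mul hz', ← Real.rpow_natCast,
    ← Real.rpow_neg hz']
  congr 1
  push_cast
  ring

lemma regWeight_le {δ : ℝ} (hδ : 0 ≤ δ) {z : E d} (hz : z ≠ 0) : regWeight δ z ≤ weight z := by
  rw [← regWeight_zero z, regWeight, regWeight, add_zero]
  have : 0 < ‖z‖ := norm_pos_iff.2 hz
  refine Real.rpow_le_rpow_of_nonpos (by positivity) (by linarith) ?_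
  have : (0 : ℝ) ≤ ((d - 1 : ℕ) : ℝ) := by positivity
  linarith

lemma regWeight_nonneg {δ : ℝ} (hδ : 0 ≤ δ) (z : E d) : 0 ≤ regWeight δ z :=
  Real.rpow_nonneg (by positivity) _

variable {p : E d → E d} {p' : E d → E d →L[ℝ] E d} {w : E d}

/-- The directional derivative along `w` of `z ↦ regWeight δ z * ⟪z, p z⟫`. -/
noncomputable def regDeriv (p : E d → E d) (p' : E d → E d →L[ℝ] E d) (w : E d) (δ : ℝ) (z : E d) :
    ℝ :=
  regWeight δ z * (⟪w, p z⟫ + ⟪z, p' z w⟫ -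
    ((d - 1 : ℕ) : ℝ) * (⟪z, w⟫ * ⟪z, p z⟫ / (‖z‖ ^ 2 + δ)))

lemma hasLineDerivAt_regWeight_mul (hp : ∀ z, HasFDerivAt p (p' z) z) {δ : ℝ} (hδ : 0 < δ)
    (z : E d) :
    HasLineDerivAt ℝ (fun z => regWeight δ z * ⟪z, p z⟫) (regDeriv p p' w δ z) z w := by
  have hz : HasDerivAt (fun t : ℝ => z + t • w) w 0 := by
    simpa using ((hasDerivAt_id (0 : ℝ)).smul_const w).const_add z
  have h0 : z + (0 : ℝ) • w = z := by simp
  have hp0 : HasDerivAt (fun t : ℝ => p (z + t • w)) (p' z w) 0 := by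
    refine HasFDerivAt.comp_hasDerivAt (f := fun t : ℝ => z + t • w) 0 ?_ hz
    rw [h0]; exact hp z
  have h1 := hz.inner ℝ hp0
  have h2 := hz.norm_sq.add_const δ
  have hpos : 0 < ‖z‖ ^ 2 + δ := by positivity
  have h3 := h2.rpow_const (p := -((d - 1 : ℕ) : ℝ) / 2) (Or.inl (by rw [h0]; exact hpos.ne'))
  have h4 : HasDerivAt (fun t : ℝ => regWeight δ (z + t • w) * ⟪z + t • w, p (z + t • w)⟫) _ 0 :=
    h3.mul h1
  refine h4.congr_deriv ?_
  rw [h0]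
  rw [regDeriv, regWeight, Real.rpow_sub_one hpos.ne']
  field_simp
  ring

lemma continuous_regWeight {δ : ℝ} (hδ : 0 < δ) : Continuous (regWeight δ : E d → ℝ) := by
  unfold regWeight
  refine Continuous.rpow_const (by fun_prop) fun z => Or.inl ?_
  have : 0 < ‖z‖ ^ 2 + δ := by positivity
  exact this.ne'

lemma continuous_regDeriv (hp : ∀ z, HasFDerivAt p (p' z) z) (hp' : Continuous p') {δ : ℝ}
    (hδ : 0 < δ) : Continuous (regDeriv p p' w δ) := by
  have hpc : Continuous p := continuous_iff_continuousAt.2 fun z => (hp z).continuousAt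
  unfold regDeriv
  refine (continuous_regWeight hδ).mul (Continuous.sub (by fun_prop) (continuous_const.mul
    (Continuous.div (by fun_prop) (by fun_prop) fun z => ?_)))
  have : 0 < ‖z‖ ^ 2 + δ := by positivity
  exact this.ne'

/-- Integration by parts against the constant 1. The regularisation δ > 0 removes the singularity at
the origin, and the support is compact. -/
lemma integral_regDeriv (hp : ∀ z, HasFDerivAt p (p' z) z) (hp' : Continuous p') {r : ℝ}
    (h0 : ∀ z, r < ‖z‖ → p z = 0) (h0' : ∀ z, r < ‖z‖ → p' z = 0) {δ : ℝ} (hδ : 0 < δ) :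
    ∫ z, regDeriv p p' w δ z = 0 := by
  have hpc : Continuous p := continuous_iff_continuousAt.2 fun z => (hp z).continuousAt
  have hcs : ∀ f : E d → ℝ, Continuous f → (∀ z, r < ‖z‖ → f z = 0) → Integrable f := by
    intro f hf hf0
    refine hf.integrable_of_hasCompactSupport
      (HasCompactSupport.intro (isCompact_closedBall 0 r) fun z hz => hf0 z ?_)
    simpa using hz
  have i1 : Integrable (regDeriv p p' w δ) := by
    refine hcs _ (continuous_regDeriv hp hp' hδ) fun z hz => ?_
    simp [regDeriv, h0 z hz, h0' z hz]
  have i2 : Integrable fun z => regWeight δ z * ⟪z, p z⟫ := by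
    refine hcs _ ((continuous_regWeight hδ).mul (by fun_prop)) fun z hz => ?_
    simp [h0 z hz]
  have h := integral_bilinear_hasLineDerivAt_right_eq_neg_left_of_integrable
    (μ := (volume : Measure (E d))) (B := ContinuousLinearMap.mul ℝ ℝ) (v := w)
    (f := fun _ => (1 : ℝ)) (f' := fun _ => (0 : ℝ)) (g := fun z => regWeight δ z * ⟪z, p z⟫)
    (g' := regDeriv p p' w δ) (by simp) (by simpa using i1) (by simpa using i2)
    (fun z _ => by simpa [HasLineDerivAt] using hasDerivAt_const (0 : ℝ) (1 : ℝ))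
    (fun z _ => hasLineDerivAt_regWeight_mul hp hδ z)
  simpa using h

/-- The integral of the derivative of `z ↦ ‖z‖^{1-d} ⟪z, p z⟫` in the direction `w` vanishes. -/
theorem integral_weight_divergence (hd : 1 ≤ d) (hp : ∀ z, HasFDerivAt p (p' z) z)
    (hp' : Continuous p') {r : ℝ} (h0 : ∀ z, r < ‖z‖ → p z = 0)
    (h0' : ∀ z, r < ‖z‖ → p' z = 0) :
    ∫ z, weight z * (⟪w, p z⟫ + ⟪z, p' z w⟫ -
      ((d - 1 : ℕ) : ℝ) * (⟪z, w⟫ * ⟪z, p z⟫ / ‖z‖ ^ 2)) = 0 := by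
  have hpc : Continuous p := continuous_iff_continuousAt.2 fun z => (hp z).continuousAt
  obtain ⟨P, hP⟩ := (isCompact_closedBall (0 : E d) r).exists_bound_of_continuousOn hpc.continuousOn
  obtain ⟨Q, hQ⟩ := (isCompact_closedBall (0 : E d) r).exists_bound_of_continuousOn
    hp'.continuousOn
  have hnontriv := nontrivial_E hd
  have hne : ∀ᵐ z : E d, z ≠ 0 := by
    rw [ae_iff]; simp
  -- The regularisation is removed by dominated convergence: for z ≠ 0 the bracket is bounded
  -- uniformly in δ on the ball of radius r, and `weight`, which dominates `regWeight`, is locally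
  -- integrable.
  have hlim : Tendsto (fun n : ℕ => ∫ z, regDeriv p p' w (1 / ((n : ℝ) + 1)) z) atTop
      (𝓝 (∫ z, weight z * (⟪w, p z⟫ + ⟪z, p' z w⟫ -
      ((d - 1 : ℕ) : ℝ) * (⟪z, w⟫ * ⟪z, p z⟫ / ‖z‖ ^ 2)))) := by
    refine tendsto_integral_of_dominated_convergence
      (fun z => (‖w‖ * P + r * (Q * ‖w‖) + ((d - 1 : ℕ) : ℝ) * (‖w‖ * P)) *
        (Metric.closedBall (0 : E d) r).indicator weight z)
      (fun n => (continuous_regDeriv hp hp' (by positivity)).aestronglyMeasurable)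
      ((integrable_weight_indicator hd r).const_mul _) (fun n => ?_) ?_
    · filter_upwards [hne] with z hz
      have hδ : (0 : ℝ) < 1 / ((n : ℝ) + 1) := by positivity
      generalize (1 : ℝ) / ((n : ℝ) + 1) = δ at hδ
      by_cases hzr : ‖z‖ ≤ r
      · rw [Set.indicator_of_mem (by simpa using hzr), regDeriv, norm_mul,
          Real.norm_of_nonneg (regWeight_nonneg hδ.le z), mul_comm]
        have hz0 : 0 < ‖z‖ := norm_pos_iff.2 hz
        have hPz := hP z (by simpa using hzr)
        have hQz := hQ z (by simpa using hzr)
        have b1 : |⟪w, p z⟫| ≤ ‖w‖ * P := (abs_real_inner_le_norm _ _).trans (by gcongr)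
        have b2 : |⟪z, p' z w⟫| ≤ r * (Q * ‖w‖) := by
          refine (abs_real_inner_le_norm _ _).trans (mul_le_mul hzr ?_ (norm_nonneg _)
            (hz0.le.trans hzr))
          exact ((p' z).le_opNorm w).trans (by gcongr)
        have b3 : |⟪z, w⟫ * ⟪z, p z⟫ / (‖z‖ ^ 2 + δ)| ≤ ‖w‖ * P := by
          rw [abs_div, abs_mul, abs_of_pos (by positivity : 0 < ‖z‖ ^ 2 + δ),
            div_le_iff₀ (by positivity)]
          have c1 := abs_real_inner_le_norm z w
          have c2 := abs_real_inner_le_norm z (p z)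
          have c3 : 0 ≤ ‖w‖ * P := mul_nonneg (norm_nonneg _) ((norm_nonneg _).trans hPz)
          calc |⟪z, w⟫| * |⟪z, p z⟫| ≤ (‖z‖ * ‖w‖) * (‖z‖ * P) := by
                refine mul_le_mul c1 (c2.trans (by gcongr)) (abs_nonneg _) (by positivity)
            _ = ‖w‖ * P * ‖z‖ ^ 2 := by ring
            _ ≤ _ := mul_le_mul_of_nonneg_left (by linarith) c3
        refine mul_le_mul ?_ (regWeight_le hδ.le hz) (regWeight_nonneg hδ.le z) ?_
        · refine (abs_sub _ _).trans (add_le_add ((abs_add_le _ _).trans (add_le_add b1 b2)) ?_)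
          rw [abs_mul, Nat.abs_cast]
          exact mul_le_mul_of_nonneg_left b3 (Nat.cast_nonneg _)
        · have c3 : 0 ≤ ‖w‖ * P := mul_nonneg (norm_nonneg _) ((norm_nonneg _).trans hPz)
          have c4 : 0 ≤ r * (Q * ‖w‖) := (abs_nonneg _).trans b2
          positivity
      · simp [regDeriv, h0 z (not_le.1 hzr), h0' z (not_le.1 hzr), Set.indicator, hzr]
    · filter_upwards [hne] with z hz
      have hz0 : ‖z‖ ^ 2 ≠ 0 := pow_ne_zero _ (norm_ne_zero_iff.2 hz)
      have hδ := tendsto_one_div_add_atTop_nhds_zero_nat (𝕜 := ℝ)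
      have hq : Tendsto (fun n : ℕ => ‖z‖ ^ 2 + 1 / ((n : ℝ) + 1)) atTop (𝓝 (‖z‖ ^ 2)) := by
        simpa using hδ.const_add (‖z‖ ^ 2)
      have hw : Tendsto (fun n : ℕ => regWeight (1 / ((n : ℝ) + 1)) z) atTop (𝓝 (weight z)) := by
        rw [← regWeight_zero z, regWeight, add_zero]
        exact hq.rpow_const (Or.inl hz0)
      unfold regDeriv
      exact hw.mul (tendsto_const_nhds.sub ((tendsto_const_nhds.div hq hz0).const_mul _))
  have hzero : ∀ n : ℕ, ∫ z, regDeriv p p' w (1 / ((n : ℝ) + 1)) z = 0 := fun n =>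
    integral_regDeriv hp hp' h0 h0' (by positivity)
  simp only [hzero] at hlim
  exact (tendsto_nhds_unique hlim tendsto_const_nhds)

end divergence

/-! ### Averages of two-point kernels -/

section kernels

variable {d : ℕ}

lemma integrable_weight_mul_prod (hd : 1 ≤ d) {k : E d → E d → ℝ}
    (hk : Measurable fun p : E d × E d => k p.1 p.2) {C : ℝ} (hC : ∀ x z, |k x z| ≤ C)
    (h0 : ∀ x z, 1 / 2 < ‖x‖ → k x z = 0) (h1 : ∀ x z, 1 < ‖z‖ → k x z = 0) :
    Integrable (fun p : E d × E d => weight p.2 * k p.1 p.2)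
      ((volume : Measure (E d)).prod volume) := by
  have hb : Integrable (fun p : E d × E d =>
      (Metric.closedBall (0 : E d) (1 / 2)).indicator (fun _ => C) p.1 *
        (Metric.closedBall (0 : E d) 1).indicator weight p.2)
      ((volume : Measure (E d)).prod volume) := by
    refine Integrable.mul_prod ?_ (integrable_weight_indicator hd 1)
    rw [integrable_indicator_iff Metric.isClosed_closedBall.measurableSet]
    exact integrableOn_const (isCompact_closedBall _ _).measure_lt_top.ne
  refine hb.mono' ((measurable_weight.comp measurable_snd).mul hk).aestronglyMeasurable
    (ae_of_all _ fun p => ?_)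
  have hC0 : 0 ≤ C := (abs_nonneg _).trans (hC 0 0)
  have hnn : 0 ≤ (Metric.closedBall (0 : E d) (1 / 2)).indicator (fun _ => C) p.1 *
        (Metric.closedBall (0 : E d) 1).indicator weight p.2 :=
    mul_nonneg (Set.indicator_nonneg (fun _ _ => hC0) _)
      (Set.indicator_nonneg (fun _ _ => weight_nonneg _) _)
  by_cases hx : ‖p.1‖ ≤ 1 / 2
  · by_cases hz : ‖p.2‖ ≤ 1
    · rw [Set.indicator_of_mem (by simpa using hx), Set.indicator_of_mem (by simpa using hz),
        norm_mul, Real.norm_of_nonneg (weight_nonneg _), mul_comm]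
      exact mul_le_mul_of_nonneg_right (hC _ _) (weight_nonneg _)
    · rw [h1 _ _ (not_le.1 hz), mul_zero, norm_zero]; exact hnn
  · rw [h0 _ _ (not_le.1 hx), mul_zero, norm_zero]; exact hnn

lemma integrable_of_bounded_support {X : Type*} [MeasurableSpace X] {μ : Measure X}
    [IsFiniteMeasure μ] {f : X × E d → ℝ} (hf : Measurable f) {C r : ℝ} (hC : ∀ p, |f p| ≤ C)
    (h0 : ∀ p, r < ‖p.2‖ → f p = 0) : Integrable f (μ.prod volume) := by
  have hb : Integrable (fun p : X × E d => (1 : ℝ) *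
      (Metric.closedBall (0 : E d) r).indicator (fun _ => C) p.2) (μ.prod volume) := by
    refine (integrable_const (1 : ℝ)).mul_prod ?_
    rw [integrable_indicator_iff Metric.isClosed_closedBall.measurableSet]
    exact integrableOn_const (isCompact_closedBall _ _).measure_lt_top.ne
  refine hb.mono' hf.aestronglyMeasurable (ae_of_all _ fun p => ?_)
  rw [one_mul]
  by_cases hz : ‖p.2‖ ≤ r
  · rw [Set.indicator_of_mem (by simpa using hz)]; exact hC p
  · rw [h0 p (not_le.1 hz), Set.indicator_of_notMem (by simpa using hz), norm_zero]

variable {k : E d → E d → ℝ}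

/-- Average over the impact parameter, for a fixed orientation. -/
lemma integral_discLaw_kernel (hk : Measurable fun p : E d × E d => k p.1 p.2) {C : ℝ}
    (hC : ∀ x z, |k x z| ≤ C) (h0 : ∀ x z, 1 / 2 < ‖x‖ → k x z = 0) {e : E d} (he : ‖e‖ = 1)
    (M : SO d) :
    ∫ b, (∫ s : ℝ, ∫ t in (0 : ℝ)..2, k (line (rot M⁻¹ e) (rot M⁻¹ b) s) (t • rot M⁻¹ e))
      ∂(discLaw e) = (ballVol d)⁻¹ * ∫ t in (0 : ℝ)..2, ∫ x, k x (t • rot M⁻¹ e) := by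
  set u := rot M⁻¹ e with hu
  set μ := (volume : Measure ℝ).restrict (Set.Ioc 0 2) with hμ
  have hIoc : ∀ f : ℝ → ℝ, ∫ t in (0 : ℝ)..2, f t = ∫ t, f t ∂μ := fun f =>
    intervalIntegral.integral_of_le (by norm_num)
  have hmeas : Measurable fun p : ℝ × E d => k p.2 (p.1 • u) :=
    hk.comp (measurable_snd.prodMk (measurable_fst.smul_const u))
  have hint : Integrable (fun p : ℝ × E d => k p.2 (p.1 • u)) (μ.prod volume) :=
    integrable_of_bounded_support hmeas (fun p => hC _ _) (fun p hp => h0 _ _ hp)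
  set f : E d → ℝ := fun x => ∫ t in (0 : ℝ)..2, k x (t • u) with hf
  have hfm : Measurable f := by
    simp only [hf, hIoc]
    exact (StronglyMeasurable.integral_prod_right (f := fun (x : E d) (t : ℝ) => k x (t • u))
      (hmeas.comp measurable_swap).stronglyMeasurable).measurable
  have hfi : Integrable f := by
    simp only [hf, hIoc]
    exact hint.integral_prod_right
  have hf0 : ∀ x, 1 / 2 < ‖x‖ → f x = 0 := fun x hx => by simp [hf, h0 x _ hx]
  have hmp := measurePreserving_rot (M⁻¹ : SO d)
  have h1 := integral_discLaw_line he (f := fun x => f (rot M⁻¹ x)) (hfm.comp hmp.measurable)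
    (hmp.integrable_comp_of_integrable hfi) (fun x hx => hf0 _ (by rwa [norm_rot]))
  have h2 : ∀ b s, rot M⁻¹ (line e b s) = line u (rot M⁻¹ b) s := fun b s => rot_line _ _ _ _
  simp only [h2] at h1
  have h3 : ∫ x, f (rot M⁻¹ x) = ∫ x, f x :=
    hmp.integral_comp (rotL M⁻¹).toHomeomorph.measurableEmbedding f
  rw [h1, h3]
  congr 1
  simp only [hf, hIoc]
  exact (integral_integral_swap hint).symm

/-- Average over the impact parameter and the orientation. -/
theorem integral_haar_discLaw_kernel (hd : 1 ≤ d)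
    (hk : Measurable fun p : E d × E d => k p.1 p.2) {C : ℝ}
    (hC : ∀ x z, |k x z| ≤ C) (h0 : ∀ x z, 1 / 2 < ‖x‖ → k x z = 0)
    (h1 : ∀ x z, 1 < ‖z‖ → k x z = 0)
    (hK : 2 ≤ d ∨ ∀ z, ∫ x, k x (-z) = ∫ x, k x z) {e : E d} (he : ‖e‖ = 1) :
    ∫ M, (∫ b, (∫ s : ℝ, ∫ t in (0 : ℝ)..2,
      k (line (rot M⁻¹ e) (rot M⁻¹ b) s) (t • rot M⁻¹ e)) ∂(discLaw e)) ∂(haarSO d) =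
      (ballVol d)⁻¹ * (sphereArea d)⁻¹ * ∫ z, weight z * ∫ x, k x z := by
  simp only [integral_discLaw_kernel hk hC h0 he]
  rw [integral_const_mul, mul_assoc]
  congr 1
  have hsm : Measurable fun z => ∫ x, k x z :=
    (StronglyMeasurable.integral_prod_right (f := fun z x => k x z)
      (hk.comp measurable_swap).stronglyMeasurable).measurable
  have hC0 : 0 ≤ C := (abs_nonneg _).trans (hC 0 0)
  refine integral_haar_ray hd he (K := fun z => ∫ x, k x z)
    (C := C * (volume : Measure (E d)).real (Metric.closedBall 0 (1 / 2))) hsm (fun z => ?_)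
    (fun z hz => by simp [h1 _ z hz]) hK
  have : ∫ x, k x z = ∫ x in Metric.closedBall (0 : E d) (1 / 2), k x z :=
    (setIntegral_eq_integral_of_forall_compl_eq_zero fun x hx => h0 _ _ (by simpa using hx)).symm
  rw [this]
  exact norm_setIntegral_le_of_norm_le_const (f := fun x => k x z) (isCompact_closedBall _ _).measure_lt_top
    (fun x _ => hC x z)

end kernels

/-! ### Squares of integrals -/

/-- For J(s) = ∫_s^2 f the derivative of ‖J‖² is -2⟪f, J⟫. The square is therefore twice the
integral over ordered pairs s, s + t with t ≥ 0, the form that suits polar coordinates; t may run up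
to 2 because f vanishes beyond 2. -/
lemma sq_norm_integral_eq {H : Type*} [NormedAddCommGroup H] [InnerProductSpace ℝ H]
    [CompleteSpace H] {f : ℝ → H} (hf : Continuous f) (h0 : ∀ s, 2 < s → f s = 0) :
    ‖∫ s in (0 : ℝ)..2, f s‖ ^ 2 =
      2 * ∫ s in (0 : ℝ)..2, ∫ t in (0 : ℝ)..2, ⟪f s, f (s + t)⟫ := by
  have hJ : ∀ s, HasDerivAt (fun s => ∫ r in s..2, f r) (-f s) s := fun s =>
    intervalIntegral.integral_hasDerivAt_left (hf.intervalIntegrable _ _)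
      (hf.stronglyMeasurableAtFilter _ _) hf.continuousAt
  have hJc : Continuous fun s => ∫ r in s..2, f r :=
    continuous_iff_continuousAt.2 fun s => (hJ s).continuousAt
  have h1 := intervalIntegral.integral_eq_sub_of_hasDerivAt (a := (0 : ℝ)) (b := 2)
    (fun s _ => (hJ s).norm_sq)
    ((continuous_const.mul (hJc.inner hf.neg)).intervalIntegrable _ _)
  rw [intervalIntegral.integral_same, norm_zero] at h1
  have h2 : ∀ s ∈ Set.uIcc (0 : ℝ) 2, ∫ t in (0 : ℝ)..2, ⟪f s, f (s + t)⟫ =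
      ⟪f s, ∫ r in s..2, f r⟫ := by
    intro s hs
    rw [Set.uIcc_of_le (by norm_num)] at hs
    have h3 : ∫ r in s..(s + 2), f r = ∫ r in s..2, f r := by
      rw [← intervalIntegral.integral_add_adjacent_intervals (b := 2)
        (hf.intervalIntegrable _ _) (hf.intervalIntegrable _ _)]
      have : ∫ r in (2 : ℝ)..(s + 2), f r = ∫ r in (2 : ℝ)..(s + 2), (0 : H) := by
        refine intervalIntegral.integral_congr_ae (ae_of_all _ fun r hr => ?_)
        rw [Set.uIoc_of_le (by linarith [hs.1])] at hr
        exact h0 r hr.1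
      rw [this]; simp
    have h4 : ∫ t in (0 : ℝ)..2, f (s + t) = ∫ r in s..(s + 2), f r := by
      rw [intervalIntegral.integral_comp_add_left (fun r => f r) s, add_zero]
    rw [← h3, ← h4]
    exact (innerSL ℝ (f s)).intervalIntegral_comp_comm
      (f := fun t => f (s + t)) ((by fun_prop : Continuous fun t => f (s + t)).intervalIntegrable 0 2)
  rw [intervalIntegral.integral_congr h2]
  have h5 : ∀ s, (2 : ℝ) * ⟪∫ r in s..2, f r, -f s⟫ = (-2) * ⟪f s, ∫ r in s..2, f r⟫ := fun s => by
    rw [inner_neg_right, real_inner_comm]; ring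
  simp only [h5] at h1
  rw [intervalIntegral.integral_const_mul] at h1
  linarith

/-! ### The kernels of the mean and the mean square of the energy transfer -/

section forceKernels

variable {d m : ℕ} {g : E d → Torus m → E d} {φ : Torus m}

/-- The kernel of `D'²`. -/
noncomputable def kerD (g : E d → Torus m → E d) (φ : Torus m) (x z : E d) : ℝ :=
  ⟪z, g x φ⟫ * ⟪z, g (x + z) φ⟫ / ‖z‖ ^ 2

/-- The kernel of `‖α^(1)‖² / 2`. -/
noncomputable def kerN (g : E d → Torus m → E d) (φ : Torus m) (x z : E d) : ℝ :=
  ⟪g x φ, g (x + z) φ⟫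

/-- The kernel of `e · α^(3)`. -/
noncomputable def kerQ (g : E d → Torus m → E d) (φ : Torus m) (x z : E d) : ℝ :=
  ⟪z, Dspace g x φ (g (x - z) φ)⟫

/-- `kerQ` with the two points exchanged. -/
noncomputable def kerQ' (g : E d → Torus m → E d) (φ : Torus m) (x z : E d) : ℝ :=
  ⟪z, Dspace g (x + z) φ (g x φ)⟫

lemma Prof.continuous_left {X : Type*} [NormedAddCommGroup X] [NormedSpace ℝ X] {k : ℕ}
    {f : E d → Torus m → X} (hf : Prof k f) (φ : Torus m) : Continuous fun y => f y φ :=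
  hf.continuous.comp (by fun_prop : Continuous fun y : E d => (y, φ))

lemma half_lt_norm_add {x z : E d} (hz : 1 < ‖z‖) (hx : ‖x‖ ≤ 1 / 2) : 1 / 2 < ‖x + z‖ := by
  have := norm_sub_le (x + z) x
  rw [add_sub_cancel_left] at this
  linarith

lemma half_lt_norm_sub {x z : E d} (hz : 1 < ‖z‖) (hx : ‖x‖ ≤ 1 / 2) : 1 / 2 < ‖x - z‖ := by
  rw [sub_eq_add_neg]
  exact half_lt_norm_add (by rwa [norm_neg]) hx

/-- A bounded measurable kernel `k x z` that vanishes unless `‖x‖ ≤ 1/2` and `‖z‖ ≤ 1`. -/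
structure IsKernel (k : E d → E d → ℝ) : Prop where
  measurable : Measurable fun p : E d × E d => k p.1 p.2
  exists_bound : ∃ C, ∀ x z, |k x z| ≤ C
  left : ∀ x z, 1 / 2 < ‖x‖ → k x z = 0
  right : ∀ x z, 1 < ‖z‖ → k x z = 0

lemma IsKernel.add {k l : E d → E d → ℝ} (hk : IsKernel k) (hl : IsKernel l) :
    IsKernel fun x z => k x z + l x z where
  measurable := hk.measurable.add hl.measurable
  exists_bound := by
    obtain ⟨C, hC⟩ := hk.exists_bound
    obtain ⟨C', hC'⟩ := hl.exists_bound
    exact ⟨C + C', fun x z => (abs_add_le _ _).trans (add_le_add (hC x z) (hC' x z))⟩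
  left x z hx := by rw [hk.left x z hx, hl.left x z hx, add_zero]
  right x z hz := by rw [hk.right x z hz, hl.right x z hz, add_zero]

lemma IsKernel.integrable_left {k : E d → E d → ℝ} (hk : IsKernel k) (z : E d) :
    Integrable fun x => k x z := by
  obtain ⟨C, hC⟩ := hk.exists_bound
  have hm : Measurable fun x => k x z :=
    hk.measurable.comp (by fun_prop : Measurable fun x : E d => (x, z))
  have hb : Integrable ((Metric.closedBall (0 : E d) (1 / 2)).indicator fun _ => C) := by
    rw [integrable_indicator_iff Metric.isClosed_closedBall.measurableSet]
    exact integrableOn_const (isCompact_closedBall _ _).measure_lt_top.ne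
  refine hb.mono' hm.aestronglyMeasurable (ae_of_all _ fun x => ?_)
  by_cases hx : ‖x‖ ≤ 1 / 2
  · rw [Set.indicator_of_mem (by simpa using hx)]; exact hC x z
  · rw [hk.left x z (not_le.1 hx), Set.indicator_of_notMem (by simpa using hx), norm_zero]

lemma IsKernel.integrable_weight {k : E d → E d → ℝ} (hd : 1 ≤ d) (hk : IsKernel k) :
    Integrable (fun p : E d × E d => weight p.2 * k p.1 p.2)
      ((volume : Measure (E d)).prod volume) := by
  obtain ⟨C, hC⟩ := hk.exists_bound
  exact integrable_weight_mul_prod hd hk.measurable hC hk.left hk.right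

lemma IsKernel.integral_integral_swap {k : E d → E d → ℝ} (hd : 1 ≤ d) (hk : IsKernel k) :
    ∫ z, weight z * ∫ x, k x z = ∫ x, ∫ z, weight z * k x z := by
  simp only [← integral_const_mul]
  exact (MeasureTheory.integral_integral_swap
    (f := fun x z => weight z * k x z) (hk.integrable_weight hd)).symm

lemma IsKernel.average (hd : 1 ≤ d) {k : E d → E d → ℝ} (hk : IsKernel k)
    (hK : 2 ≤ d ∨ ∀ z, ∫ x, k x (-z) = ∫ x, k x z) {e : E d} (he : ‖e‖ = 1) :
    ∫ M, (∫ b, (∫ s : ℝ, ∫ t in (0 : ℝ)..2,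
      k (line (rot M⁻¹ e) (rot M⁻¹ b) s) (t • rot M⁻¹ e)) ∂(discLaw e)) ∂(haarSO d) =
      (ballVol d)⁻¹ * (sphereArea d)⁻¹ * ∫ z, weight z * ∫ x, k x z := by
  obtain ⟨C, hC⟩ := hk.exists_bound
  exact integral_haar_discLaw_kernel hd hk.measurable hC hk.left hk.right hK he

lemma isKernel_kerD (hg : Prof 3 g) (φ : Torus m) : IsKernel (kerD g φ) where
  measurable := by
    have h := (hg.continuous_left φ).measurable
    unfold kerD
    exact ((measurable_snd.inner (h.comp measurable_fst)).mul (measurable_snd.inner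
      (h.comp (measurable_fst.add measurable_snd)))).div (measurable_snd.norm.pow_const 2)
  exists_bound := by
    obtain ⟨K, hK0, hK⟩ := hg.exists_bound
    refine ⟨K * K, fun x z => ?_⟩
    have h1 := (abs_real_inner_le_norm z (g x φ)).trans
      (mul_le_mul_of_nonneg_left (hK x φ) (norm_nonneg z))
    have h2 := (abs_real_inner_le_norm z (g (x + z) φ)).trans
      (mul_le_mul_of_nonneg_left (hK (x + z) φ) (norm_nonneg z))
    rw [kerD, abs_div, abs_mul, abs_of_nonneg (by positivity : 0 ≤ ‖z‖ ^ 2)]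
    refine div_le_of_le_mul₀ (by positivity) (by positivity) ?_
    calc _ ≤ (‖z‖ * K) * (‖z‖ * K) := mul_le_mul h1 h2 (abs_nonneg _) (by positivity)
      _ = _ := by ring
  left x z hx := by simp [kerD, hg.support x φ hx]
  right x z hz := by
    by_cases hx : ‖x‖ ≤ 1 / 2
    · simp [kerD, hg.support _ φ (half_lt_norm_add hz hx)]
    · simp [kerD, hg.support x φ (not_le.1 hx)]

lemma isKernel_kerN (hg : Prof 3 g) (φ : Torus m) : IsKernel (kerN g φ) where
  measurable := by
    have h := hg.continuous_left φ
    unfold kerN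
    exact (by fun_prop : Continuous fun p : E d × E d => ⟪g p.1 φ, g (p.1 + p.2) φ⟫).measurable
  exists_bound := by
    obtain ⟨K, hK0, hK⟩ := hg.exists_bound
    exact ⟨K * K, fun x z => (abs_real_inner_le_norm _ _).trans
      (mul_le_mul (hK _ _) (hK _ _) (norm_nonneg _) hK0)⟩
  left x z hx := by simp [kerN, hg.support x φ hx]
  right x z hz := by
    by_cases hx : ‖x‖ ≤ 1 / 2
    · simp [kerN, hg.support _ φ (half_lt_norm_add hz hx)]
    · simp [kerN, hg.support x φ (not_le.1 hx)]

lemma isKernel_kerQ (hg : Prof 3 g) (φ : Torus m) : IsKernel (kerQ g φ) := by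
  have hD : Prof 2 (Dspace g) := Prof.dspace (k := 2) hg
  have hright : ∀ x z, 1 < ‖z‖ → kerQ g φ x z = 0 := fun x z hz => by
    by_cases hx : ‖x‖ ≤ 1 / 2
    · simp [kerQ, hg.support _ φ (half_lt_norm_sub hz hx)]
    · simp [kerQ, hD.support x φ (not_le.1 hx)]
  refine ⟨?_, ?_, fun x z hx => by simp [kerQ, hD.support x φ hx], hright⟩
  · have h := hg.continuous_left φ
    have h' := hD.continuous_left φ
    unfold kerQ
    exact (by fun_prop : Continuous fun p : E d × E d =>
      ⟪p.2, Dspace g p.1 φ (g (p.1 - p.2) φ)⟫).measurable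
  · obtain ⟨K, hK0, hK⟩ := hg.exists_bound
    obtain ⟨L, hL0, hL⟩ := hD.exists_bound
    refine ⟨L * K, fun x z => ?_⟩
    by_cases hz : ‖z‖ ≤ 1
    · refine (abs_real_inner_le_norm _ _).trans ((mul_le_of_le_one_left (norm_nonneg _) hz).trans ?_)
      exact (ContinuousLinearMap.le_opNorm _ _).trans
        (mul_le_mul (hL _ _) (hK _ _) (norm_nonneg _) hL0)
    · rw [hright x z (not_le.1 hz), abs_zero]; positivity

lemma isKernel_kerQ' (hg : Prof 3 g) (φ : Torus m) : IsKernel (kerQ' g φ) := by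
  have hD : Prof 2 (Dspace g) := Prof.dspace (k := 2) hg
  have hright : ∀ x z, 1 < ‖z‖ → kerQ' g φ x z = 0 := fun x z hz => by
    by_cases hx : ‖x‖ ≤ 1 / 2
    · simp [kerQ', hD.support _ φ (half_lt_norm_add hz hx)]
    · simp [kerQ', hg.support x φ (not_le.1 hx)]
  refine ⟨?_, ?_, fun x z hx => by simp [kerQ', hg.support x φ hx], hright⟩
  · have h := hg.continuous_left φ
    have h' := hD.continuous_left φ
    unfold kerQ'
    exact (by fun_prop : Continuous fun p : E d × E d =>
      ⟪p.2, Dspace g (p.1 + p.2) φ (g p.1 φ)⟫).measurable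
  · obtain ⟨K, hK0, hK⟩ := hg.exists_bound
    obtain ⟨L, hL0, hL⟩ := hD.exists_bound
    refine ⟨L * K, fun x z => ?_⟩
    by_cases hz : ‖z‖ ≤ 1
    · refine (abs_real_inner_le_norm _ _).trans ((mul_le_of_le_one_left (norm_nonneg _) hz).trans ?_)
      exact (ContinuousLinearMap.le_opNorm _ _).trans
        (mul_le_mul (hL _ _) (hK _ _) (norm_nonneg _) hL0)
    · rw [hright x z (not_le.1 hz), abs_zero]; positivity

/-- Translation by z exchanges the two points, in which `kerD` is symmetric. This is the evenness
required in dimension one. -/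
lemma integral_kerD_neg (z : E d) : ∫ x, kerD g φ x (-z) = ∫ x, kerD g φ x z := by
  rw [← integral_add_right_eq_self (fun x => kerD g φ x (-z)) z]
  refine integral_congr_ae (ae_of_all _ fun x => ?_)
  simp only [kerD, add_neg_cancel_right, inner_neg_left, norm_neg]
  ring

/-- Translation by z moves the derivative to the point x + z, where it can be read as a derivative
with respect to z, ready for the divergence identity. -/
lemma integral_kerN_add_kerQ (hg : Prof 3 g) (z : E d) :
    ∫ x, (kerN g φ x z + kerQ g φ x z) = ∫ x, (kerN g φ x z + kerQ' g φ x z) := by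
  rw [integral_add ((isKernel_kerN hg φ).integrable_left z)
      ((isKernel_kerQ hg φ).integrable_left z),
    integral_add ((isKernel_kerN hg φ).integrable_left z)
      ((isKernel_kerQ' hg φ).integrable_left z)]
  congr 1
  rw [← integral_add_right_eq_self (fun x => kerQ g φ x z) z]
  simp only [kerQ, kerQ', add_sub_cancel_right]

/-- The identity behind `B' = (d - 1) / 2 · D'²`. -/
theorem integral_weight_kernel_identity (hd : 1 ≤ d) (hg : Prof 3 g) :
    ∫ z, weight z * ∫ x, (kerN g φ x z + kerQ g φ x z) =
      ((d - 1 : ℕ) : ℝ) * ∫ z, weight z * ∫ x, kerD g φ x z := by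
  have hD : Prof 2 (Dspace g) := Prof.dspace (k := 2) hg
  have k1 : IsKernel fun x z => kerN g φ x z + kerQ' g φ x z :=
    (isKernel_kerN hg φ).add (isKernel_kerQ' hg φ)
  have k2 := isKernel_kerD hg φ
  simp only [integral_kerN_add_kerQ hg]
  rw [k1.integral_integral_swap hd, k2.integral_integral_swap hd, ← integral_const_mul,
    ← sub_eq_zero, ← integral_sub (k1.integrable_weight hd).integral_prod_left
      ((k2.integrable_weight hd).integral_prod_left.const_mul _)]
  have : ∀ᵐ x : E d, (∫ z, weight z * (kerN g φ x z + kerQ' g φ x z)) -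
      ((d - 1 : ℕ) : ℝ) * ∫ z, weight z * kerD g φ x z = 0 := by
    filter_upwards [(k1.integrable_weight hd).prod_right_ae, (k2.integrable_weight hd).prod_right_ae]
      with x i1 i2
    rw [← integral_const_mul, ← integral_sub i1 (i2.const_mul _)]
    have hx : ∀ z, ‖x‖ + 1 / 2 < ‖z‖ → 1 / 2 < ‖x + z‖ := fun z hz => by
      have := norm_sub_le (x + z) x
      rw [add_sub_cancel_left] at this
      linarith
    -- For fixed x, differentiate ‖z‖^{1-d} ⟪z, g(x+z)⟫ in the direction g(x). The factor z yields
    -- `kerN`, the factor g(x+z) yields `kerQ'`, and the weight yields -(d-1) `kerD`.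
    have key := integral_weight_divergence (p := fun z => g (x + z) φ)
      (p' := fun z => Dspace g (x + z) φ) (w := g x φ) (r := ‖x‖ + 1 / 2) hd
      (fun z => (hasFDerivAt_comp_add_left x).2 (Prof.hasFDerivAt (k := 2) hg (x + z) φ))
      ((hD.continuous_left φ).comp (continuous_const.add continuous_id))
      (fun z hz => hg.support _ _ (hx z hz)) (fun z hz => hD.support _ _ (hx z hz))
    rw [← key]
    refine integral_congr_ae (ae_of_all _ fun z => ?_)
    simp only [kerN, kerQ', kerD]
    ring
  rw [integral_congr_ae this]
  simp

/-- With y' = y + z the exponent 1 + d splits into d - 1 for `weight` and 2 for the normalisation of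
`kerD`; both inner products change sign. -/
lemma integral_integral_kerD_eq (hd : 1 ≤ d) (hg : Prof 3 g) (φ : Torus m) :
    ∫ y : E d, ∫ y' : E d, ⟪y - y', g y φ⟫ * ⟪y - y', g y' φ⟫ / ‖y - y'‖ ^ (1 + d) =
      ∫ z, weight z * ∫ x, kerD g φ x z := by
  rw [(isKernel_kerD hg φ).integral_integral_swap hd]
  refine integral_congr_ae (ae_of_all _ fun y => ?_)
  simp only
  rw [← integral_add_left_eq_self (fun y' => ⟪y - y', g y φ⟫ * ⟪y - y', g y' φ⟫ /
    ‖y - y'‖ ^ (1 + d)) y]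
  refine integral_congr_ae (ae_of_all _ fun z => ?_)
  obtain ⟨n, rfl⟩ : ∃ n, d = n + 1 := ⟨d - 1, by omega⟩
  simp only [sub_add_cancel_left, inner_neg_left, norm_neg, weight, kerD, Nat.add_sub_cancel]
  rw [show 1 + (n + 1) = n + 2 by ring, pow_add]
  ring

/-! ### The coefficients in terms of the kernels -/

lemma line_add (u b : E d) (s t : ℝ) : line u b s + t • u = line u b (s + t) := by
  simp only [line]; module

lemma line_sub (u b : E d) (s t : ℝ) : line u b s - t • u = line u b (s - t) := by
  simp only [line]; module

lemma integral_line_eq_real {u b : E d} (hu : ‖u‖ = 1) (hbu : ⟪b, u⟫ = 0) {f : E d → ℝ}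
    (hf : ∀ y, 1 / 2 < ‖y‖ → f y = 0) :
    ∫ s, f (line u b s) = ∫ s in (0 : ℝ)..2, f (line u b s) := by
  simpa using integral_line_eq hu hbu hf (fun _ => 1)

lemma g_line_eq_zero (hg : Prof 3 g) {u b : E d} (hu : ‖u‖ = 1) (hbu : ⟪b, u⟫ = 0) {s : ℝ}
    (hs : s ∉ Set.Icc (0 : ℝ) 1) : g (line u b s) φ = 0 :=
  hg.support _ _ (lt_norm_line hu hbu hs)

lemma continuous_g_line (hg : Prof 3 g) (u b : E d) (φ : Torus m) :
    Continuous fun s => g (line u b s) φ :=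
  hg.continuous_comp_line continuous_const continuous_const continuous_const continuous_id

lemma inner_aOne_sq_eq (hg : Prof 3 g) {u b : E d} (hu : ‖u‖ = 1) (hbu : ⟪b, u⟫ = 0) :
    ⟪u, aOne g u b φ⟫ ^ 2 =
      2 * ∫ s : ℝ, ∫ t in (0 : ℝ)..2, kerD g φ (line u b s) (t • u) := by
  have hc := continuous_g_line hg u b φ
  have h1 : ⟪u, aOne g u b φ⟫ = ∫ s in (0 : ℝ)..2, ⟪u, g (line u b s) φ⟫ :=
    ((innerSL ℝ u).intervalIntegral_comp_comm (hc.intervalIntegrable 0 2)).symm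
  rw [integral_line_eq_real hu hbu (f := fun y => ∫ t in (0 : ℝ)..2, kerD g φ y (t • u))
    (fun y hy => by simp [(isKernel_kerD hg φ).left y _ hy]), h1, ← sq_abs, ← Real.norm_eq_abs,
    sq_norm_integral_eq (f := fun s => ⟪u, g (line u b s) φ⟫) (continuous_const.inner hc)
      (fun s hs => by rw [g_line_eq_zero hg hu hbu (fun h => by linarith [h.2]), inner_zero_right])]
  congr 1
  refine intervalIntegral.integral_congr fun s _ => ?_
  -- The normalisation by ‖z‖² makes `kerD` independent of t along z = t u; t = 0, where the
  -- quotient degenerates, is excluded from (0, 2].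
  refine intervalIntegral.integral_congr_ae (ae_of_all _ fun t ht => ?_)
  rw [Set.uIoc_of_le (by norm_num)] at ht
  have ht0 : t ≠ 0 := ht.1.ne'
  simp only [kerD, line_add, real_inner_smul_left, norm_smul, hu, RCLike.inner_apply, conj_trivial,
    mul_one, Real.norm_eq_abs, sq_abs]
  field_simp

lemma half_norm_aOne_sq_eq (hg : Prof 3 g) {u b : E d} (hu : ‖u‖ = 1) (hbu : ⟪b, u⟫ = 0) :
    1 / 2 * ‖aOne g u b φ‖ ^ 2 =
      ∫ s in (0 : ℝ)..2, ∫ t in (0 : ℝ)..2, kerN g φ (line u b s) (t • u) := by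
  rw [aOne, sq_norm_integral_eq (continuous_g_line hg u b φ)
      (fun s hs => g_line_eq_zero hg hu hbu (fun h => by linarith [h.2])), ← mul_assoc]
  norm_num
  refine intervalIntegral.integral_congr fun s _ => ?_
  refine intervalIntegral.integral_congr fun t _ => ?_
  simp only [kerN, line_add]

/-- `deflection` is ∫ (s - r) g dr; the time lag t = s - r becomes the variable, and lags up to 2
are allowed since there is no force before s = 0. The factor t is later absorbed into the
displacement z = t u of `kerQ`. -/
lemma deflection_eq (hg : Prof 3 g) {u b : E d} (hu : ‖u‖ = 1) (hbu : ⟪b, u⟫ = 0) {s : ℝ}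
    (hs : s ∈ Set.Icc (0 : ℝ) 2) :
    deflection g u b φ s = ∫ t in (0 : ℝ)..2, t • g (line u b (s - t)) φ := by
  have hc := continuous_g_line hg u b φ
  have hc2 : Continuous fun r => (s - r) • g (line u b r) φ :=
    (continuous_const.sub continuous_id).smul hc
  have h1 : deflection g u b φ s = ∫ r in (0 : ℝ)..s, (s - r) • g (line u b r) φ := by
    have c1 : Continuous fun r => s • g (line u b r) φ := hc.const_smul s
    have c2 : Continuous fun r => r • g (line u b r) φ := continuous_id.smul hc
    simp only [sub_smul]
    rw [intervalIntegral.integral_sub (c1.intervalIntegrable _ _) (c2.intervalIntegrable _ _),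
      intervalIntegral.integral_smul]
    rfl
  have h2 := intervalIntegral.integral_comp_sub_left (a := (0 : ℝ)) (b := 2)
    (fun r => (s - r) • g (line u b r) φ) s
  simp only [sub_sub_cancel, sub_zero] at h2
  have h3 : ∫ r in (s - 2)..0, (s - r) • g (line u b r) φ = 0 := by
    have : ∀ r ∈ Set.Ioo (s - 2) 0, (s - r) • g (line u b r) φ = 0 := fun r hr => by
      rw [g_line_eq_zero hg hu hbu (fun h => by linarith [h.1, hr.2]), smul_zero]
    rw [intervalIntegral.integral_of_le (by linarith [hs.2]), integral_Ioc_eq_integral_Ioo,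
      setIntegral_congr_fun measurableSet_Ioo this]
    simp
  have h4 := intervalIntegral.integral_add_adjacent_intervals
    (hc2.intervalIntegrable (μ := volume) (s - 2) 0) (hc2.intervalIntegrable (μ := volume) 0 s)
  rw [h1, h2, ← h4, h3, zero_add]

lemma inner_aThreeQuad_eq (hg : Prof 3 g) {u b : E d} (hu : ‖u‖ = 1) (hbu : ⟪b, u⟫ = 0) :
    ⟪u, aThreeQuad g u b φ⟫ =
      ∫ s in (0 : ℝ)..2, ∫ t in (0 : ℝ)..2, kerQ g φ (line u b s) (t • u) := by
  have hc := continuous_g_line hg u b φ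
  have hcD : Continuous fun s => Dspace g (line u b s) φ (deflection g u b φ s) :=
    ((Prof.dspace (k := 2) hg).continuous_comp_line
      continuous_const continuous_const continuous_const continuous_id).clm_apply
      (continuous_iff_continuousAt.2 fun s => (hasDerivAt_deflection hg u b φ s).continuousAt)
  have h1 : ⟪u, aThreeQuad g u b φ⟫ =
      ∫ s in (0 : ℝ)..2, ⟪u, Dspace g (line u b s) φ (deflection g u b φ s)⟫ :=
    ((innerSL ℝ u).intervalIntegral_comp_comm (hcD.intervalIntegrable 0 2)).symm
  rw [h1]
  refine intervalIntegral.integral_congr fun s hs => ?_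
  rw [Set.uIcc_of_le (by norm_num)] at hs
  have hc2 : Continuous fun t => t • g (line u b (s - t)) φ :=
    continuous_id.smul (hc.comp (by fun_prop : Continuous fun t : ℝ => s - t))
  rw [deflection_eq hg hu hbu hs]
  have h2 := ((innerSL ℝ u).comp (Dspace g (line u b s) φ)).intervalIntegral_comp_comm
    (hc2.intervalIntegrable (μ := volume) 0 2)
  refine Eq.trans h2.symm (intervalIntegral.integral_congr fun t _ => ?_)
  simp [kerQ, line_sub, real_inner_smul_left]

lemma continuous_integral_line_kernel {k : E d → E d → ℝ}
    (hk : Continuous fun p : E d × E d => k p.1 p.2) (u b : E d) :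
    Continuous (fun s : ℝ => ∫ t in (0 : ℝ)..2, k (line u b s) (t • u)) ∧
    ∀ s, Continuous fun t : ℝ => k (line u b s) (t • u) := by
  have hl : Continuous (line u b) := by unfold line; fun_prop
  refine ⟨intervalIntegral.continuous_parametric_intervalIntegral_of_continuous'
    (f := fun s t => k (line u b s) (t • u)) ?_ _ _, fun s => ?_⟩
  · exact hk.comp (by fun_prop : Continuous fun p : ℝ × ℝ => (line u b p.1, p.2 • u))
  · exact hk.comp (by fun_prop : Continuous fun t : ℝ => (line u b s, t • u))

lemma half_norm_sq_add_inner_eq (hg : Prof 3 g) {u b : E d} (hu : ‖u‖ = 1) (hbu : ⟪b, u⟫ = 0) :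
    1 / 2 * ‖aOne g u b φ‖ ^ 2 + ⟪u, aThreeQuad g u b φ⟫ =
      ∫ s : ℝ, ∫ t in (0 : ℝ)..2,
        (kerN g φ (line u b s) (t • u) + kerQ g φ (line u b s) (t • u)) := by
  have h := hg.continuous_left φ
  have h' := (Prof.dspace (k := 2) hg).continuous_left φ
  have cN : Continuous fun p : E d × E d => kerN g φ p.1 p.2 := by unfold kerN; fun_prop
  have cQ : Continuous fun p : E d × E d => kerQ g φ p.1 p.2 := by unfold kerQ; fun_prop
  obtain ⟨n1, n2⟩ := continuous_integral_line_kernel cN u b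
  obtain ⟨q1, q2⟩ := continuous_integral_line_kernel cQ u b
  rw [integral_line_eq_real hu hbu
    (f := fun y => ∫ t in (0 : ℝ)..2, (kerN g φ y (t • u) + kerQ g φ y (t • u)))
    (fun y hy => by simp [(isKernel_kerN hg φ).left y _ hy, (isKernel_kerQ hg φ).left y _ hy]),
    half_norm_aOne_sq_eq hg hu hbu, inner_aThreeQuad_eq hg hu hbu,
    ← intervalIntegral.integral_add (n1.intervalIntegrable _ _) (q1.intervalIntegrable _ _)]
  refine intervalIntegral.integral_congr fun s _ => ?_
  exact (intervalIntegral.integral_add ((n2 s).intervalIntegrable _ _)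
    ((q2 s).intervalIntegrable _ _)).symm

/-! ### The averages of the coefficients for a fixed phase -/

lemma unit_admissible {e : E d} (he : ‖e‖ = 1) (M : SO d) :
    ‖rot M⁻¹ e‖ = 1 ∧ ∀ᵐ b ∂(discLaw e), ⟪rot M⁻¹ b, rot M⁻¹ e⟫ = 0 := by
  refine ⟨by rw [norm_rot, he], ?_⟩
  filter_upwards [ae_discLaw e] with b hb
  rw [inner_rot_rot, hb.1]

theorem average_inner_aOne_sq (hd : 1 ≤ d) (hg : Prof 3 g) {e : E d} (he : ‖e‖ = 1) :
    ∫ M, (∫ b, ⟪rot M⁻¹ e, aOne g (rot M⁻¹ e) (rot M⁻¹ b) φ⟫ ^ 2 ∂(discLaw e)) ∂(haarSO d) =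
      2 * ((ballVol d)⁻¹ * (sphereArea d)⁻¹ * ∫ z, weight z * ∫ x, kerD g φ x z) := by
  rw [← (isKernel_kerD hg φ).average hd (Or.inr integral_kerD_neg) he, ← integral_const_mul]
  refine integral_congr_ae (ae_of_all _ fun M => ?_)
  obtain ⟨hu, hb⟩ := unit_admissible he M
  simp only
  rw [← integral_const_mul]
  refine integral_congr_ae ?_
  filter_upwards [hb] with b hb
  exact inner_aOne_sq_eq hg hu hb

/-- The divergence identity on a single ray: the integrand is the t-derivative of a t ⟪u, g(x + t
u)⟫, which vanishes at t = 0 by its factor and at t = 2 because x + 2u has left the support. -/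
lemma integral_kernel_ray_eq_zero (hg : Prof 3 g) {u x : E d} (hu : ‖u‖ = 1) {a : ℝ}
    (ha : g x φ = a • u) :
    ∫ t in (0 : ℝ)..2, (kerN g φ x (t • u) + kerQ' g φ x (t • u)) = 0 := by
  by_cases hx : ‖x‖ ≤ 1 / 2
  swap
  · have h := ((isKernel_kerN hg φ).add (isKernel_kerQ' hg φ)).left x
    simp only [h _ (not_le.1 hx), intervalIntegral.integral_zero]
  have hder : ∀ t : ℝ, HasDerivAt (fun t : ℝ => a * (t * ⟪u, g (x + t • u) φ⟫))
      (kerN g φ x (t • u) + kerQ' g φ x (t • u)) t := by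
    intro t
    have h1 : HasDerivAt (fun t : ℝ => x + t • u) u t := by
      simpa using ((hasDerivAt_id t).smul_const u).const_add x
    have h2 := (Prof.hasFDerivAt (k := 2) hg (x + t • u) φ).comp_hasDerivAt t h1
    have h3 : HasDerivAt (fun t : ℝ => ⟪u, g (x + t • u) φ⟫)
        ⟪u, Dspace g (x + t • u) φ u⟫ t := by
      simpa using (hasDerivAt_const t u).inner ℝ h2
    have h4 := ((hasDerivAt_id t).mul h3).const_mul a
    refine h4.congr_deriv ?_
    simp only [kerN, kerQ', ha, map_smul, real_inner_smul_left, real_inner_smul_right, id]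
    ring
  have hcont : Continuous fun t : ℝ => kerN g φ x (t • u) + kerQ' g φ x (t • u) := by
    have h := hg.continuous_left φ
    have h' := (Prof.dspace (k := 2) hg).continuous_left φ
    unfold kerN kerQ'
    fun_prop
  rw [intervalIntegral.integral_eq_sub_of_hasDerivAt (fun t _ => hder t)
    (hcont.intervalIntegrable _ _)]
  have h2 : g (x + (2 : ℝ) • u) φ = 0 := hg.support _ _
    (half_lt_norm_add (by rw [norm_smul, hu]; norm_num) hx)
  rw [h2, inner_zero_right]
  ring

lemma exists_eq_smul_of_dim_one (hd : d = 1) {u : E d} (hu : ‖u‖ = 1) (x : E d) :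
    ∃ a : ℝ, x = a • u := by
  rcases eq_or_eq_neg_of_norm_eq hd (x := x) (y := ‖x‖ • u)
    (by rw [norm_smul, norm_norm, hu, mul_one]) with h | h
  · exact ⟨_, h⟩
  · exact ⟨-‖x‖, by rw [neg_smul]; exact h⟩

lemma IsKernel.integral_ray_swap {k : E d → E d → ℝ} (hk : IsKernel k) (u : E d) :
    ∫ t in (0 : ℝ)..2, ∫ x, k x (t • u) = ∫ x, ∫ t in (0 : ℝ)..2, k x (t • u) := by
  obtain ⟨C, hC⟩ := hk.exists_bound
  have hm : Measurable fun p : ℝ × E d => k p.2 (p.1 • u) :=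
    hk.measurable.comp (measurable_snd.prodMk (measurable_fst.smul_const u))
  have hint : Integrable (fun p : ℝ × E d => k p.2 (p.1 • u))
      (((volume : Measure ℝ).restrict (Set.Ioc 0 2)).prod volume) :=
    integrable_of_bounded_support hm (fun p => hC _ _) (fun p hp => hk.left _ _ hp)
  simp only [intervalIntegral.integral_of_le (zero_le_two : (0 : ℝ) ≤ 2)]
  exact MeasureTheory.integral_integral_swap (f := fun (t : ℝ) x => k x (t • u)) hint

/-- In dimension one, the mean of the energy transfer vanishes to second order. -/
lemma integral_kernel_eq_zero_of_dim_one (hd : d = 1) (hg : Prof 3 g) {u : E d} (hu : ‖u‖ = 1) :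
    ∫ t in (0 : ℝ)..2, ∫ x, (kerN g φ x (t • u) + kerQ g φ x (t • u)) = 0 := by
  simp only [integral_kerN_add_kerQ hg]
  rw [((isKernel_kerN hg φ).add (isKernel_kerQ' hg φ)).integral_ray_swap u]
  refine integral_eq_zero_of_ae (ae_of_all _ fun x => ?_)
  obtain ⟨a, ha⟩ := exists_eq_smul_of_dim_one hd hu (g x φ)
  exact integral_kernel_ray_eq_zero hg hu ha

/-- For d ≥ 2 this is the kernel average followed by the divergence identity. For d = 1 the Haar
average does not produce polar coordinates; the average over the impact parameter alone already
vanishes, as does the factor d - 1. -/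
theorem average_quadratic (hd : 1 ≤ d) (hg : Prof 3 g) {e : E d} (he : ‖e‖ = 1) :
    ∫ M, (∫ b, (1 / 2 * ‖aOne g (rot M⁻¹ e) (rot M⁻¹ b) φ‖ ^ 2 +
      ⟪rot M⁻¹ e, aThreeQuad g (rot M⁻¹ e) (rot M⁻¹ b) φ⟫) ∂(discLaw e)) ∂(haarSO d) =
      ((d - 1 : ℕ) : ℝ) *
        ((ballVol d)⁻¹ * (sphereArea d)⁻¹ * ∫ z, weight z * ∫ x, kerD g φ x z) := by
  have hk : IsKernel fun x z => kerN g φ x z + kerQ g φ x z :=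
    (isKernel_kerN hg φ).add (isKernel_kerQ hg φ)
  have h1 : ∫ M, (∫ b, (1 / 2 * ‖aOne g (rot M⁻¹ e) (rot M⁻¹ b) φ‖ ^ 2 +
      ⟪rot M⁻¹ e, aThreeQuad g (rot M⁻¹ e) (rot M⁻¹ b) φ⟫) ∂(discLaw e)) ∂(haarSO d) =
      ∫ M, (∫ b, (∫ s : ℝ, ∫ t in (0 : ℝ)..2,
        (kerN g φ (line (rot M⁻¹ e) (rot M⁻¹ b) s) (t • rot M⁻¹ e) +
        kerQ g φ (line (rot M⁻¹ e) (rot M⁻¹ b) s) (t • rot M⁻¹ e))) ∂(discLaw e)) ∂(haarSO d) := by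
    refine integral_congr_ae (ae_of_all _ fun M => ?_)
    obtain ⟨hu, hb⟩ := unit_admissible he M
    refine integral_congr_ae ?_
    filter_upwards [hb] with b hb
    exact half_norm_sq_add_inner_eq hg hu hb
  rw [h1]
  by_cases hd2 : 2 ≤ d
  · rw [hk.average hd (Or.inl hd2) he, integral_weight_kernel_identity hd hg]
    ring
  · have hd1 : d = 1 := by omega
    obtain ⟨C, hC⟩ := hk.exists_bound
    have h2 : ∀ M : SO d, ∫ b, (∫ s : ℝ, ∫ t in (0 : ℝ)..2,
        (kerN g φ (line (rot M⁻¹ e) (rot M⁻¹ b) s) (t • rot M⁻¹ e) +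
        kerQ g φ (line (rot M⁻¹ e) (rot M⁻¹ b) s) (t • rot M⁻¹ e))) ∂(discLaw e) = 0 := fun M => by
      rw [integral_discLaw_kernel hk.measurable hC hk.left he M,
        integral_kernel_eq_zero_of_dim_one hd1 hg (by rw [norm_rot, he]), mul_zero]
    simp only [h2]
    simp [hd1]

end forceKernels

/-! ### Averages over the scattering parameters -/

section averages

variable {d m : ℕ} {ν : Measure ℝ}

instance [IsProbabilityMeasure ν] (v : E d) : IsProbabilityMeasure (kappaLaw m ν v) := by
  unfold kappaLaw; infer_instance

lemma discLaw_smul {r : ℝ} (hr : r ≠ 0) (v : E d) : discLaw (r • v) = discLaw v := by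
  have h : (ℝ ∙ (r • v)) = (ℝ ∙ v) := Submodule.span_singleton_smul_eq (IsUnit.mk0 r hr) v
  exact congrArg (fun K : Submodule ℝ (E d) => (ProbabilityTheory.cond (volume : Measure Kᗮ)
    (Metric.closedBall 0 (1 / 2))).map Subtype.val) h

lemma kappaLaw_dir {v : E d} (hv : v ≠ 0) : kappaLaw m ν (dir v) = kappaLaw m ν v := by
  rw [kappaLaw, dir, discLaw_smul (inv_ne_zero (norm_ne_zero_iff.2 hv)), kappaLaw]

lemma ae_admissible (hν : ∀ᵐ c ∂ν, c ∈ Set.Icc (-1 : ℝ) 1) (v : E d) :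
    ∀ᵐ κ ∂(kappaLaw m ν v), Admissible v κ := by
  have h1 : ∀ᵐ κ ∂(kappaLaw m ν v), ⟪κ.1, v⟫ = 0 ∧ ‖κ.1‖ ≤ 1 / 2 :=
    Measure.quasiMeasurePreserving_fst.ae (ae_discLaw v)
  have h2 : ∀ᵐ κ ∂(kappaLaw m ν v), κ.2.2.2 ∈ Set.Icc (-1 : ℝ) 1 :=
    Measure.quasiMeasurePreserving_snd.ae (Measure.quasiMeasurePreserving_snd.ae
      (Measure.quasiMeasurePreserving_snd.ae hν))
  filter_upwards [h1, h2] with κ h1 h2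
  exact ⟨h1.1, h1.2, h2⟩

variable [IsProbabilityMeasure ν]

lemma memLp_kappaLaw {X : Type*} [NormedAddCommGroup X]
    (hν : ∀ᵐ c ∂ν, c ∈ Set.Icc (-1 : ℝ) 1) {v : E d} {f : Kappa d m → X}
    (hf : AEStronglyMeasurable f (kappaLaw m ν v)) {C : ℝ}
    (hC : ∀ κ, Admissible v κ → ‖f κ‖ ≤ C) (p : ENNReal) : MemLp f p (kappaLaw m ν v) :=
  MemLp.of_bound hf C ((ae_admissible hν v).mono hC)

/-- The factors are put in the order in which the averages are computed: the coupling splits off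
first, then φ is held fixed while `M` and b are averaged. -/
lemma measurePreserving_kappa_rev (v : E d) :
    MeasurePreserving (fun κ : Kappa d m => (κ.2.2.2, (κ.2.2.1, (κ.2.1, κ.1)))) (kappaLaw m ν v)
      (ν.prod ((volume : Measure (Torus m)).prod ((haarSO d).prod (discLaw v)))) := by
  have h1 : MeasurePreserving Prod.swap (kappaLaw m ν v) _ := Measure.measurePreserving_swap
  have h2 := (Measure.measurePreserving_swap (μ := haarSO d)
    (ν := (volume : Measure (Torus m)).prod ν)).prod (MeasurePreserving.id (discLaw v))
  have h3 := ((Measure.measurePreserving_swap (μ := (volume : Measure (Torus m)))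
    (ν := ν)).prod (MeasurePreserving.id (haarSO d))).prod (MeasurePreserving.id (discLaw v))
  have h4 := measurePreserving_prodAssoc (ν.prod (volume : Measure (Torus m))) (haarSO d)
    (discLaw v)
  have h5 := measurePreserving_prodAssoc ν (volume : Measure (Torus m))
    ((haarSO d).prod (discLaw v))
  exact h5.comp (h4.comp (h3.comp (h2.comp h1)))

/-- The explicit coefficients are polynomials in c whose coefficients depend on (φ, M, b) only, so
their averages factor into moments of `ν`. -/
lemma integral_kappaLaw_smul {X : Type*} [NormedAddCommGroup X] [NormedSpace ℝ X]
    [SecondCountableTopology X] [MeasurableSpace X] [BorelSpace X] (v : E d)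
    {p : ℝ → ℝ} (hp : Measurable p) {F : Torus m × SO d × E d → X} (hF : Measurable F) :
    ∫ κ, p κ.2.2.2 • F (κ.2.2.1, κ.2.1, κ.1) ∂(kappaLaw m ν v) =
      (∫ c, p c ∂ν) • ∫ x, F x ∂((volume : Measure (Torus m)).prod ((haarSO d).prod (discLaw v))) := by
  have h := measurePreserving_kappa_rev (m := m) (ν := ν) v
  rw [← integral_prod_smul, ← h.map_eq, integral_map h.measurable.aemeasurable]
  exact (hp.comp measurable_fst).aestronglyMeasurable.smul
    (hF.comp measurable_snd).aestronglyMeasurable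

lemma integral_body_eq {v : E d} {F : Torus m × SO d × E d → ℝ} (hF : Measurable F) {C : ℝ}
    (hC : ∀ φ M b, ⟪b, v⟫ = 0 → ‖b‖ ≤ 1 / 2 → |F (φ, M, b)| ≤ C) :
    ∫ x, F x ∂((volume : Measure (Torus m)).prod ((haarSO d).prod (discLaw v))) =
      ∫ φ, ∫ M, ∫ b, F (φ, M, b) ∂(discLaw v) ∂(haarSO d) := by
  have hint : Integrable F
      ((volume : Measure (Torus m)).prod ((haarSO d).prod (discLaw v))) := by
    refine Integrable.of_bound hF.aestronglyMeasurable C ?_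
    have h : ∀ᵐ x ∂((volume : Measure (Torus m)).prod ((haarSO d).prod (discLaw v))),
        ⟪x.2.2, v⟫ = 0 ∧ ‖x.2.2‖ ≤ 1 / 2 :=
      Measure.quasiMeasurePreserving_snd.ae (Measure.quasiMeasurePreserving_snd.ae (ae_discLaw v))
    filter_upwards [h] with x hx
    exact hC x.1 x.2.1 x.2.2 hx.1 hx.2
  rw [integral_prod _ hint]
  refine integral_congr_ae ?_
  filter_upwards [hint.prod_right_ae] with φ hφ
  exact integral_prod _ hφ

end averages

/-! ### Means of the coefficients of the expansions. -/

section means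

variable {d m : ℕ} {ν : Measure ℝ} [IsProbabilityMeasure ν] {g : E d → Torus m → E d} {ω : E m}

/-- Coefficients in the frame of the scatterer are continuous in the laboratory frame. -/
lemma continuous_body {X : Type*} [TopologicalSpace X] {f : E d → E d → Torus m → X}
    (hf : Continuous fun x : E d × E d × Torus m => f x.1 x.2.1 x.2.2) :
    Continuous fun q : E d × Kappa d m => f (rot q.2.2.1⁻¹ q.1) (rot q.2.2.1⁻¹ q.2.1) q.2.2.2.1 := by
  have hM : Continuous fun q : E d × Kappa d m => q.2.2.1⁻¹ := by fun_prop
  exact hf.comp ((continuous_rot_comp hM (by fun_prop)).prodMk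
    ((continuous_rot_comp hM (by fun_prop)).prodMk (by fun_prop)))

lemma continuous_betaE (hg : Prof 3 g) (ω : E m) (l : ℕ) :
    Continuous fun q : E d × Kappa d m => betaE g ω l q.1 q.2 := by
  have hu : Continuous fun q : E d × Kappa d m => rot q.2.2.1⁻¹ q.1 :=
    continuous_rot_comp (by fun_prop) (by fun_prop)
  have h1 := continuous_body (continuous_aOne hg)
  have h2 := continuous_body (continuous_aTwo hg ω)
  have h3 := continuous_body (continuous_aThreeLin hg ω)
  have h4 := continuous_body (continuous_aThreeQuad hg)
  match l with
  | 0 => simp only [betaE, betaBody]; fun_prop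
  | 1 => simp only [betaE, betaBody]; fun_prop
  | (n + 2) => simp only [betaE, betaBody]; fun_prop

lemma measurable_betaE (hg : Prof 3 g) (ω : E m) (l : ℕ) (e : E d) :
    Measurable (betaE g ω l e) :=
  ((continuous_betaE hg ω l).comp (by fun_prop : Continuous fun κ : Kappa d m => (e, κ))).measurable

lemma continuous_alphaE (hg : Prof 3 g) (ω : E m) (k : ℕ) (e : E d) :
    Continuous (alphaE g ω k e) := by
  have hκ : Continuous fun κ : Kappa d m => (e, κ) := by fun_prop
  have h1 := (continuous_body (continuous_aOne hg)).comp hκ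
  have h2 := (continuous_body (continuous_aTwo hg ω)).comp hκ
  have h3 := (continuous_body (continuous_aThreeLin hg ω)).comp hκ
  have h4 := (continuous_body (continuous_aThreeQuad hg)).comp hκ
  simp only [Function.comp_def] at h1 h2 h3 h4
  have hM : Continuous fun κ : Kappa d m => κ.2.1 := by fun_prop
  match k with
  | 0 => exact continuous_const
  | 1 => exact continuous_rot_comp hM (by fun_prop)
  | 2 => exact continuous_rot_comp hM (by fun_prop)
  | 3 => exact continuous_rot_comp hM (by fun_prop)
  | (n + 4) => exact continuous_const

lemma memLp_betaE (hν : ∀ᵐ c ∂ν, c ∈ Set.Icc (-1 : ℝ) 1) (hg : Prof 3 g) {e : E d} (he : ‖e‖ = 1)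
    {l : ℕ} (hl : l ≤ 2) (p : ENNReal) : MemLp (betaE g ω l e) p (kappaLaw m ν e) := by
  obtain ⟨A, -, hA⟩ := exists_betaE_bound hg ω
  exact memLp_kappaLaw hν (measurable_betaE hg ω l e).aestronglyMeasurable
    (fun κ hκ => hA l hl e κ he hκ) p

lemma integral_alphaE_eq_zero (hcentered : ∫ c, c ∂ν = 0) (hg : Prof 3 g) (e : E d) {k : ℕ}
    (hk : k = 1 ∨ k = 2) : ∫ κ, alphaE g ω k e κ ∂(kappaLaw m ν e) = 0 := by
  have hκ : Continuous fun x : Torus m × SO d × E d => (e, ((x.2.2, x.2.1, x.1, 0) : Kappa d m)) := by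
    fun_prop
  have hM : Continuous fun x : Torus m × SO d × E d => x.2.1 := by fun_prop
  rcases hk with rfl | rfl
  · have h := integral_kappaLaw_smul (ν := ν) e measurable_id
      (continuous_rot_comp hM ((continuous_body (continuous_aOne hg)).comp hκ)).measurable
    simp only [Function.comp_def, id, hcentered, zero_smul] at h
    simpa only [alphaE, rot_smul] using h
  · have h := integral_kappaLaw_smul (ν := ν) e measurable_id
      (continuous_rot_comp hM ((continuous_body (continuous_aTwo hg ω)).comp hκ)).measurable
    simp only [Function.comp_def, id, hcentered, zero_smul] at h
    simpa only [alphaE, rot_smul] using h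

/-- Averages of functions given in the frame of the scatterer. -/
lemma integral_kappaLaw_body {p : ℝ → ℝ} (hp : Measurable p) {f : E d → E d → Torus m → ℝ}
    (hf : Continuous fun x : E d × E d × Torus m => f x.1 x.2.1 x.2.2) {e : E d} (he : ‖e‖ = 1) :
    ∫ κ, p κ.2.2.2 * f (rot κ.2.1⁻¹ e) (rot κ.2.1⁻¹ κ.1) κ.2.2.1 ∂(kappaLaw m ν e) =
      (∫ c, p c ∂ν) * ∫ φ, ∫ M, ∫ b, f (rot M⁻¹ e) (rot M⁻¹ b) φ ∂(discLaw e) ∂(haarSO d) := by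
  have hκ : Continuous fun x : Torus m × SO d × E d => (e, ((x.2.2, x.2.1, x.1, 0) : Kappa d m)) := by
    fun_prop
  have hF := ((continuous_body hf).comp hκ).measurable
  obtain ⟨A, -, hA⟩ := exists_bound_of_continuous hf
  have h1 := integral_kappaLaw_smul (ν := ν) e hp hF
  have h2 := integral_body_eq (v := e) hF (C := A) (fun φ M b _ hb =>
    hA _ _ _ (by rw [norm_rot, he]) (by rw [norm_rot]; linarith))
  rw [h2] at h1
  exact h1

lemma integrable_kappaLaw_body (hν : ∀ᵐ c ∂ν, c ∈ Set.Icc (-1 : ℝ) 1) (n : ℕ)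
    {f : E d → E d → Torus m → ℝ}
    (hf : Continuous fun x : E d × E d × Torus m => f x.1 x.2.1 x.2.2) {e : E d} (he : ‖e‖ = 1) :
    Integrable (fun κ => κ.2.2.2 ^ n * f (rot κ.2.1⁻¹ e) (rot κ.2.1⁻¹ κ.1) κ.2.2.1)
      (kappaLaw m ν e) := by
  obtain ⟨A, hA0, hA⟩ := exists_bound_of_continuous hf
  have hF : Continuous fun κ : Kappa d m => f (rot κ.2.1⁻¹ e) (rot κ.2.1⁻¹ κ.1) κ.2.2.1 :=
    (continuous_body hf).comp (by fun_prop : Continuous fun κ : Kappa d m => (e, κ))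
  refine (memLp_kappaLaw (C := A) hν ?_ (fun κ hκ => ?_) 1).integrable le_rfl
  · have hc : Continuous fun κ : Kappa d m => κ.2.2.2 ^ n := by fun_prop
    exact (hc.mul hF).aestronglyMeasurable
  · rw [norm_mul, norm_pow]
    have h1 : ‖κ.2.2.2‖ ^ n ≤ 1 := pow_le_one₀ (norm_nonneg _) (abs_le.2 hκ.2.2)
    have h2 := hA (rot κ.2.1⁻¹ e) (rot κ.2.1⁻¹ κ.1) κ.2.2.1 (by rw [norm_rot, he])
      (by rw [norm_rot]; linarith [hκ.2.1])
    calc _ ≤ 1 * A := mul_le_mul h1 h2 (norm_nonneg _) zero_le_one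
      _ = A := one_mul A

lemma integral_betaE_eq_zero (hcentered : ∫ c, c ∂ν = 0) (hg : Prof 3 g) {e : E d} (he : ‖e‖ = 1)
    {l : ℕ} (hl : l ≤ 1) : ∫ κ, betaE g ω l e κ ∂(kappaLaw m ν e) = 0 := by
  interval_cases l
  · have h := integral_kappaLaw_body (ν := ν) measurable_id
      (f := fun u b φ => ⟪u, aOne g u b φ⟫) (continuous_fst.inner (continuous_aOne hg)) he
    simpa only [id, hcentered, zero_mul, betaE, betaBody] using h
  · have h := integral_kappaLaw_body (ν := ν) measurable_id
      (f := fun u b φ => ⟪u, aTwo g ω u b φ⟫) (continuous_fst.inner (continuous_aTwo hg ω)) he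
    simpa only [id, hcentered, zero_mul, betaE, betaBody] using h

lemma Dsq_eq (hd : 1 ≤ d) (hg : Prof 3 g) (ν : Measure ℝ) :
    Dsq g ν = (∫ c, c ^ 2 ∂ν) * ∫ φ : Torus m,
      2 * ((ballVol d)⁻¹ * (sphereArea d)⁻¹ * ∫ z, weight z * ∫ x, kerD g φ x z) := by
  rw [Dsq]
  simp only [integral_integral_kerD_eq hd hg, integral_const_mul]
  ring

theorem integral_betaE_zero_sq (hd : 1 ≤ d) (hg : Prof 3 g) {e : E d} (he : ‖e‖ = 1) :
    ∫ κ, betaE g ω 0 e κ ^ 2 ∂(kappaLaw m ν e) = Dsq g ν := by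
  have h := integral_kappaLaw_body (ν := ν) (measurable_id.pow_const 2)
    (f := fun u b φ => ⟪u, aOne g u b φ⟫ ^ 2) ((continuous_fst.inner (continuous_aOne hg)).pow 2) he
  simp only [average_inner_aOne_sq hd hg he] at h
  rw [Dsq_eq hd hg]
  simp only [id] at h
  rw [← h]
  simp only [betaE, betaBody, mul_pow]

/-- The linear part of e·α^(3) disappears with the first moment of `ν`; what is left is
`average_quadratic`, whose factor d - 1 against the factor 2 in D'² gives (d-1)/2. -/
theorem integral_betaE_two (hd : 1 ≤ d) (hν : ∀ᵐ c ∂ν, c ∈ Set.Icc (-1 : ℝ) 1)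
    (hcentered : ∫ c, c ∂ν = 0) (hg : Prof 3 g) {e : E d} (he : ‖e‖ = 1) :
    ∫ κ, betaE g ω 2 e κ ∂(kappaLaw m ν e) = Bcoef g ν := by
  have c1 : Continuous fun x : E d × E d × Torus m => ⟪x.1, aThreeLin g ω x.1 x.2.1 x.2.2⟫ :=
    continuous_fst.inner (continuous_aThreeLin hg ω)
  have c2 : Continuous fun x : E d × E d × Torus m => 1 / 2 * ‖aOne g x.1 x.2.1 x.2.2‖ ^ 2 +
      ⟪x.1, aThreeQuad g x.1 x.2.1 x.2.2⟫ :=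
    (continuous_const.mul ((continuous_aOne hg).norm.pow 2)).add
      (continuous_fst.inner (continuous_aThreeQuad hg))
  have i1 := integrable_kappaLaw_body hν 1 (f := fun u b φ => ⟪u, aThreeLin g ω u b φ⟫) c1 he
  have i2 := integrable_kappaLaw_body hν 2 (f := fun u b φ => 1 / 2 * ‖aOne g u b φ‖ ^ 2 +
      ⟪u, aThreeQuad g u b φ⟫) c2 he
  have h1 := integral_kappaLaw_body (ν := ν) measurable_id
    (f := fun u b φ => ⟪u, aThreeLin g ω u b φ⟫) c1 he
  have h2 := integral_kappaLaw_body (ν := ν) (measurable_id.pow_const 2)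
    (f := fun u b φ => 1 / 2 * ‖aOne g u b φ‖ ^ 2 + ⟪u, aThreeQuad g u b φ⟫) c2 he
  simp only [average_quadratic hd hg he, id] at h2
  simp only [id, hcentered, zero_mul] at h1
  simp only [pow_one] at i1
  have h3 := integral_add i1 i2
  rw [h1, h2, zero_add] at h3
  rw [Bcoef, Dsq_eq hd hg]
  refine h3.trans ?_
  simp only [integral_const_mul]
  rw [Nat.cast_sub hd, Nat.cast_one]
  ring

end means

/-! ### Mean and mean square of the energy transfer. -/

section energy

variable {d m : ℕ} {ν : Measure ℝ} [IsProbabilityMeasure ν] {g : E d → Torus m → E d} {ω : E m}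

lemma measurable_deltaE (hg : Prof 3 g) (ω : E m) (v : E d) : Measurable (deltaE g ω v) := by
  have h : Measurable fun κ : Kappa d m => R g ω v κ :=
    (measurable_R hg ω).comp (by fun_prop : Measurable fun κ : Kappa d m => (v, κ))
  unfold deltaE
  exact ((((measurable_const.add h).norm.pow_const 2).sub measurable_const).const_mul _)

/-- The energy transfer for fast particles, and its square, up to errors. -/
lemma exists_deltaE_bounds (hg : Prof 3 g) (ω : E m) :
    ∃ C V : ℝ, 1 ≤ V ∧ ∀ (v : E d) (κ : Kappa d m), V ≤ ‖v‖ → Admissible v κ →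
      |deltaE g ω v κ - (betaE g ω 0 (dir v) κ + ‖v‖⁻¹ * betaE g ω 1 (dir v) κ +
        (‖v‖ ^ 2)⁻¹ * betaE g ω 2 (dir v) κ)| ≤ C * (‖v‖ ^ 3)⁻¹ ∧
      |deltaE g ω v κ| ≤ C ∧
      |deltaE g ω v κ ^ 2 - betaE g ω 0 (dir v) κ ^ 2| ≤ C * ‖v‖⁻¹ := by
  obtain ⟨C, V, hC0, hV, hC⟩ := exists_deltaE_expansion hg ω
  obtain ⟨A, hA0, hA⟩ := exists_betaE_bound hg ω
  set B := 3 * A + C with hB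
  have hB0 : 0 ≤ B := by positivity
  refine ⟨C + B + B * (B + A), V, hV, fun v κ hv hκ => ?_⟩
  have hv1 : 1 ≤ ‖v‖ := hV.trans hv
  have hv0 : v ≠ 0 := norm_pos_iff.1 (by linarith)
  have hκ' := (admissible_dir_iff hv0 κ).2 hκ
  have n0 := hA 0 (by norm_num) _ κ (norm_dir hv0) hκ'
  have n1 := hA 1 (by norm_num) _ κ (norm_dir hv0) hκ'
  have n2 := hA 2 le_rfl _ κ (norm_dir hv0) hκ'
  have key := hC v κ hv hκ
  generalize betaE g ω 0 (dir v) κ = β0 at *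
  generalize betaE g ω 1 (dir v) κ = β1 at *
  generalize betaE g ω 2 (dir v) κ = β2 at *
  generalize deltaE g ω v κ = δ at *
  have hε0 : 0 < ‖v‖⁻¹ := by positivity
  have hε1 : ‖v‖⁻¹ ≤ 1 := inv_le_one_of_one_le₀ hv1
  rw [← inv_pow, ← inv_pow] at *
  generalize ‖v‖⁻¹ = ε at *
  have e2 : ε ^ 2 ≤ ε := by simpa using pow_le_pow_of_le_one hε0.le hε1 (one_le_two)
  have e3 : ε ^ 3 ≤ ε := by
    simpa using pow_le_pow_of_le_one hε0.le hε1 (by norm_num : 1 ≤ 3)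
  have p1 : |ε * β1| ≤ A * ε := by
    rw [abs_mul, abs_of_pos hε0, mul_comm]; exact mul_le_mul_of_nonneg_right n1 hε0.le
  have p2 : |ε ^ 2 * β2| ≤ A * ε := by
    rw [abs_mul, abs_of_pos (by positivity), mul_comm]
    exact mul_le_mul n2 e2 (by positivity) hA0
  have p3 : C * ε ^ 3 ≤ C * ε := mul_le_mul_of_nonneg_left e3 hC0
  have q : |δ - β0| ≤ (2 * A + C) * ε := by
    have : δ - β0 = (δ - (β0 + ε * β1 + ε ^ 2 * β2)) + ε * β1 + ε ^ 2 * β2 := by ring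
    rw [this]
    refine (abs_add_three _ _ _).trans ?_
    linarith
  have q' : |δ| ≤ B := by
    have h1 : |δ| ≤ |δ - β0| + |β0| := by simpa using abs_add_le (δ - β0) β0
    have h2 : (2 * A + C) * ε ≤ 2 * A + C := mul_le_of_le_one_right (by positivity) hε1
    linarith
  refine ⟨key.trans (mul_le_mul_of_nonneg_right ?_ (by positivity)), q'.trans ?_, ?_⟩
  · have : 0 ≤ B * (B + A) := by positivity
    linarith
  · have : 0 ≤ B * (B + A) := by positivity
    linarith
  · have h1 : |δ + β0| ≤ B + A := (abs_add_le _ _).trans (add_le_add q' n0)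
    have h2 : δ ^ 2 - β0 ^ 2 = (δ - β0) * (δ + β0) := by ring
    rw [h2, abs_mul]
    calc _ ≤ (2 * A + C) * ε * (B + A) := mul_le_mul q h1 (abs_nonneg _) (by positivity)
      _ ≤ B * ε * (B + A) := by
        refine mul_le_mul_of_nonneg_right (mul_le_mul_of_nonneg_right ?_ hε0.le) (by positivity)
        linarith
      _ = B * (B + A) * ε := by ring
      _ ≤ _ := by
        refine mul_le_mul_of_nonneg_right ?_ hε0.le
        linarith

theorem deltaE_asymptotics (hd : 1 ≤ d) (hν : ∀ᵐ c ∂ν, c ∈ Set.Icc (-1 : ℝ) 1)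
    (hcentered : ∫ c, c ∂ν = 0) (hg : Prof 3 g) (ω : E m) :
    (∀ᶠ v in Bornology.cobounded (E d), MemLp (deltaE g ω v) 2 (kappaLaw m ν v)) ∧
    (fun v : E d => ∫ κ, deltaE g ω v κ ∂(kappaLaw m ν v) - Bcoef g ν / ‖v‖ ^ 2)
      =O[Bornology.cobounded (E d)] (fun v => (‖v‖ ^ 3)⁻¹) ∧
    (fun v : E d => ∫ κ, deltaE g ω v κ ^ 2 ∂(kappaLaw m ν v) - Dsq g ν)
      =O[Bornology.cobounded (E d)] (fun v => ‖v‖⁻¹) := by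
  obtain ⟨C, V, hV, hC⟩ := exists_deltaE_bounds hg ω
  have hlarge : ∀ᶠ v in Bornology.cobounded (E d), V ≤ ‖v‖ :=
    tendsto_norm_cobounded_atTop.eventually_ge_atTop V
  have hmem : ∀ v : E d, V ≤ ‖v‖ → ∀ p, MemLp (deltaE g ω v) p (kappaLaw m ν v) := fun v hv p =>
    memLp_kappaLaw hν (measurable_deltaE hg ω v).aestronglyMeasurable
      (fun κ hκ => (hC v κ hv hκ).2.1) p
  have hne : ∀ v : E d, V ≤ ‖v‖ → v ≠ 0 := fun v hv => norm_pos_iff.1 (by linarith)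
  have hβ : ∀ v : E d, V ≤ ‖v‖ → ∀ l ≤ 2, ∀ p, MemLp (betaE g ω l (dir v)) p (kappaLaw m ν v) :=
    fun v hv l hl p => by
      rw [← kappaLaw_dir (hne v hv)]
      exact memLp_betaE hν hg (norm_dir (hne v hv)) hl p
  refine ⟨hlarge.mono fun v hv => hmem v hv 2, IsBigO.of_bound C ?_, IsBigO.of_bound C ?_⟩
  · filter_upwards [hlarge] with v hv
    have he := norm_dir (hne v hv)
    have hint : ∀ l ≤ 2, Integrable (betaE g ω l (dir v)) (kappaLaw m ν v) :=
      fun l hl => (hβ v hv l hl 1).integrable le_rfl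
    have i1 := (hint 1 (by norm_num)).const_mul ‖v‖⁻¹
    have i2 := (hint 2 le_rfl).const_mul (‖v‖ ^ 2)⁻¹
    have i01 : Integrable (fun κ => betaE g ω 0 (dir v) κ + ‖v‖⁻¹ * betaE g ω 1 (dir v) κ)
        (kappaLaw m ν v) := (hint 0 (by norm_num)).add i1
    have i012 : Integrable (fun κ => betaE g ω 0 (dir v) κ + ‖v‖⁻¹ * betaE g ω 1 (dir v) κ +
        (‖v‖ ^ 2)⁻¹ * betaE g ω 2 (dir v) κ) (kappaLaw m ν v) := i01.add i2
    have h1 : ∫ κ, (betaE g ω 0 (dir v) κ + ‖v‖⁻¹ * betaE g ω 1 (dir v) κ +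
        (‖v‖ ^ 2)⁻¹ * betaE g ω 2 (dir v) κ) ∂(kappaLaw m ν v) = Bcoef g ν / ‖v‖ ^ 2 := by
      rw [integral_add i01 i2, integral_add (hint 0 (by norm_num)) i1, integral_const_mul,
        integral_const_mul, ← kappaLaw_dir (hne v hv), integral_betaE_eq_zero hcentered hg he zero_le_one,
        integral_betaE_eq_zero hcentered hg he le_rfl, integral_betaE_two hd hν hcentered hg he]
      ring
    rw [← h1, ← integral_sub ((hmem v hv 1).integrable le_rfl) i012]
    have h2 := norm_integral_le_of_norm_le_const (μ := kappaLaw m ν v)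
      (f := fun κ => deltaE g ω v κ - (betaE g ω 0 (dir v) κ + ‖v‖⁻¹ * betaE g ω 1 (dir v) κ +
        (‖v‖ ^ 2)⁻¹ * betaE g ω 2 (dir v) κ))
      ((ae_admissible hν v).mono fun κ hκ => (hC v κ hv hκ).1)
    rw [probReal_univ, mul_one] at h2
    rw [Real.norm_of_nonneg (by positivity : 0 ≤ (‖v‖ ^ 3)⁻¹)]
    exact h2
  · filter_upwards [hlarge] with v hv
    have he := norm_dir (hne v hv)
    rw [← integral_betaE_zero_sq (ω := ω) hd hg he, kappaLaw_dir (hne v hv),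
      ← integral_sub (hmem v hv 2).integrable_sq (hβ v hv 0 (by norm_num) 2).integrable_sq]
    have h2 := norm_integral_le_of_norm_le_const (μ := kappaLaw m ν v)
      (f := fun κ => deltaE g ω v κ ^ 2 - betaE g ω 0 (dir v) κ ^ 2)
      ((ae_admissible hν v).mono fun κ hκ => (hC v κ hv hκ).2.2)
    rw [probReal_univ, mul_one] at h2
    rw [Real.norm_of_nonneg (by positivity : 0 ≤ ‖v‖⁻¹)]
    exact h2

end energy

/-! ### Positivity of `D'²` -/

section positivity

variable {d m : ℕ} {ν : Measure ℝ} [IsProbabilityMeasure ν] {g : E d → Torus m → E d} {ω : E m}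

/-- Impact parameters on the boundary ‖b‖ = 1/2 are covered too: they are limits of interior points
of the disc, near which the volume of the hyperplane is positive. -/
lemma discLaw_pos {e b : E d} (hbe : ⟪b, e⟫ = 0) (hb : ‖b‖ ≤ 1 / 2) {D : Set (E d)} (hD : IsOpen D)
    (hbD : b ∈ D) : 0 < discLaw e D := by
  have hD' : IsOpen ((Subtype.val : (ℝ ∙ e)ᗮ → E d) ⁻¹' D) := hD.preimage continuous_subtype_val
  rw [discLaw, Measure.map_apply measurable_subtype_coe hD.measurableSet,
    ProbabilityTheory.cond_apply Metric.isClosed_closedBall.measurableSet]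
  refine ENNReal.mul_pos (ENNReal.inv_ne_zero.2 volume_disc_ne_top) ?_
  set b' : (ℝ ∙ e)ᗮ := ⟨b, Submodule.mem_orthogonal_singleton_iff_inner_left.2 hbe⟩ with hb'
  have hcl : b' ∈ closure (Metric.ball (0 : (ℝ ∙ e)ᗮ) (1 / 2)) := by
    rw [closure_ball _ (by norm_num), mem_closedBall_zero_iff]
    exact hb
  obtain ⟨x, hx1, hx2⟩ := mem_closure_iff.1 hcl _ hD' hbD
  have hpos : 0 < (volume : Measure (ℝ ∙ e)ᗮ)
      (Metric.ball 0 (1 / 2) ∩ (Subtype.val : (ℝ ∙ e)ᗮ → E d) ⁻¹' D) :=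
    (Metric.isOpen_ball.inter hD').measure_pos _ ⟨x, hx2, hx1⟩
  exact (hpos.trans_le (measure_mono
    (Set.inter_subset_inter_left _ Metric.ball_subset_closedBall))).ne'

lemma prod_discLaw_pos {e : E d} {U : Set (Torus m × SO d × E d)} (hU : IsOpen U)
    {x : Torus m × SO d × E d} (hx : x ∈ U) (hxe : ⟪x.2.2, e⟫ = 0) (hxn : ‖x.2.2‖ ≤ 1 / 2) :
    0 < ((volume : Measure (Torus m)).prod ((haarSO d).prod (discLaw e))) U := by
  obtain ⟨A, B, hA, hB, hxA, hxB, hAB⟩ := isOpen_prod_iff.1 hU x.1 x.2 hx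
  obtain ⟨B1, B2, hB1, hB2, hx1, hx2, hBB⟩ := isOpen_prod_iff.1 hB x.2.1 x.2.2 hxB
  refine lt_of_lt_of_le ?_ (measure_mono ((Set.prod_mono_right hBB).trans hAB))
  rw [Measure.prod_prod, Measure.prod_prod]
  exact ENNReal.mul_pos (hA.measure_pos _ ⟨_, hxA⟩).ne'
    (ENNReal.mul_pos (hB1.measure_pos _ ⟨_, hx1⟩).ne' (discLaw_pos hxe hxn hB2 hx2).ne').ne'

lemma integral_sq_pos (hν : ∀ᵐ c ∂ν, c ∈ Set.Icc (-1 : ℝ) 1) (hν0 : ν ≠ Measure.dirac 0) :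
    0 < ∫ c, c ^ 2 ∂ν := by
  have hint : Integrable (fun c : ℝ => c ^ 2) ν := by
    refine Integrable.of_bound (by fun_prop) 1 (hν.mono fun c hc => ?_)
    rw [norm_pow]
    exact pow_le_one₀ (norm_nonneg _) (abs_le.2 hc)
  refine lt_of_le_of_ne (integral_nonneg fun c => sq_nonneg c) fun h => hν0 ?_
  have h0 := (integral_eq_zero_iff_of_nonneg (fun c => sq_nonneg c) hint).1 h.symm
  have h1 : (id : ℝ → ℝ) =ᵐ[ν] fun _ => 0 := h0.mono fun c hc => by
    simpa using hc
  have h2 : ν.map id = ν.map fun _ => 0 := Measure.map_congr h1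
  rwa [Measure.map_id, Measure.map_const, measure_univ, one_smul] at h2

lemma exists_norm_eq_one (hd : 1 ≤ d) : ∃ e : E d, ‖e‖ = 1 := by
  have := nontrivial_E hd
  exact exists_norm_eq (E d) zero_le_one

lemma Dsq_nonneg (hd : 1 ≤ d) (hg : Prof 3 g) : 0 ≤ Dsq g ν := by
  obtain ⟨e, he⟩ := exists_norm_eq_one hd
  rw [← integral_betaE_zero_sq (ω := (0 : E m)) hd hg he]
  exact integral_nonneg fun κ => sq_nonneg _

/-- D'² may be computed with the given e. It is the second moment of `ν`, positive since `ν` is not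
the point mass at 0, times the mean of F² for a continuous F; the support of F² is open and contains
the given admissible point, so it has positive measure. -/
lemma Dsq_pos_of_ne_zero (hd : 1 ≤ d) (hν : ∀ᵐ c ∂ν, c ∈ Set.Icc (-1 : ℝ) 1)
    (hν0 : ν ≠ Measure.dirac 0) (hg : Prof 3 g) {e : E d} {κ : Kappa d m} (he : ‖e‖ = 1)
    (hκ : Admissible e κ) (h0 : betaE g ω 0 e κ ≠ 0) : 0 < Dsq g ν := by
  have hf : Continuous fun x : E d × E d × Torus m =>
      ⟪x.1, aOne g x.1 x.2.1 x.2.2⟫ :=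
    continuous_fst.inner (continuous_aOne hg)
  obtain ⟨F, hF⟩ : ∃ F : Torus m × SO d × E d → ℝ, F =
    fun x => ⟪rot x.2.1⁻¹ e, aOne g (rot x.2.1⁻¹ e) (rot x.2.1⁻¹ x.2.2) x.1⟫ := ⟨_, rfl⟩
  have hFc : Continuous F := by
    rw [hF]
    have hx : Continuous fun x : Torus m × SO d × E d =>
        (e, ((x.2.2, x.2.1, x.1, 0) : Kappa d m)) := by fun_prop
    have h := (continuous_body (f := fun u b φ => ⟪u, aOne g u b φ⟫) hf).comp hx
    simp only [Function.comp_def] at h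
    exact h
  have h1 : Dsq g ν = (∫ c, c ^ 2 ∂ν) *
      ∫ x, F x ^ 2 ∂((volume : Measure (Torus m)).prod ((haarSO d).prod (discLaw e))) := by
    rw [← integral_betaE_zero_sq (ω := ω) hd hg he]
    have h := integral_kappaLaw_smul (ν := ν) e (measurable_id.pow_const 2)
      (hFc.measurable.pow_const 2)
    simp only [id, smul_eq_mul] at h
    rw [← h]
    simp only [betaE, betaBody, mul_pow, hF]
  rw [h1]
  refine mul_pos (integral_sq_pos hν hν0) ?_
  obtain ⟨A, -, hA⟩ := exists_bound_of_continuous hf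
  have hbound : ∀ᵐ x ∂((volume : Measure (Torus m)).prod ((haarSO d).prod (discLaw e))),
      ‖F x ^ 2‖ ≤ A ^ 2 := by
    have h : ∀ᵐ x ∂((volume : Measure (Torus m)).prod ((haarSO d).prod (discLaw e))),
        ⟪x.2.2, e⟫ = 0 ∧ ‖x.2.2‖ ≤ 1 / 2 :=
      Measure.quasiMeasurePreserving_snd.ae (Measure.quasiMeasurePreserving_snd.ae (ae_discLaw e))
    filter_upwards [h] with x hx
    rw [norm_pow, hF]
    exact pow_le_pow_left₀ (norm_nonneg _) (hA _ _ _ (by rw [norm_rot, he])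
      (by rw [norm_rot]; linarith [hx.2])) 2
  have hint := Integrable.of_bound (hFc.pow 2).aestronglyMeasurable _ hbound
  rw [integral_pos_iff_support_of_nonneg (fun x => sq_nonneg _) hint]
  refine prod_discLaw_pos (x := (κ.2.2.1, κ.2.1, κ.1)) ((hFc.pow 2).isOpen_support) ?_ hκ.1 hκ.2.1
  rw [Function.mem_support]
  refine pow_ne_zero 2 fun h => h0 ?_
  rw [hF] at h
  simp only at h
  rw [betaE, betaBody, h, mul_zero]

theorem Dsq_pos_iff (hd : 1 ≤ d) (hν : ∀ᵐ c ∂ν, c ∈ Set.Icc (-1 : ℝ) 1)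
    (hν0 : ν ≠ Measure.dirac 0) (hg : Prof 3 g) (ω : E m) :
    0 < Dsq g ν ↔
      ∃ (e : E d) (κ : Kappa d m), ‖e‖ = 1 ∧ Admissible e κ ∧ betaE g ω 0 e κ ≠ 0 := by
  refine ⟨fun h => ?_, fun ⟨e, κ, he, hκ, h0⟩ => Dsq_pos_of_ne_zero hd hν hν0 hg he hκ h0⟩
  by_contra! hall
  obtain ⟨e, he⟩ := exists_norm_eq_one hd
  rw [← integral_betaE_zero_sq (ω := ω) hd hg he] at h
  refine h.ne' (integral_eq_zero_of_ae ((ae_admissible hν e).mono fun κ hκ => ?_))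
  simp [hall e κ he hκ]

end positivity

/-! ### Gradient fields -/

section gradient

variable {d m : ℕ} {g : E d → Torus m → E d} {W : E d → ℝ} {φ : Torus m}

lemma potential_sub_eq (hg : Prof 3 g) (hW : ∀ y, HasGradientAt W (-(g y φ)) y) (x u : E d)
    (s t : ℝ) : W (x + t • u) - W (x + s • u) = -∫ r in s..t, ⟪u, g (x + r • u) φ⟫ := by
  have hder : ∀ r : ℝ, HasDerivAt (fun r : ℝ => W (x + r • u)) (-⟪u, g (x + r • u) φ⟫) r := by
    intro r
    have h1 : HasDerivAt (fun r : ℝ => x + r • u) u r := by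
      simpa using ((hasDerivAt_id r).smul_const u).const_add x
    have h2 := (hW (x + r • u)).hasFDerivAt.comp_hasDerivAt r h1
    refine h2.congr_deriv ?_
    rw [InnerProductSpace.toDual_apply_apply, inner_neg_left, real_inner_comm]
  have hc : Continuous fun r : ℝ => -⟪u, g (x + r • u) φ⟫ := by
    have := hg.continuous_left φ
    fun_prop
  rw [← intervalIntegral.integral_neg]
  exact (intervalIntegral.integral_eq_sub_of_hasDerivAt (fun r _ => hder r)
    (hc.intervalIntegrable _ _)).symm

lemma potential_eq_of_segment (hg : Prof 3 g) (hW : ∀ y, HasGradientAt W (-(g y φ)) y) {x u : E d}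
    (h : ∀ r : ℝ, r ∈ Set.Icc (0 : ℝ) 1 → 1 / 2 < ‖x + r • u‖) : W (x + u) = W x := by
  have h1 := potential_sub_eq hg hW x u 0 1
  have h2 : ∫ r in (0 : ℝ)..1, ⟪u, g (x + r • u) φ⟫ = ∫ r in (0 : ℝ)..1, (0 : ℝ) := by
    refine intervalIntegral.integral_congr fun r hr => ?_
    rw [Set.uIcc_of_le zero_le_one] at hr
    rw [hg.support _ _ (h r hr), inner_zero_right]
  rw [h2, intervalIntegral.integral_zero, one_smul, zero_smul, add_zero] at h1
  linarith

lemma lt_norm_of_lt_inner {x w : E d} (hw : ‖w‖ = 1) (h : 1 / 2 < |⟪x, w⟫|) : 1 / 2 < ‖x‖ := by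
  have := abs_real_inner_le_norm x w
  rw [hw, mul_one] at this
  linarith

/-- The potential takes the same value at both ends of a free trajectory. -/
lemma potential_ends_eq (hd : 1 ≤ d) (hg : Prof 3 g) (hW : ∀ y, HasGradientAt W (-(g y φ)) y)
    (hW1 : d = 1 → ∀ y, 1 / 2 < ‖y‖ → W y = 0) {u b : E d} (hu : ‖u‖ = 1) (hbu : ⟪b, u⟫ = 0)
    (hb : ‖b‖ ≤ 1 / 2) : W (line u b 2) = W (line u b (-1)) := by
  have huu : ⟪u, u⟫ = 1 := by rw [real_inner_self_eq_norm_sq, hu, one_pow]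
  by_cases hd1 : d = 1
  · rw [hW1 hd1 _ (lt_norm_line hu hbu (by norm_num)), hW1 hd1 _ (lt_norm_line hu hbu (by norm_num))]
  · obtain ⟨w', hw0, hwu'⟩ := exists_ne_zero_inner_eq_zero (by omega : 2 ≤ d) u
    obtain ⟨w, hw, hwu⟩ : ∃ w : E d, ‖w‖ = 1 ∧ ⟪w, u⟫ = 0 := by
      refine ⟨‖w'‖⁻¹ • w', norm_smul_inv_norm hw0, ?_⟩
      rw [real_inner_smul_left, hwu', mul_zero]
    have huw : ⟪u, w⟫ = 0 := by rw [real_inner_comm, hwu]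
    have hww : ⟪w, w⟫ = 1 := by rw [real_inner_self_eq_norm_sq, hw, one_pow]
    have hbw : |⟪b, w⟫| ≤ 1 / 2 := by
      have := abs_real_inner_le_norm b w
      rw [hw, mul_one] at this
      linarith
    -- The two ends are joined by three sides of a rectangle outside the ball: up by 2w, along by
    -- 3u, and down again. On the sides the component along u exceeds 1/2 in modulus, on the top the
    -- component along w is at least 3/2.
    have side : ∀ s : ℝ, 1 / 2 < |s - 1 / 2| → W (line u b s + (2 : ℝ) • w) = W (line u b s) := by
      intro s hs
      refine potential_eq_of_segment hg hW fun r _ => lt_norm_of_lt_inner hu ?_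
      simpa only [line, inner_add_left, real_inner_smul_left, hbu, huu, hwu, mul_one, mul_zero,
        zero_add, add_zero] using hs
    have top : W (line u b (-1) + (2 : ℝ) • w + (3 : ℝ) • u) = W (line u b (-1) + (2 : ℝ) • w) := by
      refine potential_eq_of_segment hg hW fun r _ => lt_norm_of_lt_inner hw ?_
      simp only [line, inner_add_left, real_inner_smul_left, huw, hww, mul_one, mul_zero, add_zero]
      rw [lt_abs]
      left
      linarith [(abs_le.1 hbw).1]
    have hline : line u b (-1) + (2 : ℝ) • w + (3 : ℝ) • u = line u b 2 + (2 : ℝ) • w := by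
      simp only [line]; module
    rw [← side 2 (by norm_num), ← side (-1) (by norm_num), ← hline, top]

/-- At frozen phase the left side is the work of the force along the line, hence a difference of
potential between two ends at which the potential agrees. -/
lemma inner_aOne_eq_zero_of_gradient (hd : 1 ≤ d) (hg : Prof 3 g)
    (hW : ∀ y, HasGradientAt W (-(g y φ)) y) (hW1 : d = 1 → ∀ y, 1 / 2 < ‖y‖ → W y = 0)
    {u b : E d} (hu : ‖u‖ = 1) (hbu : ⟪b, u⟫ = 0) (hb : ‖b‖ ≤ 1 / 2) : ⟪u, aOne g u b φ⟫ = 0 := by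
  have hc := continuous_g_line hg u b φ
  have hci : Continuous fun s => ⟪u, g (line u b s) φ⟫ := continuous_const.inner hc
  have h1 : ⟪u, aOne g u b φ⟫ = ∫ s in (0 : ℝ)..2, ⟪u, g (line u b s) φ⟫ :=
    ((innerSL ℝ u).intervalIntegral_comp_comm (hc.intervalIntegrable 0 2)).symm
  have h0 : ∫ s in (-1 : ℝ)..0, ⟪u, g (line u b s) φ⟫ = 0 := by
    rw [intervalIntegral.integral_of_le (by norm_num), integral_Ioc_eq_integral_Ioo]
    refine setIntegral_eq_zero_of_forall_eq_zero fun s hs => ?_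
    rw [g_line_eq_zero hg hu hbu (fun h => by linarith [h.1, hs.2]), inner_zero_right]
  have h2 := intervalIntegral.integral_add_adjacent_intervals
    (hci.intervalIntegrable (μ := volume) (-1) 0) (hci.intervalIntegrable (μ := volume) 0 2)
  rw [h0, zero_add] at h2
  have h3 := intervalIntegral.integral_comp_sub_right (a := (-1 : ℝ)) (b := 2)
    (fun r => ⟪u, g (b + r • u) φ⟫) (1 / 2)
  have h4 := potential_sub_eq hg hW b u (-1 - 1 / 2) (2 - 1 / 2)
  have h5 := potential_ends_eq hd hg hW hW1 hu hbu hb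
  simp only [line] at h1 h2 h5
  rw [h1, h2, h3]
  linarith

theorem not_isGradientField (hd : 1 ≤ d) (hg : Prof 3 g) {ω : E m} {e : E d} {κ : Kappa d m}
    (he : ‖e‖ = 1) (hκ : Admissible e κ) (h0 : betaE g ω 0 e κ ≠ 0) : ¬ IsGradientField g := by
  rintro ⟨W, hW, hW1⟩
  refine h0 ?_
  rw [betaE, betaBody, inner_aOne_eq_zero_of_gradient (W := fun y => W y κ.2.2.1) hd hg
    (hW κ.2.2.1) (fun h => hW1 h κ.2.2.1) (by rw [norm_rot, he]) (by rw [inner_rot_rot, hκ.1])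
    (by rw [norm_rot]; exact hκ.2.1), mul_zero]

end gradient

/-! ### The law of the scattering parameters as a kernel -/

section kernel

variable {d m : ℕ}

/-- The projection orthogonal to a unit vector. -/
noncomputable def perp (e x : E d) : E d := x - ⟪x, e⟫ • e

lemma continuous_perp : Continuous fun p : E d × E d => perp p.1 p.2 := by
  unfold perp; fun_prop

lemma measurable_perp (e : E d) : Measurable (perp e) :=
  (continuous_perp.comp (by fun_prop : Continuous fun x : E d => (e, x))).measurable

/-- The uniform law on the disc orthogonal to `e`, expressed by the volume of cylinders. -/
lemma discLaw_apply {e : E d} (he : ‖e‖ = 1) {S : Set (E d)} (hS : MeasurableSet S) :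
    discLaw e S = (volume (Metric.closedBall (0 : E (d - 1)) (1 / 2)))⁻¹ *
      volume {x : E d | ⟪x, e⟫ ∈ Set.Icc (0 : ℝ) 1 ∧ perp e x ∈ Metric.closedBall 0 (1 / 2) ∩ S} := by
  have he0 : e ≠ 0 := by rintro rfl; simp at he
  rw [discLaw, Measure.map_apply measurable_subtype_coe hS,
    ProbabilityTheory.cond_apply Metric.isClosed_closedBall.measurableSet, volume_disc he0]
  congr 1
  have hm : MeasurableSet
      {x : E d | ⟪x, e⟫ ∈ Set.Icc (0 : ℝ) 1 ∧ perp e x ∈ Metric.closedBall 0 (1 / 2) ∩ S} :=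
    ((by fun_prop : Measurable fun x : E d => ⟪x, e⟫) measurableSet_Icc).inter
      (measurable_perp e (Metric.isClosed_closedBall.measurableSet.inter hS))
  rw [← (measurePreserving_cylinder he).measure_preimage hm.nullMeasurableSet]
  have hset : (fun p : ℝ × (ℝ ∙ e)ᗮ => (p.2 : E d) + p.1 • e) ⁻¹'
      {x : E d | ⟪x, e⟫ ∈ Set.Icc (0 : ℝ) 1 ∧ perp e x ∈ Metric.closedBall 0 (1 / 2) ∩ S} =
      Set.Icc (0 : ℝ) 1 ×ˢ (Metric.closedBall 0 (1 / 2) ∩ Subtype.val ⁻¹' S) := by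
    ext p
    have h1 : ⟪(p.2 : E d), e⟫ = 0 := Submodule.mem_orthogonal_singleton_iff_inner_left.1 p.2.2
    have h2 : ⟪(p.2 : E d) + p.1 • e, e⟫ = p.1 := by
      rw [inner_add_left, real_inner_smul_left, h1, real_inner_self_eq_norm_sq, he]
      ring
    have h3 : perp e ((p.2 : E d) + p.1 • e) = p.2 := by rw [perp, h2, add_sub_cancel_right]
    simp only [Set.mem_preimage, Set.mem_ofPred_eq, h2, h3, Set.mem_prod, Set.mem_inter_iff,
      mem_closedBall_zero_iff, Submodule.coe_norm]
  rw [hset, Measure.prod_prod, Real.volume_Icc]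
  simp

/-- The laws live on different hyperplanes, but `discLaw_apply` expresses them as volumes of
sections of one measurable set `T` of the product space. The velocity 0, which has no direction, is
split off as a single point. -/
lemma measurable_discLaw : Measurable (discLaw : E d → Measure (E d)) := by
  refine Measure.measurable_of_measurable_coe _ fun S hS => ?_
  set T : Set (E d × E d) := {p | ⟪p.2, p.1⟫ ∈ Set.Icc (0 : ℝ) 1 ∧
    perp p.1 p.2 ∈ Metric.closedBall 0 (1 / 2) ∩ S} with hT
  have hTm : MeasurableSet T :=
    ((by fun_prop : Measurable fun p : E d × E d => ⟪p.2, p.1⟫) measurableSet_Icc).inter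
      (continuous_perp.measurable (Metric.isClosed_closedBall.measurableSet.inter hS))
  have h1 : Measurable fun v : E d => (volume (Metric.closedBall (0 : E (d - 1)) (1 / 2)))⁻¹ *
      volume (Prod.mk (dir v) ⁻¹' T) :=
    ((measurable_measure_prodMk_left hTm).comp measurable_dir).const_mul _
  have h2 : (fun v : E d => discLaw v S) = fun v => if v = 0 then discLaw (0 : E d) S else
      (volume (Metric.closedBall (0 : E (d - 1)) (1 / 2)))⁻¹ * volume (Prod.mk (dir v) ⁻¹' T) := by
    funext v
    split_ifs with hv
    · rw [hv]
    · have h3 : discLaw (dir v) = discLaw v :=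
        discLaw_smul (inv_ne_zero (norm_ne_zero_iff.2 hv)) v
      rw [← h3, discLaw_apply (norm_dir hv) hS]
      rfl
  rw [h2]
  exact Measurable.ite (measurableSet_singleton 0) measurable_const h1

/-- The law of the scattering parameters, as a kernel. -/
noncomputable def kappaKernel (m : ℕ) (ν : Measure ℝ) : ProbabilityTheory.Kernel (E d) (Kappa d m) :=
  ProbabilityTheory.Kernel.prod ⟨discLaw, measurable_discLaw⟩
    (ProbabilityTheory.Kernel.const _ ((haarSO d).prod ((volume : Measure (Torus m)).prod ν)))

variable {ν : Measure ℝ} [IsProbabilityMeasure ν]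

lemma kappaKernel_apply (v : E d) : kappaKernel m ν v = kappaLaw m ν v := by
  have : ProbabilityTheory.IsMarkovKernel
      (⟨discLaw, measurable_discLaw⟩ : ProbabilityTheory.Kernel (E d) (E d)) :=
    ⟨fun v => inferInstanceAs (IsProbabilityMeasure (discLaw v))⟩
  rw [kappaKernel, ProbabilityTheory.Kernel.prod_apply]
  rfl

instance : ProbabilityTheory.IsMarkovKernel (kappaKernel m ν : ProbabilityTheory.Kernel (E d) _) :=
  ⟨fun v => by rw [kappaKernel_apply]; infer_instance⟩

/-! ### Rotation invariance -/

lemma map_rot_discLaw {e : E d} (he : ‖e‖ = 1) (Q : SO d) :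
    (discLaw e).map (rot Q) = discLaw (rot Q e) := by
  have hQ := (measurePreserving_rot Q).measurable
  ext S hS
  have hm : MeasurableSet {x : E d | ⟪x, rot Q e⟫ ∈ Set.Icc (0 : ℝ) 1 ∧
      perp (rot Q e) x ∈ Metric.closedBall 0 (1 / 2) ∩ S} :=
    ((by fun_prop : Measurable fun x : E d => ⟪x, rot Q e⟫) measurableSet_Icc).inter
      (measurable_perp _ (Metric.isClosed_closedBall.measurableSet.inter hS))
  rw [Measure.map_apply hQ hS, discLaw_apply he (hQ hS), discLaw_apply (by rw [norm_rot, he]) hS,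
    ← (measurePreserving_rot Q).measure_preimage hm.nullMeasurableSet]
  congr 2
  ext x
  have h : perp (rot Q e) (rot Q x) = rot Q (perp e x) := by
    rw [perp, perp, inner_rot_rot, rot_sub, rot_smul]
  simp only [Set.mem_ofPred_eq, Set.mem_preimage, inner_rot_rot, h, Set.mem_inter_iff,
    mem_closedBall_zero_iff, norm_rot]

lemma measurePreserving_rot_kappa {e : E d} (he : ‖e‖ = 1) (Q : SO d) :
    MeasurePreserving (fun κ : Kappa d m => (rot Q κ.1, Q * κ.2.1, κ.2.2)) (kappaLaw m ν e)
      (kappaLaw m ν (rot Q e)) := by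
  have h1 : MeasurePreserving (rot Q) (discLaw e) (discLaw (rot Q e)) :=
    ⟨(measurePreserving_rot Q).measurable, map_rot_discLaw he Q⟩
  have h2 := measurePreserving_mul_left (haarSO d) Q
  exact h1.prod (h2.prod (MeasurePreserving.id ((volume : Measure (Torus m)).prod ν)))

lemma betaE_rot (g : E d → Torus m → E d) (ω : E m) (l : ℕ) (e : E d) (Q : SO d) (κ : Kappa d m) :
    betaE g ω l (rot Q e) (rot Q κ.1, Q * κ.2.1, κ.2.2) = betaE g ω l e κ := by
  have h : ∀ x, rot (Q * κ.2.1)⁻¹ (rot Q x) = rot κ.2.1⁻¹ x := fun x => by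
    rw [mul_inv_rev, rot_mul, rot_inv_rot]
  simp only [betaE, h]

/-- Rotating e, b and M together leaves M⁻¹e and M⁻¹b unchanged and carries one law into the other;
any two directions are related in this way when d ≥ 2. -/
lemma integral_betaE_mul_eq {g : E d → Torus m → E d} (hd : 2 ≤ d) (hg : Prof 3 g) {ω : E m}
    {l l' : ℕ} {e e' : E d} (he : ‖e‖ = 1) (he' : ‖e'‖ = 1) :
    ∫ κ, betaE g ω l e κ * betaE g ω l' e κ ∂(kappaLaw m ν e) =
      ∫ κ, betaE g ω l e' κ * betaE g ω l' e' κ ∂(kappaLaw m ν e') := by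
  obtain ⟨Q, rfl⟩ := exists_rot_eq hd (he.trans he'.symm)
  have h := measurePreserving_rot_kappa (m := m) (ν := ν) he Q
  have hm : Measurable fun κ : Kappa d m =>
      betaE g ω l (rot Q e) κ * betaE g ω l' (rot Q e) κ :=
    (measurable_betaE hg ω l _).mul (measurable_betaE hg ω l' _)
  rw [← h.map_eq, integral_map h.measurable.aemeasurable hm.aestronglyMeasurable]
  simp only [betaE_rot]

end kernel

/-! ### The random walk -/

section walk

variable {d m : ℕ} {Ω : Type u} {κ : ℕ → Ω → Kappa d m}

/-- The information about the first `n` scattering events. -/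
@[reducible]
def pastEvents (κ : ℕ → Ω → Kappa d m) (n : ℕ) : MeasurableSpace Ω :=
  ⨆ k ∈ Finset.range n, MeasurableSpace.comap (κ k) inferInstance

lemma measurable_pastEvents_kappa (κ : ℕ → Ω → Kappa d m) {k n : ℕ} (h : k < n) :
    Measurable[pastEvents κ n] (κ k) := by
  rw [measurable_iff_comap_le]
  exact le_iSup₂_of_le k (Finset.mem_range.2 h) le_rfl

lemma pastEvents_mono (κ : ℕ → Ω → Kappa d m) {n n' : ℕ} (h : n ≤ n') :
    pastEvents κ n ≤ pastEvents κ n' :=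
  iSup₂_le fun k hk => le_iSup₂_of_le k
    (Finset.mem_range.2 ((Finset.mem_range.1 hk).trans_le h)) le_rfl

variable {ν : Measure ℝ} {g : E d → Torus m → E d} {ω : E m} [MeasurableSpace Ω] {P : Measure Ω}
  {v₀ : E d} {v : ℕ → Ω → E d}

lemma IsVelocityWalk.pastEvents_le (hw : IsVelocityWalk g ω ν P v₀ v κ) (n : ℕ) :
    pastEvents κ n ≤ ‹MeasurableSpace Ω› :=
  iSup₂_le fun k _ => (hw.measurable_kappa k).comap_le

lemma IsVelocityWalk.measurable_velocity (hw : IsVelocityWalk g ω ν P v₀ v κ) (hg : Prof 3 g)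
    (n : ℕ) : Measurable[pastEvents κ n] (v n) := by
  induction n with
  | zero =>
    have h : v 0 = fun _ => v₀ := funext hw.init
    rw [h]
    exact measurable_const
  | succ n ih =>
    have h : v (n + 1) = fun x => v n x + R g ω (v n x) (κ n x) := funext (hw.step n)
    have h1 : Measurable[pastEvents κ (n + 1)] (v n) := ih.mono (pastEvents_mono κ n.le_succ) le_rfl
    have h2 := measurable_pastEvents_kappa κ n.lt_succ_self
    rw [h]
    exact h1.add ((measurable_R hg ω).comp (h1.prodMk h2))

variable [IsProbabilityMeasure ν] [IsProbabilityMeasure P]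

/-- The hypothesis `law` in terms of kernels, checked on rectangles. An arbitrary observable X of
the past is carried along with v_n, so that Fubini for the composition product acts as conditioning
on the past. -/
lemma IsVelocityWalk.map_eq (hw : IsVelocityWalk g ω ν P v₀ v κ) (hg : Prof 3 g) (n : ℕ)
    {X : Ω → ℝ} (hX : Measurable[pastEvents κ n] X) :
    P.map (fun x => ((v n x, X x), κ n x)) = (P.map fun x => (v n x, X x)).compProd
      ((kappaKernel m ν).comap (Prod.fst : E d × ℝ → E d) measurable_fst) := by
  have hvX : Measurable[pastEvents κ n] fun x => (v n x, X x) :=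
    (hw.measurable_velocity hg n).prodMk hX
  have hvX' : Measurable fun x => (v n x, X x) := hvX.mono (hw.pastEvents_le n) le_rfl
  have hκ := hw.measurable_kappa n
  have : IsProbabilityMeasure (P.map fun x => ((v n x, X x), κ n x)) :=
    Measure.isProbabilityMeasure_map (hvX'.prodMk hκ).aemeasurable
  have : IsProbabilityMeasure (P.map fun x => (v n x, X x)) :=
    Measure.isProbabilityMeasure_map hvX'.aemeasurable
  refine Measure.ext_prod fun {s t} hs ht => ?_
  rw [Measure.map_apply (hvX'.prodMk hκ) (hs.prod ht), Measure.compProd_apply_prod hs ht,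
    setLIntegral_map hs (ProbabilityTheory.Kernel.measurable_coe _ ht) hvX']
  simp only [ProbabilityTheory.Kernel.comap_apply, kappaKernel_apply]
  exact hw.law n _ (hvX hs) t ht

/-- A statement that holds almost surely for every velocity holds along the walk. -/
lemma IsVelocityWalk.ae_of_forall (hw : IsVelocityWalk g ω ν P v₀ v κ) (hg : Prof 3 g) (n : ℕ)
    {p : E d × Kappa d m → Prop} (hp : MeasurableSet {q | p q})
    (h : ∀ w, ∀ᵐ k ∂(kappaLaw m ν w), p (w, k)) : ∀ᵐ x ∂P, p (v n x, κ n x) := by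
  have hvX : Measurable fun x => (v n x, (0 : ℝ)) :=
    ((hw.measurable_velocity hg n).mono (hw.pastEvents_le n) le_rfl).prodMk measurable_const
  have : IsProbabilityMeasure (P.map fun x => (v n x, (0 : ℝ))) :=
    Measure.isProbabilityMeasure_map hvX.aemeasurable
  have hmap := hw.map_eq hg n (X := fun _ => 0) measurable_const
  have hp' : MeasurableSet {q : (E d × ℝ) × Kappa d m | p (q.1.1, q.2)} :=
    (by fun_prop : Measurable fun q : (E d × ℝ) × Kappa d m => (q.1.1, q.2)) hp
  have hae := (Measure.ae_compProd_iff (μ := P.map fun x => (v n x, (0 : ℝ)))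
    (κ := (kappaKernel m ν).comap (Prod.fst : E d × ℝ → E d) measurable_fst) hp').2
    (ae_of_all _ fun a => by
      rw [ProbabilityTheory.Kernel.comap_apply, kappaKernel_apply]
      exact h a.1)
  rw [← hmap] at hae
  exact ae_of_ae_map (hvX.prodMk (hw.measurable_kappa n)).aemeasurable hae

/-- Conditional expectations given the past are averages over the scattering parameters. -/
lemma IsVelocityWalk.integral_mul_eq (hw : IsVelocityWalk g ω ν P v₀ v κ) (hg : Prof 3 g) (n : ℕ)
    {X : Ω → ℝ} (hX : Measurable[pastEvents κ n] X) {C : ℝ} (hXC : ∀ x, |X x| ≤ C)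
    {f : E d × Kappa d m → ℝ} (hf : Measurable f) {A : ℝ} (hfA : ∀ q, |f q| ≤ A) {a : ℝ}
    (ha : ∀ᵐ x ∂P, ∫ k, f (v n x, k) ∂(kappaLaw m ν (v n x)) = a) :
    ∫ x, X x * f (v n x, κ n x) ∂P = (∫ x, X x ∂P) * a := by
  have hX' : Measurable X := hX.mono (hw.pastEvents_le n) le_rfl
  have hv' : Measurable (v n) := (hw.measurable_velocity hg n).mono (hw.pastEvents_le n) le_rfl
  have hvX : Measurable fun x => (v n x, X x) := hv'.prodMk hX'
  have hκ := hw.measurable_kappa n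
  have : IsProbabilityMeasure (P.map fun x => (v n x, X x)) :=
    Measure.isProbabilityMeasure_map hvX.aemeasurable
  have hF : Measurable fun q : (E d × ℝ) × Kappa d m => q.1.2 * f (q.1.1, q.2) :=
    (by fun_prop : Measurable fun q : (E d × ℝ) × Kappa d m => q.1.2).mul
      (hf.comp (by fun_prop : Measurable fun q : (E d × ℝ) × Kappa d m => (q.1.1, q.2)))
  have h1 : ∫ x, X x * f (v n x, κ n x) ∂P =
      ∫ q, q.1.2 * f (q.1.1, q.2) ∂(P.map fun x => ((v n x, X x), κ n x)) :=
    (integral_map (hvX.prodMk hκ).aemeasurable hF.aestronglyMeasurable).symm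
  have hint : Integrable (fun q : (E d × ℝ) × Kappa d m => q.1.2 * f (q.1.1, q.2))
      (P.map fun x => ((v n x, X x), κ n x)) := by
    rw [integrable_map_measure hF.aestronglyMeasurable (hvX.prodMk hκ).aemeasurable]
    refine Integrable.of_bound (hF.comp (hvX.prodMk hκ)).aestronglyMeasurable (C * A)
      (ae_of_all _ fun x => ?_)
    rw [Function.comp_apply, norm_mul]
    exact mul_le_mul (hXC x) (hfA _) (norm_nonneg _) ((abs_nonneg _).trans (hXC x))
  have hmap := hw.map_eq hg n hX
  rw [hmap] at h1 hint
  rw [h1, Measure.integral_compProd hint]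
  simp only [ProbabilityTheory.Kernel.comap_apply, kappaKernel_apply, integral_const_mul]
  have hs : StronglyMeasurable fun w : E d => ∫ k, f (w, k) ∂(kappaKernel m ν w) :=
    StronglyMeasurable.integral_kernel_prod_right' hf.stronglyMeasurable
  simp only [kappaKernel_apply] at hs
  have hs' : Measurable fun p : E d × ℝ => p.2 * ∫ k, f (p.1, k) ∂(kappaLaw m ν p.1) :=
    measurable_snd.mul (hs.measurable.comp measurable_fst)
  rw [integral_map hvX.aemeasurable hs'.aestronglyMeasurable, ← integral_mul_const]
  exact integral_congr_ae (ha.mono fun x hx => by simp only [hx])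

lemma IsVelocityWalk.integral_eq (hw : IsVelocityWalk g ω ν P v₀ v κ) (hg : Prof 3 g) (n : ℕ)
    {f : E d × Kappa d m → ℝ} (hf : Measurable f) {A : ℝ} (hfA : ∀ q, |f q| ≤ A) {a : ℝ}
    (ha : ∀ᵐ x ∂P, ∫ k, f (v n x, k) ∂(kappaLaw m ν (v n x)) = a) :
    ∫ x, f (v n x, κ n x) ∂P = a := by
  have h := hw.integral_mul_eq hg n (X := fun _ => 1) measurable_const (C := 1) (by simp) hf hfA ha
  simpa using h

/-- Centred functions of the velocity and the parameters at different times are uncorrelated. -/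
lemma IsVelocityWalk.integral_mul_eq_zero (hw : IsVelocityWalk g ω ν P v₀ v κ) (hg : Prof 3 g)
    {n n' : ℕ} (hn : n ≠ n') {f f' : E d × Kappa d m → ℝ} (hf : Measurable f) (hf' : Measurable f')
    {A A' : ℝ} (hfA : ∀ q, |f q| ≤ A) (hfA' : ∀ q, |f' q| ≤ A')
    (ha : ∀ᵐ x ∂P, ∫ k, f (v n x, k) ∂(kappaLaw m ν (v n x)) = 0)
    (ha' : ∀ᵐ x ∂P, ∫ k, f' (v n' x, k) ∂(kappaLaw m ν (v n' x)) = 0) :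
    ∫ x, f (v n x, κ n x) * f' (v n' x, κ n' x) ∂P = 0 := by
  have past : ∀ {n n' : ℕ}, n < n' → ∀ {f : E d × Kappa d m → ℝ}, Measurable f →
      Measurable[pastEvents κ n'] fun x => f (v n x, κ n x) := fun {n n'} h f hf =>
    hf.comp (((hw.measurable_velocity hg n).mono (pastEvents_mono κ h.le) le_rfl).prodMk
      (measurable_pastEvents_kappa κ h))
  -- The factor at the earlier time belongs to the past of the later one, whose conditional mean is
  -- zero.
  rcases lt_or_gt_of_ne hn with h | h
  · rw [hw.integral_mul_eq hg n' (past h hf) (fun x => hfA _) hf' hfA' ha', mul_zero]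
  · simp only [mul_comm (f _)]
    rw [hw.integral_mul_eq hg n (past h hf') (fun x => hfA' _) hf hfA ha, mul_zero]

end walk

/-! ### The energy transfer along the walk -/

section walkEnergy

variable {d m : ℕ} {ν : Measure ℝ} {g : E d → Torus m → E d} {ω : E m}

open Classical in
/-- The coefficient `β^(ℓ)` as a bounded function of the velocity and the parameters. -/
noncomputable def betaV (g : E d → Torus m → E d) (ω : E m) (l : ℕ) (q : E d × Kappa d m) : ℝ :=
  if q.1 ≠ 0 ∧ Admissible q.1 q.2 then betaE g ω l (dir q.1) q.2 else 0

lemma measurableSet_admissible :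
    MeasurableSet {q : E d × Kappa d m | Admissible q.1 q.2} := by
  have h1 : MeasurableSet {q : E d × Kappa d m | ⟪q.2.1, q.1⟫ = 0} :=
    measurableSet_eq_fun (by fun_prop) measurable_const
  have h2 : MeasurableSet {q : E d × Kappa d m | ‖q.2.1‖ ≤ 1 / 2} :=
    measurableSet_le (by fun_prop) measurable_const
  have h3 : MeasurableSet {q : E d × Kappa d m | q.2.2.2.2 ∈ Set.Icc (-1 : ℝ) 1} :=
    (by fun_prop : Measurable fun q : E d × Kappa d m => q.2.2.2.2) measurableSet_Icc
  exact h1.inter (h2.inter h3)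

lemma measurable_betaV (hg : Prof 3 g) (ω : E m) (l : ℕ) : Measurable (betaV g ω l) := by
  have h0 : MeasurableSet {q : E d × Kappa d m | q.1 ≠ 0} :=
    (measurable_fst (measurableSet_singleton (0 : E d))).compl
  refine Measurable.ite (h0.inter measurableSet_admissible) ?_ measurable_const
  exact (continuous_betaE hg ω l).measurable.comp
    ((measurable_dir.comp measurable_fst).prodMk measurable_snd)

lemma exists_betaV_bound (hg : Prof 3 g) (ω : E m) :
    ∃ A, 0 ≤ A ∧ ∀ l ≤ 2, ∀ q : E d × Kappa d m, |betaV g ω l q| ≤ A := by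
  obtain ⟨A, hA0, hA⟩ := exists_betaE_bound hg ω
  refine ⟨A, hA0, fun l hl q => ?_⟩
  rw [betaV]
  split_ifs with h
  · exact hA l hl _ _ (norm_dir h.1) ((admissible_dir_iff h.1 _).2 h.2)
  · rwa [abs_zero]

lemma betaV_eq {v : E d} (hv : v ≠ 0) {κ : Kappa d m} (hκ : Admissible v κ) (l : ℕ) :
    betaV g ω l (v, κ) = betaE g ω l (dir v) κ :=
  if_pos ⟨hv, hκ⟩

lemma integral_comp_betaV (hν : ∀ᵐ c ∂ν, c ∈ Set.Icc (-1 : ℝ) 1) {v : E d} (hv : v ≠ 0)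
    (F : ℝ → ℝ → ℝ) (l l' : ℕ) :
    ∫ k, F (betaV g ω l (v, k)) (betaV g ω l' (v, k)) ∂(kappaLaw m ν v) =
      ∫ k, F (betaE g ω l (dir v) k) (betaE g ω l' (dir v) k) ∂(kappaLaw m ν (dir v)) := by
  rw [kappaLaw_dir hv]
  refine integral_congr_ae ((ae_admissible hν v).mono fun k hk => ?_)
  simp only [betaV_eq hv hk]

variable [IsProbabilityMeasure ν] {Ω : Type u} [MeasurableSpace Ω] {P : Measure Ω}
  [IsProbabilityMeasure P] {v₀ : E d} {v : ℕ → Ω → E d} {κ : ℕ → Ω → Kappa d m}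

/-- `beta` is defined through limits and is known explicitly only at admissible parameters. The walk
is almost surely admissible, so `betaV`, measurable and bounded everywhere, may take its place. -/
lemma IsVelocityWalk.beta_ae_eq (hw : IsVelocityWalk g ω ν P v₀ v κ) (hg : Prof 3 g)
    (hν : ∀ᵐ c ∂ν, c ∈ Set.Icc (-1 : ℝ) 1) {n : ℕ} (hn : ∀ᵐ x ∂P, v n x ≠ 0) {l : ℕ} (hl : l ≤ 2) :
    (fun x => beta g ω l (dir (v n x)) (κ n x)) =ᵐ[P] fun x => betaV g ω l (v n x, κ n x) := by
  filter_upwards [hn, hw.ae_of_forall hg n measurableSet_admissible (ae_admissible hν)] with x h0 hx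
  rw [betaV_eq h0 hx, beta_eq hg (norm_dir h0) ((admissible_dir_iff h0 _).2 hx) l hl]

/-- The correlations of the coefficients along the walk. -/
theorem IsVelocityWalk.beta_correlations (hw : IsVelocityWalk g ω ν P v₀ v κ) (hd : 1 ≤ d)
    (hg : Prof 3 g) (hν : ∀ᵐ c ∂ν, c ∈ Set.Icc (-1 : ℝ) 1) (hcentered : ∫ c, c ∂ν = 0) {N : ℕ}
    (hne : ∀ n ≤ N, ∀ᵐ x ∂P, v n x ≠ 0) :
    (∀ n ≤ N, ∀ l ≤ 2, MemLp (fun x => beta g ω l (dir (v n x)) (κ n x)) 2 P) ∧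
    (∀ n ≤ N, ∫ x, beta g ω 2 (dir (v n x)) (κ n x) ∂P - Bcoef g ν = 0) ∧
    (∀ n ≤ N, ∀ l ≤ 1, ∫ x, beta g ω l (dir (v n x)) (κ n x) ∂P = 0) ∧
    (∀ n ≤ N, ∀ n' ≤ N, n ≠ n' →
      (∀ l ≤ 1, ∀ l' ≤ 1,
        ∫ x, beta g ω l (dir (v n x)) (κ n x) * beta g ω l' (dir (v n' x)) (κ n' x) ∂P = 0) ∧
      (∀ l ≤ 1,
        ∫ x, beta g ω l (dir (v n x)) (κ n x) *
          (beta g ω 2 (dir (v n' x)) (κ n' x) - Bcoef g ν) ∂P = 0) ∧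
      ∫ x, (beta g ω 2 (dir (v n x)) (κ n x) - Bcoef g ν) *
        (beta g ω 2 (dir (v n' x)) (κ n' x) - Bcoef g ν) ∂P = 0) ∧
    ((d = 1 → ∀ n ≤ N, ∀ᵐ x ∂P, dir (v n x) = dir v₀) →
      ∀ n ≤ N, ∀ n' ≤ N, ∀ l ≤ 2,
        ∫ x, beta g ω l (dir (v n x)) (κ n x) * beta g ω 2 (dir (v n x)) (κ n x) ∂P =
          ∫ x, beta g ω l (dir (v n' x)) (κ n' x) *
            beta g ω 2 (dir (v n' x)) (κ n' x) ∂P) := by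
  obtain ⟨A, hA0, hA⟩ := exists_betaV_bound (d := d) hg ω
  have hm := measurable_betaV hg ω
  have hae : ∀ n ≤ N, ∀ l ≤ 2, (fun x => beta g ω l (dir (v n x)) (κ n x)) =ᵐ[P]
      fun x => betaV g ω l (v n x, κ n x) := fun n hn l hl => hw.beta_ae_eq hg hν (hne n hn) hl
  have hvκ : ∀ n, Measurable fun x => (v n x, κ n x) := fun n =>
    ((hw.measurable_velocity hg n).mono (hw.pastEvents_le n) le_rfl).prodMk (hw.measurable_kappa n)
  have mean01 : ∀ n ≤ N, ∀ l ≤ 1,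
      ∀ᵐ x ∂P, ∫ k, betaV g ω l (v n x, k) ∂(kappaLaw m ν (v n x)) = 0 := fun n hn l hl =>
    (hne n hn).mono fun x hx => by
      rw [integral_comp_betaV hν hx (fun a _ => a) l l,
        integral_betaE_eq_zero hcentered hg (norm_dir hx) hl]
  have mean2 : ∀ n ≤ N,
      ∀ᵐ x ∂P, ∫ k, betaV g ω 2 (v n x, k) ∂(kappaLaw m ν (v n x)) = Bcoef g ν := fun n hn =>
    (hne n hn).mono fun x hx => by
      rw [integral_comp_betaV hν hx (fun a _ => a) 2 2,
        integral_betaE_two hd hν hcentered hg (norm_dir hx)]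
  have mean2' : ∀ n ≤ N, ∀ᵐ x ∂P,
      ∫ k, (betaV g ω 2 (v n x, k) - Bcoef g ν) ∂(kappaLaw m ν (v n x)) = 0 := fun n hn =>
    (mean2 n hn).mono fun x hx => by
      have hi : Integrable (fun k => betaV g ω 2 (v n x, k)) (kappaLaw m ν (v n x)) :=
        Integrable.of_bound ((hm 2).comp measurable_prodMk_left).aestronglyMeasurable A
          (ae_of_all _ fun k => hA 2 le_rfl _)
      rw [integral_sub hi (integrable_const _), hx, integral_const, probReal_univ, one_smul, sub_self]
  have hm2 : Measurable fun q : E d × Kappa d m => betaV g ω 2 q - Bcoef g ν :=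
    (hm 2).sub measurable_const
  have hA2 : ∀ q : E d × Kappa d m, |betaV g ω 2 q - Bcoef g ν| ≤ A + |Bcoef g ν| := fun q =>
    (abs_sub _ _).trans (add_le_add (hA 2 le_rfl q) le_rfl)
  refine ⟨fun n hn l hl => ?_, fun n hn => ?_, fun n hn l hl => ?_, fun n hn n' hn' hnn =>
    ⟨fun l hl l' hl' => ?_, fun l hl => ?_, ?_⟩, fun hrev n hn n' hn' l hl => ?_⟩
  · exact (MemLp.of_bound ((hm l).comp (hvκ n)).aestronglyMeasurable A
      (ae_of_all _ fun x => hA l hl _)).ae_eq (hae n hn l hl).symm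
  · rw [integral_congr_ae (hae n hn 2 le_rfl),
      hw.integral_eq hg n (hm 2) (hA 2 le_rfl) (mean2 n hn), sub_self]
  · rw [integral_congr_ae (hae n hn l (by omega)),
      hw.integral_eq hg n (hm l) (hA l (by omega)) (mean01 n hn l hl)]
  · refine (integral_congr_ae ((hae n hn l (by omega)).mul (hae n' hn' l' (by omega)))).trans ?_
    exact hw.integral_mul_eq_zero hg hnn (hm l) (hm l') (hA l (by omega)) (hA l' (by omega))
      (mean01 n hn l hl) (mean01 n' hn' l' hl')
  · refine (integral_congr_ae ((hae n hn l (by omega)).mul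
      ((hae n' hn' 2 le_rfl).sub (EventuallyEq.refl _ fun _ => Bcoef g ν)))).trans ?_
    exact hw.integral_mul_eq_zero hg hnn (hm l) hm2 (hA l (by omega)) hA2
      (mean01 n hn l hl) (mean2' n' hn')
  · refine (integral_congr_ae
      (((hae n hn 2 le_rfl).sub (EventuallyEq.refl _ fun _ => Bcoef g ν)).mul
        ((hae n' hn' 2 le_rfl).sub (EventuallyEq.refl _ fun _ => Bcoef g ν)))).trans ?_
    exact hw.integral_mul_eq_zero hg hnn hm2 hm2 hA2 hA2 (mean2' n hn) (mean2' n' hn')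
  -- The conditional second moment is a constant: for d ≥ 2 by rotation invariance, for d = 1
  -- because the direction is assumed not to change.
  · obtain ⟨a, ha⟩ : ∃ a, ∀ n ≤ N, ∀ᵐ x ∂P,
        ∫ k, betaV g ω l (v n x, k) * betaV g ω 2 (v n x, k) ∂(kappaLaw m ν (v n x)) = a := by
      by_cases hd1 : d = 1
      · refine ⟨∫ k, betaE g ω l (dir v₀) k * betaE g ω 2 (dir v₀) k ∂(kappaLaw m ν (dir v₀)),
          fun n hn => ?_⟩
        filter_upwards [hne n hn, hrev hd1 n hn] with x hx hx'
        rw [integral_comp_betaV hν hx (fun a b => a * b) l 2, hx']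
      · obtain ⟨e, he⟩ := exists_norm_eq_one hd
        refine ⟨∫ k, betaE g ω l e k * betaE g ω 2 e k ∂(kappaLaw m ν e), fun n hn => ?_⟩
        filter_upwards [hne n hn] with x hx
        rw [integral_comp_betaV hν hx (fun a b => a * b) l 2,
          integral_betaE_mul_eq (by omega) hg (norm_dir hx) he]
    have key : ∀ n ≤ N, ∫ x, beta g ω l (dir (v n x)) (κ n x) *
        beta g ω 2 (dir (v n x)) (κ n x) ∂P = a := fun n hn => by
      refine (integral_congr_ae ((hae n hn l hl).mul (hae n hn 2 le_rfl))).trans ?_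
      refine hw.integral_eq hg n (f := fun q => betaV g ω l q * betaV g ω 2 q) ((hm l).mul (hm 2))
        (A := A * A) (fun q => ?_) (ha n hn)
      rw [abs_mul]
      exact mul_le_mul (hA l hl q) (hA 2 le_rfl q) (abs_nonneg _) hA0
    rw [key n hn, key n' hn']

end walkEnergy

end InelasticScattering

/-! ### Assembly: transfer from the explicit coefficients to `alpha` and `beta`. -/

theorem mainTheorem2 {d m : ℕ} (hd : 1 ≤ d) (ω : E m) (hω : ‖ω‖ = 1)
    (g : E d → Torus m → E d) (hg : IsForceProfile g)
    (ν : Measure ℝ) [IsProbabilityMeasure ν] (hν : ∀ᵐ c ∂ν, c ∈ Set.Icc (-1 : ℝ) 1)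
    (hν0 : ν ≠ Measure.dirac 0) (hcentered : ∫ c, c ∂ν = 0) :
    -- the coefficients `α^(1)`, `α^(2)`, `α^(3)` exist: expansion of `R`, uniform in all variables
    (∃ C V : ℝ, 0 < V ∧ ∀ (v : E d) (κ : Kappa d m), V ≤ ‖v‖ → Admissible v κ →
      ‖R g ω v κ - ∑ k ∈ Finset.Icc 1 3, (‖v‖ ^ k)⁻¹ • alpha g ω k (dir v) κ‖ ≤ C / ‖v‖ ^ 4) ∧
    (∀ (e : E d) (κ : Kappa d m), ‖e‖ = 1 → Admissible e κ →
      alpha g ω 1 e κ = alphaOne g e κ ∧ alpha g ω 2 e κ = alphaTwo g ω e κ) ∧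
    -- (i) the means of `α^(1)` and `α^(2)`
    (∀ e : E d, ‖e‖ = 1 → ∀ k ∈ ({1, 2} : Set ℕ),
      Integrable (alpha g ω k e) (kappaLaw m ν e) ∧
      ∫ κ, alpha g ω k e κ ∂(kappaLaw m ν e) = 0) ∧
    -- the mean and the mean square of the energy change
    (∀ᶠ v in Bornology.cobounded (E d), MemLp (deltaE g ω v) 2 (kappaLaw m ν v)) ∧
    (fun v : E d => ∫ κ, deltaE g ω v κ ∂(kappaLaw m ν v) - Bcoef g ν / ‖v‖ ^ 2)
      =O[Bornology.cobounded (E d)] (fun v => (‖v‖ ^ 3)⁻¹) ∧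
    (fun v : E d => ∫ κ, deltaE g ω v κ ^ 2 ∂(kappaLaw m ν v) - Dsq g ν)
      =O[Bornology.cobounded (E d)] (fun v => ‖v‖⁻¹) ∧
    0 ≤ Dsq g ν ∧
    -- the means of the `β^(ℓ)`
    (∀ e : E d, ‖e‖ = 1 →
      (∀ l ≤ 2, MemLp (beta g ω l e) 2 (kappaLaw m ν e)) ∧
      (∀ l ≤ 1, ∫ κ, beta g ω l e κ ∂(kappaLaw m ν e) = 0) ∧
      ∫ κ, beta g ω 2 e κ ∂(kappaLaw m ν e) = Bcoef g ν ∧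
      ∫ κ, beta g ω 0 e κ ^ 2 ∂(kappaLaw m ν e) = Dsq g ν) ∧
    -- positivity of `D'`
    (0 < Real.sqrt (Dsq g ν) ↔
      ∃ (e : E d) (κ : Kappa d m), ‖e‖ = 1 ∧ Admissible e κ ∧ beta g ω 0 e κ ≠ 0) ∧
    ((∃ (e : E d) (κ : Kappa d m), ‖e‖ = 1 ∧ Admissible e κ ∧ beta g ω 0 e κ ≠ 0) →
      ¬ IsGradientField g) ∧
    -- (ii) the random walk, as long as the directions `e_0, …, e_N` are defined
    (∀ (Ω : Type u) [MeasurableSpace Ω] (P : Measure Ω) [IsProbabilityMeasure P] (v₀ : E d)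
      (v : ℕ → Ω → E d) (κ : ℕ → Ω → Kappa d m), IsVelocityWalk g ω ν P v₀ v κ →
      ∀ N : ℕ, (∀ n ≤ N, ∀ᵐ x ∂P, v n x ≠ 0) →
      (∀ n ≤ N, ∀ l ≤ 2, MemLp (fun x => beta g ω l (dir (v n x)) (κ n x)) 2 P) ∧
      (∀ n ≤ N, ∫ x, beta g ω 2 (dir (v n x)) (κ n x) ∂P - Bcoef g ν = 0) ∧
      (∀ n ≤ N, ∀ l ≤ 1, ∫ x, beta g ω l (dir (v n x)) (κ n x) ∂P = 0) ∧
      (∀ n ≤ N, ∀ n' ≤ N, n ≠ n' →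
        (∀ l ≤ 1, ∀ l' ≤ 1,
          ∫ x, beta g ω l (dir (v n x)) (κ n x) * beta g ω l' (dir (v n' x)) (κ n' x) ∂P = 0) ∧
        (∀ l ≤ 1,
          ∫ x, beta g ω l (dir (v n x)) (κ n x) *
            (beta g ω 2 (dir (v n' x)) (κ n' x) - Bcoef g ν) ∂P = 0) ∧
        ∫ x, (beta g ω 2 (dir (v n x)) (κ n x) - Bcoef g ν) *
          (beta g ω 2 (dir (v n' x)) (κ n' x) - Bcoef g ν) ∂P = 0) ∧
      -- in dimension one as long as the direction of motion is not reversed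
      ((d = 1 → ∀ n ≤ N, ∀ᵐ x ∂P, dir (v n x) = dir v₀) →
        ∀ n ≤ N, ∀ n' ≤ N,
          ∫ x, beta g ω 2 (dir (v n x)) (κ n x) ^ 2 ∂P =
            ∫ x, beta g ω 2 (dir (v n' x)) (κ n' x) ^ 2 ∂P ∧
          ∀ l ≤ 1,
            ∫ x, beta g ω l (dir (v n x)) (κ n x) * beta g ω 2 (dir (v n x)) (κ n x) ∂P =
              ∫ x, beta g ω l (dir (v n' x)) (κ n' x) *
                beta g ω 2 (dir (v n' x)) (κ n' x) ∂P)) := by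
  have hp : Prof 3 g := hg.prof
  have hα : ∀ e : E d, ‖e‖ = 1 → ∀ k ≤ 3,
      alphaE g ω k e =ᵐ[kappaLaw m ν e] alpha g ω k e := fun e he k hk =>
    (ae_admissible hν e).mono fun κ hκ => (alpha_eq hp he hκ k hk).symm
  have hβ : ∀ e : E d, ‖e‖ = 1 → ∀ l ≤ 2,
      betaE g ω l e =ᵐ[kappaLaw m ν e] beta g ω l e := fun e he l hl =>
    (ae_admissible hν e).mono fun κ hκ => (beta_eq hp he hκ l hl).symm
  have hβ0 : (∃ (e : E d) (κ : Kappa d m), ‖e‖ = 1 ∧ Admissible e κ ∧ beta g ω 0 e κ ≠ 0) ↔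
      ∃ (e : E d) (κ : Kappa d m), ‖e‖ = 1 ∧ Admissible e κ ∧ betaE g ω 0 e κ ≠ 0 := by
    refine exists_congr fun e => exists_congr fun κ => and_congr_right fun he =>
      and_congr_right fun hκ => ?_
    rw [beta_eq hp he hκ 0 (Nat.zero_le 2)]
  obtain ⟨hΔ1, hΔ2, hΔ3⟩ := deltaE_asymptotics hd hν hcentered hp ω
  refine ⟨?_, fun e κ he hκ => ⟨?_, ?_⟩, fun e he k hk => ?_, hΔ1, hΔ2, hΔ3, Dsq_nonneg hd hp,
    fun e he => ⟨fun l hl => ?_, fun l hl => ?_, ?_, ?_⟩, ?_, ?_, ?_⟩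
  · obtain ⟨C, V, -, hV, hC⟩ := exists_R_expansion hp ω
    refine ⟨C, V, by linarith, fun v κ hv hκ => ?_⟩
    have hv0 : v ≠ 0 := norm_pos_iff.1 (by linarith)
    have h := alpha_eq (ω := ω) hp (norm_dir hv0) ((admissible_dir_iff hv0 κ).2 hκ)
    have hsum : ∑ k ∈ Finset.Icc 1 3, (‖v‖ ^ k)⁻¹ • alpha g ω k (dir v) κ =
        (‖v‖ ^ 1)⁻¹ • alphaE g ω 1 (dir v) κ + (‖v‖ ^ 2)⁻¹ • alphaE g ω 2 (dir v) κ +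
          (‖v‖ ^ 3)⁻¹ • alphaE g ω 3 (dir v) κ := by
      rw [← h 1 (by norm_num), ← h 2 (by norm_num), ← h 3 le_rfl]
      simp [Finset.sum_Icc_succ_top]
    rw [hsum]
    exact hC v κ hv hκ
  · rw [alpha_eq hp he hκ 1 (by norm_num), alphaE_one_eq hp he hκ]
  · rw [alpha_eq hp he hκ 2 (by norm_num), alphaE_two_eq hp he hκ]
  · have hk3 : k ≤ 3 := by rcases hk with rfl | rfl <;> norm_num
    obtain ⟨A, -, hA⟩ := exists_alphaE_bound hp ω
    refine ⟨((memLp_kappaLaw hν (continuous_alphaE hp ω k e).aestronglyMeasurable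
      (fun κ hκ => hA k e κ he hκ) 1).integrable le_rfl).congr (hα e he k hk3), ?_⟩
    rw [← integral_congr_ae (hα e he k hk3), integral_alphaE_eq_zero hcentered hp e hk]
  · exact (memLp_betaE hν hp he hl 2).ae_eq (hβ e he l hl)
  · rw [← integral_congr_ae (hβ e he l (by omega)), integral_betaE_eq_zero hcentered hp he hl]
  · rw [← integral_congr_ae (hβ e he 2 le_rfl), integral_betaE_two hd hν hcentered hp he]
  · rw [← integral_betaE_zero_sq (ω := ω) hd hp he]
    exact integral_congr_ae ((hβ e he 0 (Nat.zero_le 2)).mono fun κ hκ => by simp only [hκ])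
  · rw [Real.sqrt_pos, hβ0]
    exact Dsq_pos_iff hd hν hν0 hp ω
  · rw [hβ0]
    rintro ⟨e, κ, he, hκ, h0⟩
    exact not_isGradientField hd hp he hκ h0
  · intro Ω _ P _ v₀ v κ hw N hne
    obtain ⟨h1, h2, h3, h4, h5⟩ := hw.beta_correlations hd hp hν hcentered hne
    refine ⟨h1, h2, h3, h4, fun hrev n hn n' hn' => ⟨?_, fun l hl => ?_⟩⟩
    · simpa only [sq] using h5 hrev n hn n' hn' 2 le_rfl
    · exact h5 hrev n hn n' hn' l (by omega)
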